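/- Let $R$ be a commutative ring. All modules are $\mathbb Z$-graded $R$-modules, differentials have degree $+1$, and algebras are unital; a multiplication is not required to be associative unless this is said. For maps from a dg coalgebra to a dg algebra put $\nabla f=d f-(-1)^{|f|}f d$ and $f\smile g=\mu(f\otimes g)\Delta$, where $(f\otimes g)(x\otimes y)=(-1)^{|g||x|}f(x)\otimes g(y)$. **Bar construction.** Let $A$ be a $1$-reduced associative dga ($A^{i}=0$ for $i<0$, $A^0=R\cdot 1\cong R$, $A^1=0$). Then $BA$ is the tensor coalgebra (with deconcatenation) on the desuspension of $A^{>0}$, $|[\bar a_1|\cdots|\bar a_n]|=\sum_i(|a_i|-1)$, with the differential $$d[\bar a_1|\cdots|\bar a_n]=-\sum_i(-1)^{\varepsilon_{i-1}}[\bar a_1|\cdots|\overline{da_i}|\cdots|\bar a_n]-\sum_{i<n}(-1)^{\varepsilon_i}[\bar a_1|\cdots|\overline{a_ia_{i+1}}|\cdots|\bar a_n],\qquad \varepsilon_i=\sum_{j\le i}(|a_j|-1).$$ **Hirsch algebra.** A Hirsch algebra is a $1$-reduced associative dga $A$ with multilinear maps $E_{p,q}:A^{\otimes p}\otimes A^{\otimes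 q}\to A$, $p,q\ge 0$, $p+q>0$, of degree $1-p-q$, such that $E_{1,0}=\mathrm{Id}=E_{0,1}$; $E_{p,0}=0=E_{0,q}$ for $p,q>1$; $E_{p,q}$ with $p,q\ge1$ vanishes when one of its arguments is $1$; and the map $E:BA\otimes BA\to A$, $E([\bar a_1|\cdots|\bar a_p]\otimes[\bar b_1|\cdots|\bar b_q])=E_{p,q}(a_1,\dots,a_p;b_1,\dots,b_q)$ (with $E([\,]\otimes[\,])=0$) satisfies $\nabla E=-E\smile E$. Its comultiplicative extension is a multiplication $\mu_E:BA\otimes BA\to BA$. **Hopf algebra and comodule.** Let $C$ be a dg Hopf algebra: a coassociative counital dg coalgebra with a unital multiplication that is a map of dg coalgebras (no antipode is required). Let $M$ be a dga that is a dga comodule over $C$: it has a coassociative counital left coaction $\Delta_M:M\to C\otimes M$ which is a map of dg algebras. Write $\Delta_M^k(m)=\sum c^1\otimes\cdots\otimes c^k\otimes m^{k+1}$ for the iterated coaction ($\Delta_M^0=\mathrm{Id}$). **Twisting cochain.** Let $\vartheta:C\to A$ be a multiplicative twisting cochain, that is, a linear map of degree $1$ with $\nabla\vartheta=-\vartheta\smile\vartheta$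 and values in $A^{>0}$ (automatic when $C$ is non-negatively graded), whose comultiplicative extension $C\to BA$, $c\mapsto\sum_n[\overline{\vartheta c^{(1)}}|\cdots|\overline{\vartheta c^{(n)}}]$, is a map of algebras for $\mu_E$. **Theorem.** Let $d_\vartheta=d\otimes \mathrm{Id}+\mathrm{Id}\otimes d+\vartheta\cap{-}$ on $A\otimes M$, where $(\mathrm{Id}\otimes d)(a\otimes m)=(-1)^{|a|}a\otimes dm$ and, with $\Delta_M(m)=\sum c\otimes m'$, $$\vartheta\cap(a\otimes m)=(-1)^{|a|+1}\sum a\,\vartheta(c)\otimes m'.$$ For $a_1,a_2\in A$ and $m_1,m_2\in M$, writing $\Delta_M^p(m_1)=\sum c_1^1\otimes\cdots\otimes c_1^p\otimes m_1^{p+1}$ and $\Delta_M^{q-1}(m_2)=\sum c_2^1\otimes\cdots\otimes c_2^{q-1}\otimes m_2^{q}$, put $$\mu_\vartheta\big((a_1\otimes m_1)\otimes(a_2\otimes m_2)\big)=\sum_{p\ge0,\;q\ge1}(-1)^{\epsilon}\,a_1E_{p,q}\big(\vartheta(c_1^1),\dots,\vartheta(c_1^p);a_2,\vartheta(c_2^1),\dots,\vartheta(c_2^{q-1})\big)\otimes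 m_1^{p+1}m_2^{q},$$ $$\epsilon=|c_1^1|+\cdots+|c_1^p|+|m_1^{p+1}|\big(|a_2|+|c_2^1|+\cdots+|c_2^{q-1}|\big).$$ For all $a_1,m_1,a_2,m_2$ only finitely many pairs $(p,q)$ contribute to this sum, and $A\otimes M$ with its total grading, the differential $d_\vartheta$, the multiplication $\mu_\vartheta$ and the unit $1\otimes1$ is a (unital, not necessarily associative) dga: $d_\vartheta^2=0$ and $d_\vartheta$ is a derivation of $\mu_\vartheta$. -/

import Mathlib

open scoped TensorProduct

noncomputable section

universe u v w x

/-! ## Differential graded modules, algebras, coalgebras -/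

/-- A cochain complex (`ℤ`-graded, differential of degree `+1`) of `R`-modules with total
module `V`. -/
structure DGModule (R : Type u) [CommRing R] (V : Type v) [AddCommGroup V] [Module R V] where
  gr : ℤ → Submodule R V
  isInternal : DirectSum.IsInternal gr
  d : V →ₗ[R] V
  d_mem : ∀ (i : ℤ) (a : V), a ∈ gr i → d a ∈ gr (i + 1)
  d_d : ∀ a : V, d (d a) = 0

namespace DGModule

variable {R : Type u} [CommRing R] {V : Type v} [AddCommGroup V] [Module R V]
  {W : Type w} [AddCommGroup W] [Module R W]

/-- The decomposition of an element into its homogeneous components. -/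
def decomp (X : DGModule R V) : V ≃ₗ[R] DirectSum ℤ (fun i => X.gr i) :=
  letI := X.isInternal.chooseDecomposition
  DirectSum.decomposeLinearEquiv X.gr

/-- The projection onto the sum of the components of even degree. -/
def even (X : DGModule R V) : V →ₗ[R] V :=
  DirectSum.toModule R ℤ V (fun i => if Even i then (X.gr i).subtype else 0) ∘ₗ
    X.decomp.toLinearMap

/-- The projection onto the sum of the components of odd degree. -/
def odd (X : DGModule R V) : V →ₗ[R] V :=
  DirectSum.toModule R ℤ V (fun i => if Even i then 0 else (X.gr i).subtype) ∘ₗ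
    X.decomp.toLinearMap

/-- The sign involution `a ↦ (-1)^|a| a`. -/
def sgn (X : DGModule R V) : V →ₗ[R] V := X.even - X.odd

/-- The total degree on a tensor product. -/
def tensorGr (X : DGModule R V) (Y : DGModule R W) (n : ℤ) : Submodule R (V ⊗[R] W) :=
  ⨆ i : ℤ, Submodule.map₂ (TensorProduct.mk R V W) (X.gr i) (Y.gr (n - i))

/-- The tensor product differential `d (a ⊗ b) = d a ⊗ b + (-1)^|a| a ⊗ d b`. -/
def tensorD (X : DGModule R V) (Y : DGModule R W) : V ⊗[R] W →ₗ[R] V ⊗[R] W :=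
  TensorProduct.map X.d LinearMap.id + TensorProduct.map X.sgn Y.d

/-- The span `V^{>0}` of the elements of positive degree. -/
def pos (X : DGModule R V) : Submodule R V := ⨆ i : ℤ, ⨆ _ : 0 < i, X.gr i

/-- The projection of `V` onto `V^{>0}` that kills the components of degree `≤ 0`. -/
def posProj (X : DGModule R V) : V →ₗ[R] X.pos :=
  DirectSum.toModule R ℤ X.pos
      (fun i => if h : 0 < i then
          Submodule.inclusion (le_iSup₂ (f := fun (i : ℤ) (_ : 0 < i) => X.gr i) i h)
        else 0) ∘ₗ
    X.decomp.toLinearMap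

end DGModule

/-- The interchange `(a ⊗ b) ⊗ (a' ⊗ b') ↦ (-1)^(|b| |a'|) (a ⊗ a') ⊗ (b ⊗ b')`, where `ev` and
`od` are the projections of `W` onto its even and odd parts and `s` is the sign involution
`a' ↦ (-1)^|a'| a'` of `V'`. -/
def koszulSwap {R : Type u} [CommRing R] {V W V' W' : Type*}
    [AddCommGroup V] [Module R V] [AddCommGroup W] [Module R W]
    [AddCommGroup V'] [Module R V'] [AddCommGroup W'] [Module R W']
    (ev od : W →ₗ[R] W) (s : V' →ₗ[R] V') :
    (V ⊗[R] W) ⊗[R] (V' ⊗[R] W') →ₗ[R] (V ⊗[R] V') ⊗[R] (W ⊗[R] W') :=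
  (TensorProduct.tensorTensorTensorComm R V W V' W').toLinearMap ∘ₗ
    (TensorProduct.map (TensorProduct.map LinearMap.id ev) LinearMap.id +
      TensorProduct.map (TensorProduct.map LinearMap.id od)
        (TensorProduct.map s LinearMap.id))

/-- A unital dg algebra; the multiplication is not required to be associative. -/
structure DGAlgebra (R : Type u) [CommRing R] (V : Type v) [AddCommGroup V] [Module R V]
    extends DGModule R V where
  mul : V →ₗ[R] V →ₗ[R] V
  one : V
  mul_mem : ∀ (i j : ℤ) (a b : V), a ∈ gr i → b ∈ gr j → mul a b ∈ gr (i + j)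
  one_mem : one ∈ gr 0
  one_mul : ∀ a : V, mul one a = a
  mul_one : ∀ a : V, mul a one = a
  leibniz : ∀ (i : ℤ) (a b : V), a ∈ gr i →
    d (mul a b) = mul (d a) b + (i.negOnePow : ℤ) • mul a (d b)

/-- The multiplication `(a ⊗ b)(a' ⊗ b') = (-1)^(|b| |a'|) a a' ⊗ b b'` on a tensor product of
dg algebras. -/
def DGAlgebra.tensorMul {R : Type u} [CommRing R] {V : Type v} [AddCommGroup V] [Module R V]
    {W : Type w} [AddCommGroup W] [Module R W] (X : DGAlgebra R V) (Y : DGAlgebra R W) :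
    (V ⊗[R] W) ⊗[R] (V ⊗[R] W) →ₗ[R] V ⊗[R] W :=
  TensorProduct.map (TensorProduct.lift X.mul) (TensorProduct.lift Y.mul) ∘ₗ
    koszulSwap Y.even Y.odd X.sgn

/-- A dg coalgebra: a coassociative counital coalgebra whose structure maps are chain maps of
degree `0`. -/
structure DGCoalgebra (R : Type u) [CommRing R] (V : Type v) [AddCommGroup V] [Module R V]
    extends DGModule R V, Coalgebra R V where
  comul_mem : ∀ (n : ℤ) (a : V), a ∈ gr n → comul a ∈ toDGModule.tensorGr toDGModule n
  comul_d : ∀ a : V, comul (d a) = toDGModule.tensorD toDGModule (comul a)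
  counit_eq_zero : ∀ (n : ℤ) (a : V), n ≠ 0 → a ∈ gr n → counit a = 0
  counit_d : ∀ a : V, counit (d a) = 0

/-- A dg Hopf algebra: a dg coalgebra with a unital, not necessarily associative multiplication
which is a map of dg coalgebras. No antipode is required. -/
structure DGHopfAlgebra (R : Type u) [CommRing R] (V : Type v) [AddCommGroup V] [Module R V]
    extends DGAlgebra R V, DGCoalgebra R V where
  comul_mul : ∀ a b : V,
    comul (mul a b) = toDGAlgebra.tensorMul toDGAlgebra (comul a ⊗ₜ[R] comul b)
  comul_one : comul one = one ⊗ₜ[R] one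
  counit_mul : ∀ a b : V, counit (mul a b) = counit a * counit b
  counit_one : counit one = 1

/-- A dga which is a (left) comodule over a dg Hopf algebra `H`: the coaction is coassociative
and counital and is a map of dg algebras. -/
structure DGComoduleAlgebra {R : Type u} [CommRing R] {C : Type v} [AddCommGroup C] [Module R C]
    (H : DGHopfAlgebra R C) (M : Type w) [AddCommGroup M] [Module R M]
    extends DGAlgebra R M where
  coact : M →ₗ[R] C ⊗[R] M
  coact_mem : ∀ (n : ℤ) (m : M), m ∈ gr n → coact m ∈ H.toDGModule.tensorGr toDGModule n
  coact_d : ∀ m : M, coact (d m) = H.toDGModule.tensorD toDGModule (coact m)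
  coact_coassoc : ∀ m : M,
    TensorProduct.assoc R C C M (TensorProduct.map H.comul LinearMap.id (coact m)) =
      TensorProduct.map LinearMap.id coact (coact m)
  coact_counit : ∀ m : M,
    TensorProduct.lid R M (TensorProduct.map H.counit LinearMap.id (coact m)) = m
  coact_mul : ∀ m n : M,
    coact (mul m n) = H.toDGAlgebra.tensorMul toDGAlgebra (coact m ⊗ₜ[R] coact n)
  coact_one : coact one = H.one ⊗ₜ[R] one

/-! ## Words: recursion on the tensor algebra -/

namespace Words

variable {R : Type u} [CommRing R] {W : Type v} [AddCommGroup W] [Module R W]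
  {P : Type w} [AddCommGroup P] [Module R P]

/-- Auxiliary map for `foldCons`. -/
def foldStep (G₁ : W →ₗ[R] TensorAlgebra R W →ₗ[R] P) (G₂ : W →ₗ[R] P →ₗ[R] P) :
    W →ₗ[R] Module.End R (TensorAlgebra R W × P) where
  toFun a := LinearMap.prod
    (LinearMap.mul R (TensorAlgebra R W) (TensorAlgebra.ι R a) ∘ₗ LinearMap.fst R _ _)
    (G₁ a ∘ₗ LinearMap.fst R _ _ + G₂ a ∘ₗ LinearMap.snd R _ _)
  map_add' a b := by
    refine LinearMap.ext fun z => Prod.ext ?_ ?_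
    · simp
    · simp; abel
  map_smul' r a := by
    refine LinearMap.ext fun z => Prod.ext ?_ ?_
    · simp
    · simp

/-- The linear map `F` on the tensor algebra with `F 1 = p₀` and
`F (a · t) = G₁ a t + G₂ a (F t)` for a letter `a` and a word `t`. -/
def foldCons (G₁ : W →ₗ[R] TensorAlgebra R W →ₗ[R] P) (G₂ : W →ₗ[R] P →ₗ[R] P) (p₀ : P) :
    TensorAlgebra R W →ₗ[R] P :=
  LinearMap.snd R _ _ ∘ₗ
    (LinearMap.applyₗ ((1 : TensorAlgebra R W), p₀)) ∘ₗ
      (TensorAlgebra.lift R (foldStep G₁ G₂)).toLinearMap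

theorem foldCons_one (G₁ : W →ₗ[R] TensorAlgebra R W →ₗ[R] P) (G₂ : W →ₗ[R] P →ₗ[R] P) (p₀ : P) :
    foldCons G₁ G₂ p₀ 1 = p₀ := by
  simp [foldCons]

theorem lift_foldStep_fst (G₁ : W →ₗ[R] TensorAlgebra R W →ₗ[R] P) (G₂ : W →ₗ[R] P →ₗ[R] P)
    (t : TensorAlgebra R W) (z : TensorAlgebra R W × P) :
    (TensorAlgebra.lift R (foldStep G₁ G₂) t z).1 = t * z.1 := by
  induction t using TensorAlgebra.induction generalizing z with
  | algebraMap r => simp [Algebra.smul_def]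
  | ι a => simp [foldStep]
  | mul s t hs ht => simp [hs, ht, mul_assoc]
  | add s t hs ht => simp [hs, ht, add_mul]

theorem foldCons_cons (G₁ : W →ₗ[R] TensorAlgebra R W →ₗ[R] P) (G₂ : W →ₗ[R] P →ₗ[R] P) (p₀ : P)
    (a : W) (t : TensorAlgebra R W) :
    foldCons G₁ G₂ p₀ (TensorAlgebra.ι R a * t) = G₁ a t + G₂ a (foldCons G₁ G₂ p₀ t) := by
  have h := lift_foldStep_fst G₁ G₂ t (1, p₀)
  rw [mul_one] at h
  have key : ∀ z : TensorAlgebra R W × P, (foldStep G₁ G₂ a z).2 = G₁ a z.1 + G₂ a z.2 :=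
    fun _ => rfl
  simp [foldCons, key, h]

/-- Splitting off the first letter: `a · t ↦ a ⊗ t`, and `1 ↦ 0`. -/
def peel : TensorAlgebra R W →ₗ[R] W ⊗[R] TensorAlgebra R W :=
  foldCons (TensorProduct.mk R W (TensorAlgebra R W)) 0 0

/-- Deconcatenation, `[a₁|…|aₙ] ↦ ∑ᵢ [a₁|…|aᵢ] ⊗ [aᵢ₊₁|…|aₙ]`, `0 ≤ i ≤ n`. -/
def deconcat : TensorAlgebra R W →ₗ[R] TensorAlgebra R W ⊗[R] TensorAlgebra R W :=
  foldCons
    (LinearMap.compr₂ (LinearMap.mul R (TensorAlgebra R W) ∘ₗ TensorAlgebra.ι R)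
      (TensorProduct.mk R _ _ 1))
    (LinearMap.rTensorHom (TensorAlgebra R W) ∘ₗ
      LinearMap.mul R (TensorAlgebra R W) ∘ₗ TensorAlgebra.ι R)
    (1 ⊗ₜ[R] 1)

/-- Given the projections `e`, `o` of the module of letters onto its even and odd parts, the
projections of words onto their even (first component) and odd (second component) parts. -/
def parity (e o : W →ₗ[R] W) :
    TensorAlgebra R W →ₗ[R] TensorAlgebra R W × TensorAlgebra R W :=
  foldCons 0
    (LinearMap.mk₂ R
      (fun a z => (TensorAlgebra.ι R (e a) * z.1 + TensorAlgebra.ι R (o a) * z.2,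
        TensorAlgebra.ι R (e a) * z.2 + TensorAlgebra.ι R (o a) * z.1))
      (fun a b z => by ext <;> simp [add_mul] <;> abel)
      (fun r a z => by ext <;> simp)
      (fun a y z => by ext <;> simp [mul_add] <;> abel)
      (fun r a z => by ext <;> simp))
    (1, 0)

/-- For a coalgebra `(D, Δ, ε)` and a linear map `φ : D → W`, the component
`φ^{⊗ n} Δ^{(n)} : D → W^{⊗ n}` of the comultiplicative extension `D → T W` of `φ`. -/
def coextComponent {D : Type w} [AddCommGroup D] [Module R D] (Δ : D →ₗ[R] D ⊗[R] D)
    (ε : D →ₗ[R] R) (φ : D →ₗ[R] W) : ℕ → D →ₗ[R] TensorAlgebra R W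
  | 0 => Algebra.linearMap R (TensorAlgebra R W) ∘ₗ ε
  | n + 1 => LinearMap.mul' R (TensorAlgebra R W) ∘ₗ
      TensorProduct.map (TensorAlgebra.ι R ∘ₗ φ) (coextComponent Δ ε φ n) ∘ₗ Δ

/-- The comultiplicative extension `∑ₙ φ^{⊗ n} Δ^{(n)} : D → T W` of `φ : D → W`. Below it is used
only where, for every element, almost all terms of the sum vanish. -/
def coextension {D : Type w} [AddCommGroup D] [Module R D] (Δ : D →ₗ[R] D ⊗[R] D)
    (ε : D →ₗ[R] R) (φ : D →ₗ[R] W) (z : D) : TensorAlgebra R W :=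
  ∑ᶠ n : ℕ, coextComponent Δ ε φ n z

/-- The map `[a₁|…|aₙ] ↦ [g a₁|…|g aₙ]` on words. -/
def map {W' : Type w} [AddCommGroup W'] [Module R W'] (g : W →ₗ[R] W') :
    TensorAlgebra R W →ₗ[R] TensorAlgebra R W' :=
  (TensorAlgebra.lift R (TensorAlgebra.ι R ∘ₗ g)).toLinearMap

/-- Multilinear maps `E_{p,q} : V^{⊗ p} ⊗ V^{⊗ q} → V` assembled to a bilinear map on words,
`([a₁|…|aₚ], [b₁|…|b_q]) ↦ E_{p,q}(a₁,…,aₚ; b₁,…,b_q)`. -/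
def evalOps (E : ∀ p q : ℕ, (⨂[R]^p W) →ₗ[R] (⨂[R]^q W) →ₗ[R] W) :
    TensorAlgebra R W →ₗ[R] TensorAlgebra R W →ₗ[R] W :=
  LinearMap.compl₁₂
    (DirectSum.toModule R ℕ ((DirectSum ℕ fun q => ⨂[R]^q W) →ₗ[R] W) fun p =>
      (DirectSum.toModule R ℕ ((⨂[R]^p W) →ₗ[R] W) fun q => (E p q).flip).flip)
    TensorAlgebra.toDirectSum.toLinearMap TensorAlgebra.toDirectSum.toLinearMap

end Words

/-! ## Twisting cochains -/

/-- The equation `∇ f = - f ⌣ f`, that is `d f + f d = - f ⌣ f`, for a map `f` of degree `1` from a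
dg coalgebra with differential `dD`, comultiplication `Δ` and sign involution `s` to a dg algebra
`X`; here `f ⌣ f` is the composite of `Δ`, of `f ⊗ f` (which sends `z ⊗ z'` to
`(-1)^|z| f z ⊗ f z'`) and of the multiplication of `X`. -/
def IsTwisting {R : Type u} [CommRing R] {D : Type v} [AddCommGroup D] [Module R D]
    {V : Type w} [AddCommGroup V] [Module R V] (dD : D →ₗ[R] D) (Δ : D →ₗ[R] D ⊗[R] D)
    (s : D →ₗ[R] D) (X : DGAlgebra R V) (f : D →ₗ[R] V) : Prop :=
  ∀ z : D, X.d (f z) + f (dD z) =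
    - TensorProduct.lift X.mul (TensorProduct.map (f ∘ₗ s) f (Δ z))

/-! ## The bar construction -/

namespace DGAlgebra

variable {R : Type u} [CommRing R] {V : Type v} [AddCommGroup V] [Module R V]

/-- The bar construction of a dga with `V⁰ = R · 1` and `Vⁿ = 0` for `n < 0`: the tensor coalgebra
on the desuspension of `V^{>0}`. The word `[a₁|…|aₙ]` is the product of the letters `aᵢ` and has
degree `∑ᵢ (|aᵢ| - 1)`. -/
abbrev Bar (X : DGAlgebra R V) : Type (max u v) := TensorAlgebra R X.pos

/-- The even part of a bar word. (A letter `a` has degree `|a| - 1`.) -/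
def barEven (X : DGAlgebra R V) : X.Bar →ₗ[R] X.Bar :=
  LinearMap.fst R _ _ ∘ₗ
    Words.parity (X.posProj ∘ₗ X.odd ∘ₗ X.pos.subtype) (X.posProj ∘ₗ X.even ∘ₗ X.pos.subtype)

/-- The odd part of a bar word. -/
def barOdd (X : DGAlgebra R V) : X.Bar →ₗ[R] X.Bar :=
  LinearMap.snd R _ _ ∘ₗ
    Words.parity (X.posProj ∘ₗ X.odd ∘ₗ X.pos.subtype) (X.posProj ∘ₗ X.even ∘ₗ X.pos.subtype)

/-- The sign involution of the bar construction. -/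
def barSgn (X : DGAlgebra R V) : X.Bar →ₗ[R] X.Bar := X.barEven - X.barOdd

/-- `a ↦ (-1)^(|a| - 1) a` on letters. -/
def letterSgn (X : DGAlgebra R V) : X.pos →ₗ[R] X.pos :=
  - (X.posProj ∘ₗ X.sgn ∘ₗ X.pos.subtype)

/-- Multiplication into the first letter: `(a, [a₁|a₂|…|aₙ]) ↦ [a a₁|a₂|…|aₙ]`, and
`(a, []) ↦ 0`. -/
def mulHead (X : DGAlgebra R V) : X.pos →ₗ[R] X.Bar →ₗ[R] X.Bar :=
  LinearMap.compl₂
    (TensorProduct.uncurry (RingHom.id R) X.pos X.Bar X.Bar ∘ₗ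
      LinearMap.llcomp R X.pos X.pos (X.Bar →ₗ[R] X.Bar)
        (LinearMap.mul R X.Bar ∘ₗ TensorAlgebra.ι R) ∘ₗ
      LinearMap.compl₁₂ (X.mul.compr₂ X.posProj) X.pos.subtype X.pos.subtype)
    Words.peel

/-- The differential of the bar construction,
`d [a₁|…|aₙ] = - ∑ᵢ (-1)^(εᵢ₋₁) [a₁|…|d aᵢ|…|aₙ] - ∑ᵢ (-1)^(εᵢ) [a₁|…|aᵢ aᵢ₊₁|…|aₙ]`
with `εᵢ = (|a₁| - 1) + ⋯ + (|aᵢ| - 1)`, by recursion on words: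
`d [a|t] = - [d a|t] - (-1)^(|a| - 1) [a t₁|t₂|…] + (-1)^(|a| - 1) [a|d t]`. -/
def barD (X : DGAlgebra R V) : X.Bar →ₗ[R] X.Bar :=
  Words.foldCons
    (- (LinearMap.mul R X.Bar ∘ₗ TensorAlgebra.ι R ∘ₗ X.posProj ∘ₗ X.d ∘ₗ X.pos.subtype)
      - X.mulHead ∘ₗ X.letterSgn)
    (LinearMap.mul R X.Bar ∘ₗ TensorAlgebra.ι R ∘ₗ X.letterSgn)
    0

/-- The differential of `BA ⊗ BA`. -/
def barBarD (X : DGAlgebra R V) : X.Bar ⊗[R] X.Bar →ₗ[R] X.Bar ⊗[R] X.Bar :=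
  TensorProduct.map X.barD LinearMap.id + TensorProduct.map X.barSgn X.barD

/-- The comultiplication of the tensor product coalgebra `BA ⊗ BA`. -/
def barBarComul (X : DGAlgebra R V) :
    X.Bar ⊗[R] X.Bar →ₗ[R] (X.Bar ⊗[R] X.Bar) ⊗[R] (X.Bar ⊗[R] X.Bar) :=
  koszulSwap X.barEven X.barOdd X.barSgn ∘ₗ TensorProduct.map Words.deconcat Words.deconcat

/-- The counit of `BA ⊗ BA`. -/
def barBarCounit (X : DGAlgebra R V) : X.Bar ⊗[R] X.Bar →ₗ[R] R :=
  LinearMap.mul' R R ∘ₗ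
    TensorProduct.map TensorAlgebra.algebraMapInv.toLinearMap
      TensorAlgebra.algebraMapInv.toLinearMap

/-- The sign involution of `BA ⊗ BA`. -/
def barBarSgn (X : DGAlgebra R V) : X.Bar ⊗[R] X.Bar →ₗ[R] X.Bar ⊗[R] X.Bar :=
  TensorProduct.map X.barSgn X.barSgn

/-- The map `BA ⊗ BA → A`,
`[a₁|…|aₚ] ⊗ [b₁|…|b_q] ↦ E_{p,q}(a₁,…,aₚ; b₁,…,b_q)`. -/
def barOps (X : DGAlgebra R V) (E : ∀ p q : ℕ, (⨂[R]^p V) →ₗ[R] (⨂[R]^q V) →ₗ[R] V) :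
    X.Bar ⊗[R] X.Bar →ₗ[R] V :=
  TensorProduct.lift (LinearMap.compl₁₂ (Words.evalOps E)
    (Words.map X.pos.subtype) (Words.map X.pos.subtype))

end DGAlgebra

/-! ## Hirsch algebras and multiplicative twisting cochains -/

/-- A Hirsch algebra: a 1-reduced associative dga `A` with operations
`E_{p,q} : A^{⊗ p} ⊗ A^{⊗ q} → A`, `p + q > 0` (with the convention `E_{0,0} = 0`), of degree
`1 - p - q`, such that `E_{1,0}` and `E_{0,1}` are the identity, `E_{p,0}` and `E_{0,q}` vanish
for `p, q > 1`, `E_{p,q}` for `p, q ≥ 1` vanishes if one of its arguments is the unit, and the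
resulting map `E : BA ⊗ BA → A` satisfies `∇ E = - E ⌣ E`. -/
structure HirschAlgebra (R : Type u) [CommRing R] (A : Type v) [AddCommGroup A] [Module R A]
    extends DGAlgebra R A where
  mul_assoc : ∀ a b c : A, mul (mul a b) c = mul a (mul b c)
  gr_neg : ∀ i : ℤ, i < 0 → gr i = ⊥
  gr_zero : gr 0 = Submodule.span R {one}
  smul_one_injective : Function.Injective (fun r : R => r • one)
  gr_one : gr 1 = ⊥
  E : ∀ p q : ℕ, (⨂[R]^p A) →ₗ[R] (⨂[R]^q A) →ₗ[R] A
  E_zero_zero : E 0 0 = 0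
  E_mem : ∀ (p q : ℕ) (i : Fin p → ℤ) (j : Fin q → ℤ) (a : Fin p → A) (b : Fin q → A),
    (∀ k, a k ∈ gr (i k)) → (∀ k, b k ∈ gr (j k)) →
      E p q (PiTensorProduct.tprod R a) (PiTensorProduct.tprod R b) ∈
        gr ((∑ k, i k) + (∑ k, j k) + 1 - p - q)
  E_one_left : ∀ (a : Fin 1 → A) (b : Fin 0 → A),
    E 1 0 (PiTensorProduct.tprod R a) (PiTensorProduct.tprod R b) = a 0
  E_one_right : ∀ (a : Fin 0 → A) (b : Fin 1 → A),
    E 0 1 (PiTensorProduct.tprod R a) (PiTensorProduct.tprod R b) = b 0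
  E_left : ∀ p : ℕ, 1 < p → E p 0 = 0
  E_right : ∀ q : ℕ, 1 < q → E 0 q = 0
  E_unit : ∀ (p q : ℕ) (a : Fin p → A) (b : Fin q → A), 1 ≤ p → 1 ≤ q →
    ((∃ k, a k = one) ∨ (∃ k, b k = one)) →
      E p q (PiTensorProduct.tprod R a) (PiTensorProduct.tprod R b) = 0
  E_twisting : IsTwisting toDGAlgebra.barBarD toDGAlgebra.barBarComul toDGAlgebra.barBarSgn
    toDGAlgebra (toDGAlgebra.barOps E)

/-- The multiplication `μ_E : BA ⊗ BA → BA` on the bar construction of a Hirsch algebra: the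
comultiplicative extension of `E : BA ⊗ BA → A`. -/
def HirschAlgebra.barMul {R : Type u} [CommRing R] {A : Type v} [AddCommGroup A] [Module R A]
    (X : HirschAlgebra R A) (z : X.Bar ⊗[R] X.Bar) : X.Bar :=
  Words.coextension X.barBarComul X.barBarCounit (X.posProj ∘ₗ X.barOps X.E) z

section Twisted

variable {R : Type u} [CommRing R] {A : Type v} [AddCommGroup A] [Module R A]
  {C : Type w} [AddCommGroup C] [Module R C] {M : Type x} [AddCommGroup M] [Module R M]

/-- A twisting cochain `C → A`: a map of degree `1` with `∇ ϑ = - ϑ ⌣ ϑ` whose composite with the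
augmentation of `A` vanishes. (The last condition concerns `C^{-1} → A⁰` only; it is void if `C`
is non-negatively graded.) -/
structure IsTwistingCochain (H : DGHopfAlgebra R C) (X : HirschAlgebra R A)
    (ϑ : C →ₗ[R] A) : Prop where
  map_mem : ∀ (i : ℤ) (c : C), c ∈ H.gr i → ϑ c ∈ X.gr (i + 1)
  map_neg_one : ∀ c : C, c ∈ H.gr (-1) → ϑ c = 0
  twisting : IsTwisting H.d H.comul H.sgn X.toDGAlgebra ϑ

/-- The comultiplicative extension `C → BA`, `c ↦ ∑ₙ [ϑ c⁽¹⁾|…|ϑ c⁽ⁿ⁾]`. -/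
def barExtension (H : DGHopfAlgebra R C) (X : HirschAlgebra R A) (ϑ : C →ₗ[R] A) (c : C) : X.Bar :=
  Words.coextension H.comul H.counit (X.posProj ∘ₗ ϑ) c

/-- A twisting cochain is multiplicative if its comultiplicative extension `C → BA` is a map of
algebras. -/
structure IsMultiplicativeTwistingCochain (H : DGHopfAlgebra R C) (X : HirschAlgebra R A)
    (ϑ : C →ₗ[R] A) : Prop extends IsTwistingCochain H X ϑ where
  map_one : barExtension H X ϑ H.one = 1
  map_mul : ∀ c c' : C, barExtension H X ϑ (H.mul c c') =
    X.barMul (barExtension H X ϑ c ⊗ₜ[R] barExtension H X ϑ c')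

variable {H : DGHopfAlgebra R C}

/-- The cap product `ϑ ∩ (a ⊗ m) = (-1)^(|a| + 1) ∑ a ϑ(c) ⊗ m'`, where `∑ c ⊗ m'` is the coaction
on `m`. -/
def cap (X : HirschAlgebra R A) (Y : DGComoduleAlgebra H M) (ϑ : C →ₗ[R] A) :
    A ⊗[R] M →ₗ[R] A ⊗[R] M :=
  - (TensorProduct.map (TensorProduct.lift X.mul) LinearMap.id ∘ₗ
      (TensorProduct.assoc R A A M).symm.toLinearMap ∘ₗ
      TensorProduct.map X.sgn (TensorProduct.map ϑ LinearMap.id ∘ₗ Y.coact))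

/-- The twisted differential `d_ϑ = d ⊗ Id + Id ⊗ d + ϑ ∩ _`. -/
def twistedD (X : HirschAlgebra R A) (Y : DGComoduleAlgebra H M) (ϑ : C →ₗ[R] A) :
    A ⊗[R] M →ₗ[R] A ⊗[R] M :=
  X.toDGModule.tensorD Y.toDGModule + cap X Y ϑ

/-- `m ↦ ∑ [ϑ(c¹)|…|ϑ(cⁿ)] ⊗ mⁿ⁺¹`, where `∑ c¹ ⊗ ⋯ ⊗ cⁿ ⊗ mⁿ⁺¹` is the `n`-fold iterated coaction
on `m`. -/
def iterCoact (Y : DGComoduleAlgebra H M) (ϑ : C →ₗ[R] A) : ℕ → M →ₗ[R] TensorAlgebra R A ⊗[R] M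
  | 0 => TensorProduct.mk R (TensorAlgebra R A) M 1
  | n + 1 =>
      TensorProduct.map (LinearMap.mul' R (TensorAlgebra R A)) LinearMap.id ∘ₗ
        (TensorProduct.assoc R (TensorAlgebra R A) (TensorAlgebra R A) M).symm.toLinearMap ∘ₗ
        TensorProduct.map (TensorAlgebra.ι R ∘ₗ ϑ) (iterCoact Y ϑ n) ∘ₗ Y.coact

/-- `[a₁|…|aₙ] ↦ (-1)^(∑ᵢ (|aᵢ| - 1)) [a₁|…|aₙ]`; on a word `[ϑ(c¹)|…|ϑ(cⁿ)]` the sign is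
`(-1)^(|c¹| + ⋯ + |cⁿ|)`. -/
def wordSgn (X : HirschAlgebra R A) : TensorAlgebra R A →ₗ[R] TensorAlgebra R A :=
  Words.map (- X.sgn)

/-- `(w₁ ⊗ m₁, w₂ ⊗ m₂) ↦ E(w₁; w₂) ⊗ m₁ m₂` for words `w₁`, `w₂`. -/
def opsMul (X : HirschAlgebra R A) (Y : DGComoduleAlgebra H M) :
    TensorAlgebra R A ⊗[R] M →ₗ[R] TensorAlgebra R A ⊗[R] M →ₗ[R] A ⊗[R] M :=
  TensorProduct.map₂ (Words.evalOps X.E) Y.mul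

/-- `(a, w ⊗ m) ↦ [a|w] ⊗ m`. -/
def consLeft : A →ₗ[R] TensorAlgebra R A ⊗[R] M →ₗ[R] TensorAlgebra R A ⊗[R] M :=
  LinearMap.rTensorHom M ∘ₗ LinearMap.mul R (TensorAlgebra R A) ∘ₗ TensorAlgebra.ι R

/-- `(a, a' ⊗ m) ↦ a a' ⊗ m`. -/
def leftMul (X : HirschAlgebra R A) : A →ₗ[R] A ⊗[R] M →ₗ[R] A ⊗[R] M :=
  LinearMap.rTensorHom M ∘ₗ X.mul

/-- The `(p, r + 1)` summand of the twisted multiplication at `a₁ ⊗ m₁` and `a₂ ⊗ m₂`, that is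
`∑ (-1)^ε a₁ E_{p,r+1}(ϑ(c₁¹),…,ϑ(c₁ᵖ); a₂, ϑ(c₂¹),…,ϑ(c₂ʳ)) ⊗ m₁ᵖ⁺¹ m₂ʳ⁺¹` with
`ε = |c₁¹| + ⋯ + |c₁ᵖ| + |m₁ᵖ⁺¹| (|a₂| + |c₂¹| + ⋯ + |c₂ʳ|)`. The two terms of the sum below
correspond to the even and the odd part of `m₁ᵖ⁺¹`. -/
def twistedMulTerm (X : HirschAlgebra R A) (Y : DGComoduleAlgebra H M) (ϑ : C →ₗ[R] A)
    (p r : ℕ) (a₁ : A) (m₁ : M) (a₂ : A) (m₂ : M) : A ⊗[R] M :=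
  leftMul X a₁
    (opsMul X Y (TensorProduct.map (wordSgn X) Y.even (iterCoact Y ϑ p m₁))
        (consLeft a₂ (iterCoact Y ϑ r m₂)) +
      opsMul X Y (TensorProduct.map (wordSgn X) Y.odd (iterCoact Y ϑ p m₁))
        (consLeft (X.sgn a₂) (TensorProduct.map (wordSgn X) LinearMap.id (iterCoact Y ϑ r m₂))))

end Twisted

end

/-!
Write `Δ` for comultiplications and `∑ c ⊗ m'` for the coaction on `m`. Since `A¹ = 0` and `ϑ`
vanishes in degree `-1`, the cochain `ϑ` vanishes in degrees `≤ 0`. Hence the comultiplicative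
extension `F : C → BA` of `ϑ` is locally finite, and it satisfies
`F c = ε(c) [] + ∑ [ϑ c'|F c'']` with `c''` of smaller degree than `c` (`barExt_rec`). Maps out of
`C` can be compared by this recursion (`eq_zero_of_rec`), which shows that `F` is a map of dg
coalgebras (`deconcat_barExt`, `barD_barExt`). Comparing words of length one in the multiplicativity
of `F` gives `E(F c; F c') = ϑ(c c')` (`barOps_barExt`).

By coassociativity of the coaction, the twisted product only involves the pairing
`Ψ(c₁, a ⊗ c₂) = ± E(F c₁; [a|F c₂])`:
`(a₁ ⊗ m₁)(a₂ ⊗ m₂) = ∑ ± a₁ Ψ(c₁, a₂ ⊗ c₂) ⊗ m₁' m₂'` (`twistedMul_eq_finsum`). Evaluating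
`∇ E = - E ⌣ E` on `F c₁ ⊗ [a|F c₂]` expresses `d Ψ(c₁, a ⊗ c₂)` by values of `Ψ` on differentials,
by `Ψ(c₁, a ϑ(c₂') ⊗ c₂'')`, which comes from the bar differential, and by the two parts
`ϑ(c₁') Ψ(c₁'', a ⊗ c₂)` and `Ψ(c₁', a ⊗ c₂') ϑ(c₁'' c₂'')` of the cup product (`hirsch_pos`). For
`a = 1`, which is not a letter of the bar construction, the same formula follows from the
multiplicativity of `ϑ` (`hirsch_one`).

The differential `d_ϑ` is a derivation of the left `A`-module `A ⊗ M` (`twistedD_leftMul`). So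
`d_ϑ² = 0` has to be checked only on `1 ⊗ m`, where it is the twisting cochain equation
(`twistedD_twistedD`), and the product rule only for `(1 ⊗ m)(a ⊗ n)`. The terms of the latter are
functionals of the coactions on `m` and `n`, and after an application of coassociativity they cancel
by the formula for `d Ψ` (`smashMul_leibniz`): up to sign, the part `ϑ(c₁') Ψ(c₁'', a ⊗ c₂)` of the
cup product is `(ϑ ∩ (1 ⊗ m)) (a ⊗ n)`, the term from the bar differential is
`(1 ⊗ m) (ϑ ∩ (a ⊗ n))`, and the part `Ψ(c₁', a ⊗ c₂') ϑ(c₁'' c₂'')` is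
`ϑ ∩ ((1 ⊗ m) (a ⊗ n))`, since the coaction is multiplicative (`cap_smashMul`).

Signs are handled by evaluating all linear functionals on homogeneous elements.
-/

/-! ### Signs and homogeneous elements -/

section Signs

variable {R : Type*} [CommRing R]

variable (R) in
/-- The sign `(-1)^i` as a scalar of `R`. -/
def koszulSign (i : ℤ) : R := ((i.negOnePow : ℤ) : R)

theorem zsmul_negOnePow {V : Type*} [AddCommGroup V] [Module R V] (i : ℤ) (a : V) :
    (i.negOnePow : ℤ) • a = koszulSign R i • a :=
  (Int.cast_smul_eq_zsmul R _ _).symm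

theorem koszulSign_even {i : ℤ} (h : Even i) : koszulSign R i = 1 := by
  simp [koszulSign, Int.negOnePow_even i h]

theorem koszulSign_odd {i : ℤ} (h : ¬ Even i) : koszulSign R i = -1 := by
  simp [koszulSign, Int.negOnePow_odd i (Int.not_even_iff_odd.mp h)]

theorem koszulSign_eq_ite (i : ℤ) : koszulSign R i = if Even i then 1 else -1 := by
  split_ifs with h
  · exact koszulSign_even h
  · exact koszulSign_odd h

theorem koszulSign_add (i j : ℤ) : koszulSign R (i + j) = koszulSign R i * koszulSign R j := by
  simp [koszulSign, Int.negOnePow_add]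

theorem koszulSign_succ (i : ℤ) : koszulSign R (i + 1) = - koszulSign R i := by
  simp [koszulSign, Int.negOnePow_succ]

theorem koszulSign_zero : koszulSign R 0 = 1 := koszulSign_even (by simp)

theorem koszulSign_mul_self (i : ℤ) : koszulSign R i * koszulSign R i = 1 := by
  rw [koszulSign_eq_ite]; split_ifs <;> simp

theorem koszulSign_congr {i j : ℤ} (h : Even i ↔ Even j) : koszulSign R i = koszulSign R j := by
  simp only [koszulSign_eq_ite, h]

variable {V : Type*} [AddCommGroup V] [Module R V]

/-- The `j`-th power of a sign involution `σ`. -/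
def signPow (σ : V →ₗ[R] V) (j : ℤ) : V →ₗ[R] V := if Even j then LinearMap.id else σ

theorem signPow_apply (σ : V →ₗ[R] V) (j : ℤ) {k : ℤ} {a : V} (h : σ a = koszulSign R k • a) :
    signPow σ j a = koszulSign R (j * k) • a := by
  unfold signPow
  split_ifs with hj
  · rw [koszulSign_even (hj.mul_right k)]; simp
  · rw [h]
    congr 1
    exact koszulSign_congr (by simp [Int.even_mul, hj])

theorem koszulSwap_tmul {W V' W' : Type*} [AddCommGroup W] [Module R W]
    [AddCommGroup V'] [Module R V'] [AddCommGroup W'] [Module R W']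
    (ev od : W →ₗ[R] W) (s : V' →ₗ[R] V') (j : ℤ) (v : V) (b : W) (v' : V') (b' : W')
    (he : ev b = if Even j then b else 0) (ho : od b = if Even j then 0 else b) :
    koszulSwap ev od s ((v ⊗ₜ[R] b) ⊗ₜ[R] (v' ⊗ₜ[R] b')) =
      (v ⊗ₜ[R] signPow s j v') ⊗ₜ[R] (b ⊗ₜ[R] b') := by
  unfold signPow
  by_cases hj : Even j <;> simp [koszulSwap, he, ho, hj]

end Signs

section GradedTensor

variable {R : Type u} [CommRing R] {V : Type v} [AddCommGroup V] [Module R V]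
  {W : Type w} [AddCommGroup W] [Module R W]

/-- The degree `n` part of `V ⊗ W` for families `g` and `h` of submodules of `V` and `W`. -/
def gradedTensor (g : ℤ → Submodule R V) (h : ℤ → Submodule R W) (n : ℤ) :
    Submodule R (V ⊗[R] W) :=
  ⨆ i : ℤ, Submodule.map₂ (TensorProduct.mk R V W) (g i) (h (n - i))

variable {g : ℤ → Submodule R V} {h : ℤ → Submodule R W}

theorem tmul_mem_gradedTensor {i j n : ℤ} {a : V} {b : W}
    (ha : a ∈ g i) (hb : b ∈ h j) (hn : i + j = n) : a ⊗ₜ[R] b ∈ gradedTensor g h n := by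
  refine Submodule.mem_iSup_of_mem i ?_
  have hj : j = n - i := by omega
  subst hj
  exact Submodule.apply_mem_map₂ (TensorProduct.mk R V W) ha hb

@[elab_as_elim]
theorem gradedTensor_induction {n : ℤ} {p : V ⊗[R] W → Prop}
    (tmul : ∀ i j a b, a ∈ g i → b ∈ h j → i + j = n → p (a ⊗ₜ b))
    (add : ∀ a b, p a → p b → p (a + b)) {z : V ⊗[R] W} (hz : z ∈ gradedTensor g h n) : p z := by
  have zero : p 0 := by
    simpa using tmul 0 n 0 0 (zero_mem _) (zero_mem _) (by simp)
  refine Submodule.iSup_induction _ (motive := p) hz ?_ zero add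
  intro i z hz
  rw [Submodule.map₂_eq_span_image2] at hz
  induction hz using Submodule.closure_induction with
  | zero => exact zero
  | add a b _ _ ha hb => exact add a b ha hb
  | smul_mem r z hz =>
    obtain ⟨a, ha, b, hb, rfl⟩ := hz
    have := tmul i (n - i) (r • a) b (Submodule.smul_mem _ _ ha) hb (by omega)
    simpa [TensorProduct.smul_tmul'] using this

end GradedTensor

namespace DGModule

variable {R : Type u} [CommRing R] {V : Type v} [AddCommGroup V] [Module R V]
  {W : Type w} [AddCommGroup W] [Module R W]

theorem decomp_of_mem (X : DGModule R V) {i : ℤ} {a : V} (ha : a ∈ X.gr i) :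
    X.decomp a = DirectSum.lof R ℤ (fun i => X.gr i) i ⟨a, ha⟩ := by
  let := X.isInternal.chooseDecomposition
  exact DirectSum.decompose_of_mem X.gr ha

theorem even_of_mem (X : DGModule R V) {i : ℤ} {a : V} (ha : a ∈ X.gr i) :
    X.even a = if Even i then a else 0 := by
  simp only [even, LinearMap.comp_apply, LinearEquiv.coe_coe, X.decomp_of_mem ha,
    DirectSum.toModule_lof]
  split_ifs <;> simp

theorem odd_of_mem (X : DGModule R V) {i : ℤ} {a : V} (ha : a ∈ X.gr i) :
    X.odd a = if Even i then 0 else a := by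
  simp only [odd, LinearMap.comp_apply, LinearEquiv.coe_coe, X.decomp_of_mem ha,
    DirectSum.toModule_lof]
  split_ifs <;> simp

theorem sgn_of_mem (X : DGModule R V) {i : ℤ} {a : V} (ha : a ∈ X.gr i) :
    X.sgn a = koszulSign R i • a := by
  simp only [sgn, LinearMap.sub_apply, X.even_of_mem ha, X.odd_of_mem ha, koszulSign_eq_ite]
  split_ifs <;> simp

theorem pos_of_mem (X : DGModule R V) {i : ℤ} (hi : 0 < i) {a : V} (ha : a ∈ X.gr i) :
    a ∈ X.pos :=
  le_iSup₂ (f := fun (i : ℤ) (_ : 0 < i) => X.gr i) i hi ha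

theorem posProj_of_mem (X : DGModule R V) {i : ℤ} (hi : 0 < i) {a : V} (ha : a ∈ X.gr i) :
    X.posProj a = ⟨a, X.pos_of_mem hi ha⟩ := by
  simp only [posProj, LinearMap.comp_apply, LinearEquiv.coe_coe, X.decomp_of_mem ha,
    DirectSum.toModule_lof]
  simp [hi, Submodule.inclusion]
  rfl

theorem posProj_of_mem_nonpos (X : DGModule R V) {i : ℤ} (hi : ¬ 0 < i) {a : V}
    (ha : a ∈ X.gr i) : X.posProj a = 0 := by
  simp only [posProj, LinearMap.comp_apply, LinearEquiv.coe_coe, X.decomp_of_mem ha,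
    DirectSum.toModule_lof]
  simp [hi]

@[elab_as_elim]
theorem homogeneous_induction (X : DGModule R V) {p : V → Prop}
    (mem : ∀ i a, a ∈ X.gr i → p a) (zero : p 0) (add : ∀ a b, p a → p b → p (a + b)) (a : V) :
    p a := by
  have h : a ∈ ⨆ i, X.gr i := by
    rw [X.isInternal.submodule_iSup_eq_top]; trivial
  exact Submodule.iSup_induction X.gr (motive := p) h mem zero add

theorem hom_ext_homogeneous (X : DGModule R V) {f g : V →ₗ[R] W}
    (h : ∀ i a, a ∈ X.gr i → f a = g a) : f = g := by
  refine LinearMap.ext fun a => ?_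
  induction a using X.homogeneous_induction with
  | mem i a ha => exact h i a ha
  | zero => simp
  | add a b ha hb => simp [ha, hb]

@[elab_as_elim]
theorem pos_induction (X : DGModule R V) {p : X.pos → Prop}
    (mem : ∀ i a (hi : 0 < i) (ha : a ∈ X.gr i), p ⟨a, X.pos_of_mem hi ha⟩)
    (add : ∀ a b, p a → p b → p (a + b)) (a : X.pos) : p a := by
  obtain ⟨a, ha⟩ := a
  have zero : p 0 := mem 1 0 one_pos (zero_mem _)
  have key : ∃ h : a ∈ X.pos, p ⟨a, h⟩ := by
    refine Submodule.iSup_induction (fun i : ℤ => ⨆ _ : 0 < i, X.gr i)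
      (motive := fun a => ∃ h : a ∈ X.pos, p ⟨a, h⟩) ha ?_ ⟨zero_mem _, zero⟩ ?_
    · intro i a ha
      by_cases hi : 0 < i
      · simp only [hi, iSup_pos] at ha
        exact ⟨_, mem i a hi ha⟩
      · simp only [hi, not_false_eq_true, iSup_neg, Submodule.mem_bot] at ha
        subst ha
        exact ⟨zero_mem _, zero⟩
    · rintro a b ⟨ha, pa⟩ ⟨hb, pb⟩
      exact ⟨add_mem ha hb, add _ _ pa pb⟩
  exact key.2

theorem posProj_coe (X : DGModule R V) (a : X.pos) : X.posProj a = a := by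
  induction a using X.pos_induction with
  | mem i a hi ha => exact X.posProj_of_mem hi ha
  | add a b ha hb => rw [Submodule.coe_add, map_add, ha, hb]

theorem coe_posProj (X : DGModule R V) {a : V} (ha : a ∈ X.pos) : (X.posProj a : V) = a :=
  congrArg Subtype.val (X.posProj_coe ⟨a, ha⟩)

/-! ### The total grading of a tensor product -/

theorem tmul_mem_tensorGr (X : DGModule R V) (Y : DGModule R W) {i j n : ℤ} {a : V} {b : W}
    (ha : a ∈ X.gr i) (hb : b ∈ Y.gr j) (h : i + j = n) : a ⊗ₜ[R] b ∈ X.tensorGr Y n :=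
  tmul_mem_gradedTensor ha hb h

@[elab_as_elim]
theorem tensorGr_induction (X : DGModule R V) (Y : DGModule R W) {n : ℤ}
    {p : V ⊗[R] W → Prop}
    (tmul : ∀ i j a b, a ∈ X.gr i → b ∈ Y.gr j → i + j = n → p (a ⊗ₜ b))
    (add : ∀ a b, p a → p b → p (a + b)) {z : V ⊗[R] W} (hz : z ∈ X.tensorGr Y n) : p z :=
  gradedTensor_induction tmul add hz

@[elab_as_elim]
theorem tensor_induction (X : DGModule R V) (Y : DGModule R W) {p : V ⊗[R] W → Prop}
    (tmul : ∀ i j a b, a ∈ X.gr i → b ∈ Y.gr j → p (a ⊗ₜ b))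
    (add : ∀ a b, p a → p b → p (a + b)) (z : V ⊗[R] W) : p z := by
  have zero : p 0 := by
    simpa using tmul 0 0 0 0 (zero_mem _) (zero_mem _)
  induction z with
  | zero => exact zero
  | add a b ha hb => exact add a b ha hb
  | tmul a b =>
    induction a using X.homogeneous_induction with
    | zero => simpa using zero
    | add a a' ha ha' => rw [TensorProduct.add_tmul]; exact add _ _ ha ha'
    | mem i a ha =>
      induction b using Y.homogeneous_induction with
      | zero => simpa using zero
      | add a a' ha ha' => rw [TensorProduct.tmul_add]; exact add _ _ ha ha'
      | mem j b hb => exact tmul i j a b ha hb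

/-- The map of components `V^i ⊗ W^j → (V ⊗ W)^(i+j)`. -/
def tensorGrMk (X : DGModule R V) (Y : DGModule R W) (i j : ℤ) :
    X.gr i →ₗ[R] Y.gr j →ₗ[R] X.tensorGr Y (i + j) :=
  LinearMap.mk₂ R (fun a b => ⟨a.1 ⊗ₜ b.1, X.tmul_mem_tensorGr Y a.2 b.2 rfl⟩)
    (fun _ _ _ => Subtype.ext (TensorProduct.add_tmul _ _ _))
    (fun _ _ _ => Subtype.ext (TensorProduct.smul_tmul' _ _ _).symm)
    (fun _ _ _ => Subtype.ext (TensorProduct.tmul_add _ _ _))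
    (fun _ _ _ => Subtype.ext (TensorProduct.tmul_smul _ _ _))

/-- The decomposition of an element of `V ⊗ W` by total degree. -/
noncomputable def tensorDecomp (X : DGModule R V) (Y : DGModule R W) :
    V ⊗[R] W →ₗ[R] DirectSum ℤ (fun n => X.tensorGr Y n) :=
  TensorProduct.lift (LinearMap.compl₁₂
    (DirectSum.toModule R ℤ (DirectSum ℤ (fun j => Y.gr j) →ₗ[R]
        DirectSum ℤ (fun n => X.tensorGr Y n)) fun i =>
      (DirectSum.toModule R ℤ (X.gr i →ₗ[R] DirectSum ℤ (fun n => X.tensorGr Y n)) fun j =>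
        ((X.tensorGrMk Y i j).compr₂
          (DirectSum.lof R ℤ (fun n => X.tensorGr Y n) (i + j))).flip).flip)
    X.decomp.toLinearMap Y.decomp.toLinearMap)

theorem tensorDecomp_tmul (X : DGModule R V) (Y : DGModule R W) {i j : ℤ} {a : V} {b : W}
    (ha : a ∈ X.gr i) (hb : b ∈ Y.gr j) :
    X.tensorDecomp Y (a ⊗ₜ b) = DirectSum.lof R ℤ (fun n => X.tensorGr Y n) (i + j)
      ⟨a ⊗ₜ b, X.tmul_mem_tensorGr Y ha hb rfl⟩ := by
  simp only [tensorDecomp, TensorProduct.lift.tmul, LinearMap.compl₁₂_apply, LinearEquiv.coe_coe,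
    X.decomp_of_mem ha, Y.decomp_of_mem hb, DirectSum.toModule_lof, LinearMap.flip_apply,
    LinearMap.compr₂_apply]
  rfl

theorem tensorGr_isInternal (X : DGModule R V) (Y : DGModule R W) :
    DirectSum.IsInternal (X.tensorGr Y) := by
  let : DirectSum.Decomposition (X.tensorGr Y) := by
    refine DirectSum.Decomposition.ofLinearMap _ (X.tensorDecomp Y) ?_ ?_
    · refine LinearMap.ext fun z => ?_
      induction z using X.tensor_induction Y with
      | tmul i j a b ha hb =>
        simp [X.tensorDecomp_tmul Y ha hb]
      | add a b ha hb => rw [map_add, ha, hb, map_add]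
    · refine DirectSum.linearMap_ext R fun n => LinearMap.ext fun z => ?_
      obtain ⟨z, hz⟩ := z
      have key : ∃ h : z ∈ X.tensorGr Y n, X.tensorDecomp Y z =
          DirectSum.lof R ℤ (fun n => X.tensorGr Y n) n ⟨z, h⟩ := by
        refine X.tensorGr_induction Y ?_ ?_ hz
        · intro i j a b ha hb h
          subst h
          exact ⟨X.tmul_mem_tensorGr Y ha hb rfl, X.tensorDecomp_tmul Y ha hb⟩
        · rintro a b ⟨ha, ea⟩ ⟨hb, eb⟩
          refine ⟨add_mem ha hb, ?_⟩
          rw [map_add, ea, eb, ← map_add]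
          rfl
      simpa using key.2
  exact DirectSum.Decomposition.isInternal _

theorem sgn_mem (X : DGModule R V) {i : ℤ} {a : V} (ha : a ∈ X.gr i) : X.sgn a ∈ X.gr i := by
  rw [X.sgn_of_mem ha]; exact Submodule.smul_mem _ _ ha

theorem tensorD_tmul (X : DGModule R V) (Y : DGModule R W) (a : V) (b : W) :
    X.tensorD Y (a ⊗ₜ b) = X.d a ⊗ₜ b + X.sgn a ⊗ₜ Y.d b := rfl

theorem tensorD_mem (X : DGModule R V) (Y : DGModule R W) {n : ℤ} {z : V ⊗[R] W}
    (hz : z ∈ X.tensorGr Y n) : X.tensorD Y z ∈ X.tensorGr Y (n + 1) := by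
  refine X.tensorGr_induction Y ?_ ?_ hz
  · intro i j a b ha hb h
    rw [tensorD_tmul]
    exact add_mem (X.tmul_mem_tensorGr Y (X.d_mem i a ha) hb (by omega))
      (X.tmul_mem_tensorGr Y (X.sgn_mem ha) (Y.d_mem j b hb) (by omega))
  · intro a b ha hb
    rw [map_add]; exact add_mem ha hb

theorem map_sgn_tensorGr (X : DGModule R V) (Y : DGModule R W) {n : ℤ} {z : V ⊗[R] W}
    (hz : z ∈ X.tensorGr Y n) : TensorProduct.map X.sgn Y.sgn z = koszulSign R n • z := by
  refine X.tensorGr_induction Y ?_ ?_ hz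
  · intro i j a b ha hb h
    subst h
    simp [X.sgn_of_mem ha, Y.sgn_of_mem hb, koszulSign_add, TensorProduct.smul_tmul',
      TensorProduct.tmul_smul, smul_smul, mul_comm]
  · intro a b ha hb
    rw [map_add, ha, hb, smul_add]

end DGModule

/-! ### The multiplication defined by a pairing -/

noncomputable section TwistedProduct

variable {R : Type u} [CommRing R] {A : Type v} [AddCommGroup A] [Module R A]
  {C : Type w} [AddCommGroup C] [Module R C] {M : Type x} [AddCommGroup M] [Module R M]
  {P Q : Type*} [AddCommGroup P] [Module R P] [AddCommGroup Q] [Module R Q]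

/-- For a bilinear map `Θ : P × Q → A` and a sign involution `σ` of `Q`, the bilinear map
`(p ⊗ m, q ⊗ n) ↦ (-1)^(|m| |q|) Θ(p, q) ⊗ m n`. -/
def smashMul (Y : DGAlgebra R M) (Θ : P →ₗ[R] Q →ₗ[R] A) (σ : Q →ₗ[R] Q) :
    P ⊗[R] M →ₗ[R] Q ⊗[R] M →ₗ[R] A ⊗[R] M :=
  TensorProduct.map₂ Θ Y.mul ∘ₗ TensorProduct.map LinearMap.id Y.even +
    (TensorProduct.map₂ Θ Y.mul).compl₁₂ (TensorProduct.map LinearMap.id Y.odd)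
      (TensorProduct.map σ LinearMap.id)

theorem smashMul_tmul (Y : DGAlgebra R M) (Θ : P →ₗ[R] Q →ₗ[R] A) (σ : Q →ₗ[R] Q)
    {j : ℤ} {m : M} (hm : m ∈ Y.gr j) (p : P) (q : Q) (n : M) :
    smashMul Y Θ σ (p ⊗ₜ m) (q ⊗ₜ n) = Θ p (signPow σ j q) ⊗ₜ[R] Y.mul m n := by
  unfold signPow
  by_cases hj : Even j <;>
    simp [smashMul, Y.even_of_mem hm, Y.odd_of_mem hm, hj]

theorem smashMul_tmul_smul (Y : DGAlgebra R M) (Θ : P →ₗ[R] Q →ₗ[R] A) (σ : Q →ₗ[R] Q)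
    {j k : ℤ} {m : M} (hm : m ∈ Y.gr j) (p : P) {q : Q} (hq : σ q = koszulSign R k • q) (n : M) :
    smashMul Y Θ σ (p ⊗ₜ m) (q ⊗ₜ n) = koszulSign R (j * k) • (Θ p q ⊗ₜ[R] Y.mul m n) := by
  rw [smashMul_tmul Y Θ σ hm, signPow_apply σ j hq, map_smul, TensorProduct.smul_tmul']

/-- `(c ⊗ c', q) ↦ ϑ(c) Ψ(c', q)`. -/
def headMul (X : HirschAlgebra R A) (ϑ : C →ₗ[R] A) (Ψ : C →ₗ[R] Q →ₗ[R] A) :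
    C ⊗[R] C →ₗ[R] Q →ₗ[R] A :=
  TensorProduct.lift ((LinearMap.llcomp R Q A A ∘ₗ X.mul ∘ₗ ϑ).compl₂ Ψ)

theorem headMul_tmul (X : HirschAlgebra R A) (ϑ : C →ₗ[R] A) (Ψ : C →ₗ[R] Q →ₗ[R] A)
    (c c' : C) (q : Q) : headMul X ϑ Ψ (c ⊗ₜ c') q = X.mul (ϑ c) (Ψ c' q) := rfl

/-- `(c₁ ⊗ c₁', q ⊗ c₂) ↦ ± Ψ(c₁, q) ϑ(c₁' c₂)`, where the sign is that of the interchange of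
`c₁'` and `q` times `(-1)^|Ψ(c₁, q)|`, and `q ∈ A ⊗ C`. -/
def tailMul (X : HirschAlgebra R A) (H : DGHopfAlgebra R C) (ϑ : C →ₗ[R] A)
    (Ψ : C →ₗ[R] A ⊗[R] C →ₗ[R] A) : C ⊗[R] C →ₗ[R] (A ⊗[R] C) ⊗[R] C →ₗ[R] A :=
  TensorProduct.curry (TensorProduct.lift X.mul ∘ₗ
    TensorProduct.map (X.sgn ∘ₗ TensorProduct.lift Ψ) (ϑ ∘ₗ TensorProduct.lift H.mul) ∘ₗ
    koszulSwap H.even H.odd (TensorProduct.map X.sgn H.sgn))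

theorem tailMul_tmul (X : HirschAlgebra R A) (H : DGHopfAlgebra R C) (ϑ : C →ₗ[R] A)
    (Ψ : C →ₗ[R] A ⊗[R] C →ₗ[R] A) {j : ℤ} (c : C) {c' : C} (hc' : c' ∈ H.gr j) (q : A ⊗[R] C)
    (c₂ : C) :
    tailMul X H ϑ Ψ (c ⊗ₜ c') (q ⊗ₜ c₂) =
      X.mul (X.sgn (Ψ c (signPow (TensorProduct.map X.sgn H.sgn) j q))) (ϑ (H.mul c' c₂)) := by
  simp only [tailMul, TensorProduct.curry_apply, LinearMap.comp_apply]
  rw [koszulSwap_tmul _ _ _ j _ _ _ _ (H.even_of_mem hc') (H.odd_of_mem hc')]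
  simp

/-- `(a ⊗ c) ⊗ c' ↦ a ϑ(c) ⊗ c'`. -/
def absorbMul (X : HirschAlgebra R A) (ϑ : C →ₗ[R] A) : (A ⊗[R] C) ⊗[R] Q →ₗ[R] A ⊗[R] Q :=
  TensorProduct.map (TensorProduct.lift (X.mul.compl₂ ϑ)) LinearMap.id

theorem absorbMul_tmul (X : HirschAlgebra R A) (ϑ : C →ₗ[R] A) (a : A) (c : C) (q : Q) :
    absorbMul X ϑ ((a ⊗ₜ c) ⊗ₜ q) = X.mul a (ϑ c) ⊗ₜ[R] q := rfl

/-- `a ↦ (c ⊗ c' ↦ (a ⊗ c) ⊗ c')`. -/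
def prefixTmul (a : A) : P ⊗[R] Q →ₗ[R] (A ⊗[R] P) ⊗[R] Q :=
  (TensorProduct.assoc R A P Q).symm.toLinearMap ∘ₗ TensorProduct.mk R A (P ⊗[R] Q) a

theorem prefixTmul_tmul (a : A) (p : P) (q : Q) :
    prefixTmul a (p ⊗ₜ[R] q) = (a ⊗ₜ[R] p) ⊗ₜ[R] q := rfl

/-- The properties of the pairing
`Ψ(c₁, a ⊗ c₂) = ∑ ± E(ϑ(c₁⁽¹⁾),…,ϑ(c₁⁽ᵖ⁾); a, ϑ(c₂⁽¹⁾),…,ϑ(c₂⁽ʳ⁾))` which make the twisted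
multiplication a chain map: degree, two unit laws, and the Hirsch identity
`∇ E = - E ⌣ E` on the bar words `[ϑ(c₁)|…]` and `[a|ϑ(c₂)|…]`. -/
structure IsTwistedPairing (X : HirschAlgebra R A) (H : DGHopfAlgebra R C) (ϑ : C →ₗ[R] A)
    (Ψ : C →ₗ[R] A ⊗[R] C →ₗ[R] A) : Prop where
  mem : ∀ (i k l : ℤ) (c₁ : C) (a : A) (c₂ : C), c₁ ∈ H.gr i → a ∈ X.gr k → c₂ ∈ H.gr l →
    Ψ c₁ (a ⊗ₜ c₂) ∈ X.gr (i + k + l)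
  one_middle : ∀ c₁ c₂ : C, Ψ c₁ (X.one ⊗ₜ c₂) = (H.counit c₁ * H.counit c₂) • X.one
  one_left : ∀ (a : A) (c₂ : C), Ψ H.one (a ⊗ₜ c₂) = H.counit c₂ • a
  hirsch : ∀ (i k l : ℤ) (c₁ : C) (a : A) (c₂ : C), c₁ ∈ H.gr i → a ∈ X.gr k → c₂ ∈ H.gr l →
    X.d (Ψ c₁ (a ⊗ₜ c₂)) = Ψ (H.d c₁) (a ⊗ₜ c₂) + koszulSign R i • Ψ c₁ (X.d a ⊗ₜ c₂)
      - koszulSign R (i + k) • Ψ c₁ (absorbMul X ϑ (prefixTmul a (H.comul c₂)))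
      + koszulSign R (i + k) • Ψ c₁ (a ⊗ₜ H.d c₂)
      - headMul X ϑ Ψ (H.comul c₁) (a ⊗ₜ c₂)
      + tailMul X H ϑ Ψ (H.comul c₁) (prefixTmul a (H.comul c₂))

variable {H : DGHopfAlgebra R C}

theorem cap_tmul (X : HirschAlgebra R A) (Y : DGComoduleAlgebra H M) (ϑ : C →ₗ[R] A) (a : A)
    (m : M) : cap X Y ϑ (a ⊗ₜ m) = - absorbMul X ϑ (prefixTmul (X.sgn a) (Y.coact m)) := by
  simp only [cap, LinearMap.neg_apply, LinearMap.comp_apply, TensorProduct.map_tmul,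
    LinearEquiv.coe_coe]
  congr 1
  generalize Y.coact m = z
  induction z with
  | zero => simp
  | add a b ha hb => simp only [map_add, TensorProduct.tmul_add, ha, hb]
  | tmul c m => simp [absorbMul_tmul, prefixTmul_tmul]

theorem leftMul_tmul (X : HirschAlgebra R A) (a b : A) (m : M) :
    leftMul X a (b ⊗ₜ[R] m) = X.mul a b ⊗ₜ[R] m := rfl

theorem cap_leftMul (X : HirschAlgebra R A) (Y : DGComoduleAlgebra H M) (ϑ : C →ₗ[R] A)
    {k : ℤ} {a : A} (ha : a ∈ X.gr k) (z : A ⊗[R] M) :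
    cap X Y ϑ (leftMul X a z) = koszulSign R k • leftMul X a (cap X Y ϑ z) := by
  induction z using X.tensor_induction Y.toDGModule with
  | add x y hx hy => simp only [map_add, hx, hy, smul_add]
  | tmul i j b m hb hm =>
    rw [leftMul_tmul, cap_tmul, cap_tmul, X.sgn_of_mem hb, X.sgn_of_mem (X.mul_mem _ _ _ _ ha hb),
      map_neg, smul_neg]
    congr 1
    generalize Y.coact m = z
    induction z with
    | zero => simp
    | add a b ha hb => simp only [map_add, smul_add, ha, hb]
    | tmul c m =>
      simp [absorbMul_tmul, prefixTmul_tmul, leftMul_tmul, koszulSign_add, X.mul_assoc,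
        ← TensorProduct.smul_tmul', smul_smul]

theorem tensorD_leftMul (X : HirschAlgebra R A) (Y : DGComoduleAlgebra H M)
    {k : ℤ} {a : A} (ha : a ∈ X.gr k) (z : A ⊗[R] M) :
    X.tensorD Y.toDGModule (leftMul X a z) = leftMul X (X.d a) z +
      koszulSign R k • leftMul X a (X.tensorD Y.toDGModule z) := by
  induction z using X.tensor_induction Y.toDGModule with
  | add x y hx hy => simp only [map_add, hx, hy, smul_add]; abel
  | tmul i j b m hb hm =>
    simp only [leftMul_tmul, DGModule.tensorD_tmul, X.leibniz _ _ _ ha, zsmul_negOnePow (R := R),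
      X.sgn_of_mem hb, X.sgn_of_mem (X.mul_mem _ _ _ _ ha hb), map_add,
      koszulSign_add, ← TensorProduct.smul_tmul', map_smul, TensorProduct.add_tmul, smul_add,
      smul_smul, add_assoc]

/-- The twisted differential is a derivation of the left `A`-module structure of `A ⊗ M`. -/
theorem twistedD_leftMul (X : HirschAlgebra R A) (Y : DGComoduleAlgebra H M) (ϑ : C →ₗ[R] A)
    {k : ℤ} {a : A} (ha : a ∈ X.gr k) (z : A ⊗[R] M) :
    twistedD X Y ϑ (leftMul X a z) = leftMul X (X.d a) z +
      koszulSign R k • leftMul X a (twistedD X Y ϑ z) := by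
  simp only [twistedD, LinearMap.add_apply, tensorD_leftMul X Y ha, cap_leftMul X Y ϑ ha, map_add,
    smul_add, add_assoc]

theorem leftMul_mem (X : HirschAlgebra R A) (Y : DGModule R M) {k n : ℤ} {a : A}
    (ha : a ∈ X.gr k) {z : A ⊗[R] M} (hz : z ∈ X.tensorGr Y n) :
    leftMul X a z ∈ X.tensorGr Y (k + n) := by
  refine X.tensorGr_induction Y ?_ ?_ hz
  · intro i j b m hb hm h
    exact X.tmul_mem_tensorGr Y (X.mul_mem _ _ _ _ ha hb) hm (by omega)
  · intro a b ha hb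
    rw [map_add]; exact add_mem ha hb

theorem leftMul_one_left (X : HirschAlgebra R A) (z : A ⊗[R] M) : leftMul X X.one z = z := by
  induction z with
  | zero => simp
  | add a b ha hb => simp only [map_add, ha, hb]
  | tmul a m => rw [leftMul_tmul, X.one_mul]

theorem leftMul_tmul_one (X : HirschAlgebra R A) (a : A) (m : M) :
    leftMul X a (X.one ⊗ₜ[R] m) = a ⊗ₜ m := by
  rw [leftMul_tmul, X.mul_one]

theorem leftMul_mul (X : HirschAlgebra R A) (a b : A) (z : A ⊗[R] M) :
    leftMul X (X.mul a b) z = leftMul X a (leftMul X b z) := by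
  induction z with
  | zero => simp
  | add a b ha hb => simp only [map_add, ha, hb]
  | tmul c m => simp only [leftMul_tmul, X.mul_assoc]

theorem DGAlgebra.d_one (X : DGAlgebra R A) : X.d X.one = 0 := by
  have h := X.leibniz 0 X.one X.one X.one_mem
  simpa [X.one_mul, X.mul_one] using h

theorem DGAlgebra.sgn_one (X : DGAlgebra R A) : X.sgn X.one = X.one := by
  rw [X.sgn_of_mem X.one_mem, koszulSign_zero, one_smul]

theorem twistedD_one_tmul (X : HirschAlgebra R A) (Y : DGComoduleAlgebra H M) (ϑ : C →ₗ[R] A)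
    (m : M) : twistedD X Y ϑ (X.one ⊗ₜ m) =
      X.one ⊗ₜ Y.d m - TensorProduct.map ϑ LinearMap.id (Y.coact m) := by
  simp only [twistedD, LinearMap.add_apply, DGModule.tensorD_tmul, X.d_one, X.sgn_one,
    cap_tmul, TensorProduct.zero_tmul, zero_add, sub_eq_add_neg]
  congr 2
  generalize Y.coact m = z
  induction z with
  | zero => simp
  | add a b ha hb => simp only [map_add, ha, hb]
  | tmul c m => simp [absorbMul_tmul, prefixTmul_tmul, X.one_mul]

theorem absorbMul_mem (X : HirschAlgebra R A) (Y : DGModule R M) {ϑ : C →ₗ[R] A}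
    (hϑ : ∀ (i : ℤ) (c : C), c ∈ H.gr i → ϑ c ∈ X.gr (i + 1)) {k n : ℤ} {a : A}
    (ha : a ∈ X.gr k) {z : C ⊗[R] M} (hz : z ∈ H.tensorGr Y n) :
    absorbMul X ϑ (prefixTmul a z) ∈ X.tensorGr Y (k + n + 1) := by
  refine H.tensorGr_induction Y ?_ ?_ hz
  · intro i j b m hb hm h
    exact X.tmul_mem_tensorGr Y (X.mul_mem _ _ _ _ ha (hϑ i b hb)) hm (by omega)
  · intro a b ha hb
    rw [map_add, map_add]; exact add_mem ha hb

theorem twistedD_mem (X : HirschAlgebra R A) (Y : DGComoduleAlgebra H M) {ϑ : C →ₗ[R] A}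
    (hϑ : ∀ (i : ℤ) (c : C), c ∈ H.gr i → ϑ c ∈ X.gr (i + 1)) {n : ℤ} {z : A ⊗[R] M}
    (hz : z ∈ X.tensorGr Y.toDGModule n) :
    twistedD X Y ϑ z ∈ X.tensorGr Y.toDGModule (n + 1) := by
  refine add_mem (X.tensorD_mem Y.toDGModule hz) ?_
  refine X.tensorGr_induction Y.toDGModule ?_ ?_ hz
  · intro i j a m ha hm h
    subst h
    rw [cap_tmul]
    exact neg_mem (absorbMul_mem X Y.toDGModule hϑ (X.sgn_mem ha) (Y.coact_mem j m hm))
  · intro a b ha hb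
    rw [map_add]; exact add_mem ha hb

theorem coassoc_symm (Y : DGComoduleAlgebra H M) (m : M) :
    (TensorProduct.assoc R C C M).symm (TensorProduct.map LinearMap.id Y.coact (Y.coact m)) =
      TensorProduct.map H.comul LinearMap.id (Y.coact m) := by
  rw [← Y.coact_coassoc, LinearEquiv.symm_apply_apply]

/-- By `A`-linearity it is enough to square the twisted differential on `1 ⊗ m`, where the twisting
cochain equation applies. -/
theorem twistedD_twistedD (X : HirschAlgebra R A) (Y : DGComoduleAlgebra H M) {ϑ : C →ₗ[R] A}
    (hϑ : IsTwistingCochain H X ϑ) (z : A ⊗[R] M) : twistedD X Y ϑ (twistedD X Y ϑ z) = 0 := by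
  have key : ∀ m : M, twistedD X Y ϑ (twistedD X Y ϑ (X.one ⊗ₜ m)) = 0 := by
    intro m
    -- the twisted differential of `ϑ(c) ⊗ m'`
    have h1 : ∀ z : C ⊗[R] M, twistedD X Y ϑ (TensorProduct.map ϑ LinearMap.id z) =
        TensorProduct.map (X.d ∘ₗ ϑ) LinearMap.id z
          - TensorProduct.map (ϑ ∘ₗ H.sgn) Y.d z
          + TensorProduct.map (TensorProduct.lift X.mul ∘ₗ TensorProduct.map (ϑ ∘ₗ H.sgn) ϑ)
              LinearMap.id ((TensorProduct.assoc R C C M).symm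
                (TensorProduct.map LinearMap.id Y.coact z)) := by
      intro z
      induction z using H.tensor_induction Y.toDGModule with
      | add a b ha hb => simp only [map_add, ha, hb]; abel
      | tmul i j c m hc hm =>
        rw [TensorProduct.map_tmul, ← leftMul_tmul_one X (ϑ c) (LinearMap.id m),
          twistedD_leftMul X Y ϑ (hϑ.map_mem i c hc), twistedD_one_tmul, leftMul_tmul_one,
          map_sub, leftMul_tmul_one, koszulSign_succ]
        have h2 : leftMul X (ϑ c) (TensorProduct.map ϑ LinearMap.id (Y.coact m)) =
            koszulSign R i • TensorProduct.map
              (TensorProduct.lift X.mul ∘ₗ TensorProduct.map (ϑ ∘ₗ H.sgn) ϑ) LinearMap.id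
              ((TensorProduct.assoc R C C M).symm
                (TensorProduct.map LinearMap.id Y.coact (c ⊗ₜ m))) := by
          rw [TensorProduct.map_tmul]
          generalize Y.coact m = z
          induction z with
          | zero => simp
          | add a b ha hb => simp only [map_add, TensorProduct.tmul_add, smul_add, ha, hb]
          | tmul c' m =>
            simp [leftMul_tmul, H.sgn_of_mem hc, ← TensorProduct.smul_tmul', smul_smul,
              koszulSign_mul_self]
        rw [LinearMap.id_apply, h2]
        simp only [TensorProduct.map_tmul, LinearMap.comp_apply, H.sgn_of_mem hc, map_smul,
          ← TensorProduct.smul_tmul', LinearMap.id_apply, smul_sub, neg_mul, neg_smul,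
          smul_smul, koszulSign_mul_self, one_smul]
        abel
    rw [twistedD_one_tmul, map_sub, twistedD_one_tmul, Y.d_d, h1, coassoc_symm, Y.coact_d]
    have h3 : TensorProduct.map (TensorProduct.lift X.mul ∘ₗ TensorProduct.map (ϑ ∘ₗ H.sgn) ϑ)
          LinearMap.id (TensorProduct.map H.comul LinearMap.id (Y.coact m)) =
        - TensorProduct.map (X.d ∘ₗ ϑ + ϑ ∘ₗ H.d) LinearMap.id (Y.coact m) := by
      generalize Y.coact m = z
      induction z with
      | zero => simp
      | add a b ha hb => simp only [map_add, ha, hb]; abel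
      | tmul c m =>
        have := hϑ.twisting c
        rw [← neg_eq_iff_eq_neg] at this
        simp only [TensorProduct.map_tmul, LinearMap.comp_apply, LinearMap.add_apply]
        rw [← this, TensorProduct.neg_tmul]
        rfl
    rw [h3, TensorProduct.tmul_zero]
    generalize Y.coact m = z
    induction z with
    | zero => simp
    | add a b ha hb =>
      have := congrArg₂ (· + ·) ha hb
      simp only [map_add, add_zero] at this ⊢
      refine Eq.trans ?_ this
      abel
    | tmul c m =>
      simp [DGModule.tensorD_tmul, TensorProduct.add_tmul]
      abel
  induction z using X.tensor_induction Y.toDGModule with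
  | add x y hx hy => rw [map_add, map_add, hx, hy, add_zero]
  | tmul i j a m ha hm =>
    rw [← leftMul_tmul_one X a m, twistedD_leftMul X Y ϑ ha, map_add, map_smul,
      twistedD_leftMul X Y ϑ ha, twistedD_leftMul X Y ϑ (X.d_mem _ _ ha), key, X.d_d,
      koszulSign_succ]
    simp

end TwistedProduct

/-! ### The twisted tensor product as a dg algebra -/

noncomputable section TwistedAlgebra

variable {R : Type u} [CommRing R] {A : Type v} [AddCommGroup A] [Module R A]
  {C : Type w} [AddCommGroup C] [Module R C] {M : Type x} [AddCommGroup M] [Module R M]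
  {H : DGHopfAlgebra R C} {ϑ : C →ₗ[R] A} {Ψ : C →ₗ[R] A ⊗[R] C →ₗ[R] A}

theorem map_prefixTmul {V W : Type*} [AddCommGroup V] [Module R V] [AddCommGroup W] [Module R W]
    (f : A →ₗ[R] A) (g : V →ₗ[R] V) (h : W →ₗ[R] W) (a : A) (z : V ⊗[R] W) :
    TensorProduct.map (TensorProduct.map f g) h (prefixTmul a z) =
      prefixTmul (f a) (TensorProduct.map g h z) := by
  induction z with
  | zero => simp
  | tmul x y => simp [prefixTmul_tmul]
  | add x y hx hy => simp only [map_add, hx, hy]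

theorem prefixTmul_smul_left {P Q : Type*} [AddCommGroup P] [Module R P] [AddCommGroup Q]
    [Module R Q] (r : R) (a : A) (z : P ⊗[R] Q) :
    prefixTmul (r • a) z = r • prefixTmul a z := by
  simp [prefixTmul]

theorem map_sgn_prefixTmul {V W : Type*} [AddCommGroup V] [Module R V] [AddCommGroup W]
    [Module R W] (X : DGModule R A) (Y : DGModule R V) (Z : DGModule R W) {k l : ℤ} {a : A}
    (ha : a ∈ X.gr k) {z : V ⊗[R] W} (hz : z ∈ Y.tensorGr Z l) :
    TensorProduct.map (TensorProduct.map X.sgn Y.sgn) Z.sgn (prefixTmul a z) =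
      koszulSign R (k + l) • prefixTmul a z := by
  rw [map_prefixTmul, X.sgn_of_mem ha, Y.map_sgn_tensorGr Z hz, prefixTmul_smul_left, map_smul,
    smul_smul, koszulSign_add]

theorem map_sgn_tmul (X : DGModule R A) (Y : DGModule R C) {k l : ℤ} {a : A} {c : C}
    (ha : a ∈ X.gr k) (hc : c ∈ Y.gr l) :
    TensorProduct.map X.sgn Y.sgn (a ⊗ₜ c) = koszulSign R (k + l) • (a ⊗ₜ[R] c) :=
  X.map_sgn_tensorGr Y (X.tmul_mem_tensorGr Y ha hc rfl)

/-- The sign involution of `A ⊗ C`. -/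
abbrev pairSgn (X : HirschAlgebra R A) (H : DGHopfAlgebra R C) : A ⊗[R] C →ₗ[R] A ⊗[R] C :=
  TensorProduct.map X.sgn H.sgn

/-- The product `(1 ⊗ m)(a ⊗ n) = ∑ ± Ψ(c, a ⊗ c') ⊗ m' n'`, where `∑ c ⊗ m'` and `∑ c' ⊗ n'` are
the coactions on `m` and `n`. -/
def comoduleMul (X : HirschAlgebra R A) (Y : DGComoduleAlgebra H M)
    (Ψ : C →ₗ[R] A ⊗[R] C →ₗ[R] A) : M →ₗ[R] A ⊗[R] M →ₗ[R] A ⊗[R] M :=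
  (smashMul Y.toDGAlgebra Ψ (pairSgn X H)).compl₁₂ Y.coact
    ((TensorProduct.assoc R A C M).symm.toLinearMap ∘ₗ TensorProduct.map LinearMap.id Y.coact)

theorem comoduleMul_tmul (X : HirschAlgebra R A) (Y : DGComoduleAlgebra H M) (m : M) (a : A)
    (n : M) : comoduleMul X Y Ψ m (a ⊗ₜ n) =
      smashMul Y.toDGAlgebra Ψ (pairSgn X H) (Y.coact m) (prefixTmul a (Y.coact n)) := rfl

/-- The twisted product `(a ⊗ m) y = a ((1 ⊗ m) y)` on `A ⊗ M`. -/
def twistedMul (X : HirschAlgebra R A) (Y : DGComoduleAlgebra H M)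
    (Ψ : C →ₗ[R] A ⊗[R] C →ₗ[R] A) : A ⊗[R] M →ₗ[R] A ⊗[R] M →ₗ[R] A ⊗[R] M :=
  TensorProduct.lift
    ((LinearMap.llcomp R (A ⊗[R] M) (A ⊗[R] M) (A ⊗[R] M) ∘ₗ leftMul X).compl₂
      (comoduleMul X Y Ψ))

theorem twistedMul_tmul (X : HirschAlgebra R A) (Y : DGComoduleAlgebra H M) (a : A) (m : M)
    (y : A ⊗[R] M) : twistedMul X Y Ψ (a ⊗ₜ m) y = leftMul X a (comoduleMul X Y Ψ m y) := rfl

theorem twistedMul_leftMul (X : HirschAlgebra R A) (Y : DGComoduleAlgebra H M) (a : A)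
    (x y : A ⊗[R] M) : twistedMul X Y Ψ (leftMul X a x) y = leftMul X a (twistedMul X Y Ψ x y) := by
  induction x with
  | zero => simp
  | add x z hx hz => simp only [map_add, LinearMap.add_apply, hx, hz]
  | tmul b m => rw [leftMul_tmul, twistedMul_tmul, twistedMul_tmul, leftMul_mul]

theorem tensorMul_tmul (X : DGAlgebra R A) (Y : DGAlgebra R M) {j l : ℤ} (a : A) {m : M}
    (hm : m ∈ Y.gr j) {b : A} (hb : b ∈ X.gr l) (n : M) :
    X.tensorMul Y ((a ⊗ₜ m) ⊗ₜ (b ⊗ₜ n)) =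
      koszulSign R (j * l) • (X.mul a b ⊗ₜ[R] Y.mul m n) := by
  rw [DGAlgebra.tensorMul, LinearMap.comp_apply,
    koszulSwap_tmul _ _ _ j _ _ _ _ (Y.even_of_mem hm) (Y.odd_of_mem hm),
    signPow_apply _ j (X.sgn_of_mem hb)]
  simp only [TensorProduct.tmul_smul, ← TensorProduct.smul_tmul', map_smul,
    TensorProduct.map_tmul, TensorProduct.lift.tmul]

theorem tailMul_tmul_smul (X : HirschAlgebra R A) (hΨ : IsTwistedPairing X H ϑ Ψ)
    {i i' k l : ℤ} {c₁ : C} (hc₁ : c₁ ∈ H.gr i) {c₁' : C} (hc₁' : c₁' ∈ H.gr i') {a : A}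
    (ha : a ∈ X.gr k) {c₂ : C} (hc₂ : c₂ ∈ H.gr l) (c₂' : C) :
    tailMul X H ϑ Ψ (c₁ ⊗ₜ c₁') ((a ⊗ₜ c₂) ⊗ₜ c₂') =
      koszulSign R (i' * (k + l) + (i + k + l)) •
        X.mul (Ψ c₁ (a ⊗ₜ c₂)) (ϑ (H.mul c₁' c₂')) := by
  rw [tailMul_tmul X H ϑ Ψ c₁ hc₁',
    signPow_apply _ i' (map_sgn_tmul X.toDGModule H.toDGModule ha hc₂), map_smul, map_smul,
    X.sgn_of_mem (hΨ.mem _ _ _ _ _ _ hc₁ ha hc₂), smul_smul, map_smul, LinearMap.smul_apply,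
    koszulSign_add (i' * (k + l))]

/-- The computation behind `cap_smashMul`, with `z` and `w` in place of the coactions on `m` and
`n`. -/
theorem absorbMul_tensorMul (X : HirschAlgebra R A) (Y : DGAlgebra R M)
    (hΨ : IsTwistedPairing X H ϑ Ψ) {i j k l n : ℤ} {c₁ : C} (hc₁ : c₁ ∈ H.gr i) {a : A}
    (ha : a ∈ X.gr k) {c₂ : C} (hc₂ : c₂ ∈ H.gr l) {z : C ⊗[R] M}
    (hz : z ∈ H.tensorGr Y.toDGModule j) (w : C ⊗[R] M) (hn : n = j * (k + l) + (i + k + l)) :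
    koszulSign R n • absorbMul X ϑ (prefixTmul (Ψ c₁ (a ⊗ₜ c₂))
        (H.toDGAlgebra.tensorMul Y (z ⊗ₜ w))) =
      smashMul Y (tailMul X H ϑ Ψ) (TensorProduct.map (pairSgn X H) H.sgn)
        ((TensorProduct.assoc R C C M).symm (c₁ ⊗ₜ z))
        ((TensorProduct.assoc R (A ⊗[R] C) C M).symm ((a ⊗ₜ c₂) ⊗ₜ w)) := by
  refine H.tensorGr_induction Y.toDGModule ?_ ?_ hz
  swap
  · intro x y hx hy
    rw [TensorProduct.add_tmul, map_add, map_add, map_add, smul_add, hx, hy,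
      TensorProduct.tmul_add, map_add, map_add, LinearMap.add_apply]
  intro i' j' c₁' m' hc₁' hm' hij
  induction w using H.tensor_induction Y.toDGModule with
  | add x y hx hy =>
    rw [TensorProduct.tmul_add, map_add, map_add, map_add, smul_add, hx, hy,
      TensorProduct.tmul_add, map_add, map_add]
  | tmul l' _ c₂' n' hc₂' hn' =>
  have h2 : (TensorProduct.map (pairSgn X H) H.sgn) ((a ⊗ₜ[R] c₂) ⊗ₜ[R] c₂') =
      koszulSign R (k + l + l') • ((a ⊗ₜ[R] c₂) ⊗ₜ[R] c₂') := by
    rw [TensorProduct.map_tmul, map_sgn_tmul X.toDGModule H.toDGModule ha hc₂,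
      H.sgn_of_mem hc₂', TensorProduct.tmul_smul, ← TensorProduct.smul_tmul', smul_smul,
      koszulSign_add (k + l) l', mul_comm]
  rw [tensorMul_tmul _ _ _ hm' hc₂', map_smul, map_smul, prefixTmul_tmul, absorbMul_tmul,
    TensorProduct.assoc_symm_tmul, TensorProduct.assoc_symm_tmul,
    smashMul_tmul_smul _ _ _ hm' _ h2, tailMul_tmul_smul X hΨ hc₁ hc₁' ha hc₂,
    ← TensorProduct.smul_tmul', smul_smul, smul_smul, ← koszulSign_add, ← koszulSign_add]
  congr 2
  subst hn hij
  ring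

/-- The cap product with `ϑ` of a product `Ψ(c₁, q) ⊗ m n`, in terms of the coactions on `m` and
`n`. -/
theorem cap_smashMul (X : HirschAlgebra R A) (Y : DGComoduleAlgebra H M)
    (hΨ : IsTwistedPairing X H ϑ Ψ) (z : C ⊗[R] M) (w : (A ⊗[R] C) ⊗[R] M) :
    cap X Y ϑ (smashMul Y.toDGAlgebra Ψ (pairSgn X H) z w) =
      - smashMul Y.toDGAlgebra (tailMul X H ϑ Ψ) (TensorProduct.map (pairSgn X H) H.sgn)
        ((TensorProduct.assoc R C C M).symm (TensorProduct.map LinearMap.id Y.coact z))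
        ((TensorProduct.assoc R (A ⊗[R] C) C M).symm
          (TensorProduct.map LinearMap.id Y.coact w)) := by
  induction z using H.tensor_induction Y.toDGModule with
  | add x y hx hy => simp only [map_add, LinearMap.add_apply, hx, hy, neg_add]
  | tmul i j c₁ m hc₁ hm =>
  induction w with
  | zero => simp
  | add x y hx hy => simp only [map_add, hx, hy, neg_add]
  | tmul q n =>
  induction q using X.tensor_induction H.toDGModule with
  | add x y hx hy => simp only [map_add, TensorProduct.add_tmul, hx, hy, neg_add]
  | tmul k l a c₂ ha hc₂ =>
  rw [smashMul_tmul_smul _ _ _ hm _ (map_sgn_tmul X.toDGModule H.toDGModule ha hc₂), map_smul,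
    cap_tmul, Y.coact_mul, X.sgn_of_mem (hΨ.mem _ _ _ _ _ _ hc₁ ha hc₂), smul_neg,
    prefixTmul_smul_left, map_smul, smul_smul, ← koszulSign_add, TensorProduct.map_tmul,
    TensorProduct.map_tmul]
  congr 1
  exact absorbMul_tensorMul X Y.toDGAlgebra hΨ hc₁ ha hc₂ (Y.coact_mem j m hm) _ rfl

/-- The product of `∑ ϑ(c) ⊗ m` with `y`, in terms of the coactions on `m` and `y`. -/
theorem twistedMul_map_left (X : HirschAlgebra R A) (Y : DGComoduleAlgebra H M)
    (z : C ⊗[R] M) (y : A ⊗[R] M) :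
    twistedMul X Y Ψ (TensorProduct.map ϑ LinearMap.id z) y =
      smashMul Y.toDGAlgebra (headMul X ϑ Ψ) (pairSgn X H)
        ((TensorProduct.assoc R C C M).symm (TensorProduct.map LinearMap.id Y.coact z))
        ((TensorProduct.assoc R A C M).symm (TensorProduct.map LinearMap.id Y.coact y)) := by
  induction z with
  | zero => simp
  | add a b ha hb => simp only [map_add, LinearMap.add_apply, ha, hb]
  | tmul c m =>
  rw [TensorProduct.map_tmul, twistedMul_tmul]
  change leftMul X (ϑ c) (smashMul Y.toDGAlgebra Ψ (pairSgn X H) (Y.coact m)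
    ((TensorProduct.assoc R A C M).symm (TensorProduct.map LinearMap.id Y.coact y))) = _
  rw [TensorProduct.map_tmul, LinearMap.id_apply]
  generalize (TensorProduct.assoc R A C M).symm (TensorProduct.map LinearMap.id Y.coact y) = w
  generalize Y.coact m = z
  induction z using H.tensor_induction Y.toDGModule with
  | add a b ha hb => simp only [map_add, TensorProduct.tmul_add, LinearMap.add_apply, ha, hb]
  | tmul i j c' m hc' hm =>
  induction w with
  | zero => simp
  | add a b ha hb => simp only [map_add, ha, hb]
  | tmul q n =>
  rw [TensorProduct.assoc_symm_tmul, smashMul_tmul _ _ _ hm, smashMul_tmul _ _ _ hm,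
    leftMul_tmul, headMul_tmul]

/-- The product rule for `(1 ⊗ m)(a ⊗ n)`, as an identity that is linear in the coactions `z₁` on
`m` and `z₂` on `n`. The terms with `d m` and `d n` match by signs, the others by the Hirsch
identity. -/
theorem smashMul_leibniz (X : HirschAlgebra R A) (Y : DGAlgebra R M)
    (hϑ : ∀ (i : ℤ) (c : C), c ∈ H.gr i → ϑ c ∈ X.gr (i + 1))
    (hΨ : IsTwistedPairing X H ϑ Ψ) {n k : ℤ} {z₁ : C ⊗[R] M} (hz₁ : z₁ ∈ H.tensorGr Y.toDGModule n)
    {a : A} (ha : a ∈ X.gr k) (z₂ : C ⊗[R] M) :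
    X.tensorD Y.toDGModule (smashMul Y Ψ (pairSgn X H) z₁ (prefixTmul a z₂)) -
      smashMul Y (tailMul X H ϑ Ψ) (TensorProduct.map (pairSgn X H) H.sgn)
        (TensorProduct.map H.comul LinearMap.id z₁)
        (TensorProduct.map (prefixTmul a ∘ₗ H.comul) LinearMap.id z₂) =
    smashMul Y Ψ (pairSgn X H) (H.tensorD Y.toDGModule z₁) (prefixTmul a z₂) -
      smashMul Y (headMul X ϑ Ψ) (pairSgn X H) (TensorProduct.map H.comul LinearMap.id z₁)
        (prefixTmul a z₂) +
      koszulSign R n • (smashMul Y Ψ (pairSgn X H) z₁ (prefixTmul (X.d a) z₂) +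
        koszulSign R k • smashMul Y Ψ (pairSgn X H) z₁ (prefixTmul a (H.tensorD Y.toDGModule z₂)) -
        koszulSign R k • smashMul Y Ψ (pairSgn X H) z₁
          (TensorProduct.map (absorbMul X ϑ ∘ₗ prefixTmul a ∘ₗ H.comul) LinearMap.id z₂)) := by
  refine H.tensorGr_induction Y.toDGModule ?_ ?_ hz₁
  swap
  · intro x y hx hy
    have := congrArg₂ (· + ·) hx hy
    simp only [map_add, LinearMap.add_apply, smul_add, smul_sub] at this ⊢
    refine Eq.trans ?_ (this.trans ?_) <;> abel
  intro i j c₁ m₁ hc₁ hm₁ hij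
  subst hij
  induction z₂ using H.tensor_induction Y.toDGModule with
  | add x y hx hy =>
    have := congrArg₂ (· + ·) hx hy
    simp only [map_add, smul_add, smul_sub] at this ⊢
    refine Eq.trans ?_ (this.trans ?_) <;> abel
  | tmul l l' c₂ m₂ hc₂ hm₂ =>
  have hs : ∀ {k l : ℤ} {a : A} {c : C}, a ∈ X.gr k → c ∈ H.gr l → _ := fun ha hc =>
    map_sgn_tmul X.toDGModule H.toDGModule ha hc
  have h2 : TensorProduct.map (pairSgn X H) H.sgn (prefixTmul a (H.comul c₂)) =
      koszulSign R (k + l) • prefixTmul a (H.comul c₂) :=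
    map_sgn_prefixTmul X.toDGModule H.toDGModule H.toDGModule ha (H.comul_mem l c₂ hc₂)
  have h3 : pairSgn X H (absorbMul X ϑ (prefixTmul a (H.comul c₂))) =
      koszulSign R (k + l + 1) • absorbMul X ϑ (prefixTmul a (H.comul c₂)) :=
    X.map_sgn_tensorGr H.toDGModule (absorbMul_mem X H.toDGModule hϑ ha (H.comul_mem l c₂ hc₂))
  simp only [DGModule.tensorD_tmul, map_add, LinearMap.add_apply, prefixTmul_tmul,
    TensorProduct.map_tmul, LinearMap.id_apply, LinearMap.comp_apply]
  rw [H.sgn_of_mem hc₁, H.sgn_of_mem hc₂]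
  simp only [smashMul_tmul_smul _ _ _ hm₁ _ (hs ha hc₂), smashMul_tmul_smul _ _ _ hm₁ _ h2,
    smashMul_tmul_smul _ _ _ (Y.d_mem _ _ hm₁) _ (hs ha hc₂),
    smashMul_tmul_smul _ _ _ hm₁ _ (hs (X.d_mem _ _ ha) hc₂),
    smashMul_tmul_smul _ _ _ hm₁ _ (hs ha (H.d_mem _ _ hc₂)),
    smashMul_tmul_smul _ _ _ hm₁ _ h3, TensorProduct.tmul_smul, ← TensorProduct.smul_tmul',
    map_smul, LinearMap.smul_apply, DGModule.tensorD_tmul,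
    X.sgn_of_mem (hΨ.mem _ _ _ _ _ _ hc₁ ha hc₂), hΨ.hirsch _ _ _ _ _ _ hc₁ ha hc₂,
    Y.leibniz _ _ _ hm₁, TensorProduct.add_tmul, TensorProduct.sub_tmul, TensorProduct.tmul_add,
    zsmul_negOnePow (R := R)]
  rw [show (j + 1) * (k + l) = j * (k + l) + k + l by ring,
    show j * (k + 1 + l) = j * (k + l) + j by ring,
    show j * (k + (l + 1)) = j * (k + l) + j by ring,
    show j * (k + l + 1) = j * (k + l) + j by ring]
  simp only [koszulSign_add]
  obtain hj | hj : koszulSign R j = 1 ∨ koszulSign R j = -1 := by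
    rw [koszulSign_eq_ite]; split_ifs <;> simp
  all_goals
    simp only [hj]
    module

theorem assoc_symm_map_coact_prefixTmul (Y : DGComoduleAlgebra H M) (a : A) (m : M) :
    (TensorProduct.assoc R (A ⊗[R] C) C M).symm
        (TensorProduct.map LinearMap.id Y.coact (prefixTmul a (Y.coact m))) =
      TensorProduct.map (prefixTmul a ∘ₗ H.comul) LinearMap.id (Y.coact m) := by
  have h : ∀ z : C ⊗[R] M, (TensorProduct.assoc R (A ⊗[R] C) C M).symm
        (TensorProduct.map LinearMap.id Y.coact (prefixTmul a z)) =
      TensorProduct.map (prefixTmul a) LinearMap.id ((TensorProduct.assoc R C C M).symm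
        (TensorProduct.map LinearMap.id Y.coact z)) := by
    intro z
    induction z with
    | zero => simp
    | add x y hx hy => simp only [map_add, hx, hy]
    | tmul c m =>
      rw [prefixTmul_tmul, TensorProduct.map_tmul, TensorProduct.map_tmul, LinearMap.id_apply,
        LinearMap.id_apply]
      generalize Y.coact m = z
      induction z with
      | zero => simp
      | add x y hx hy => simp only [TensorProduct.tmul_add, map_add, hx, hy]
      | tmul c' m => rfl
  rw [h, coassoc_symm, ← LinearMap.comp_apply, ← TensorProduct.map_comp, LinearMap.id_comp]

/-- The product of `1 ⊗ m` with `∑ a ϑ(c) ⊗ n'`, the cap product term of `d_ϑ (a ⊗ n)`. -/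
theorem comoduleMul_absorbMul (X : HirschAlgebra R A) (Y : DGComoduleAlgebra H M) (m n : M)
    (a : A) : comoduleMul X Y Ψ m (absorbMul X ϑ (prefixTmul a (Y.coact n))) =
      smashMul Y.toDGAlgebra Ψ (pairSgn X H) (Y.coact m)
        (TensorProduct.map (absorbMul X ϑ ∘ₗ prefixTmul a ∘ₗ H.comul) LinearMap.id
          (Y.coact n)) := by
  have h : ∀ z : C ⊗[R] M, comoduleMul X Y Ψ m (absorbMul X ϑ (prefixTmul a z)) =
      smashMul Y.toDGAlgebra Ψ (pairSgn X H) (Y.coact m)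
        (TensorProduct.map (absorbMul X ϑ ∘ₗ prefixTmul a) LinearMap.id
          ((TensorProduct.assoc R C C M).symm (TensorProduct.map LinearMap.id Y.coact z))) := by
    intro z
    induction z with
    | zero => simp
    | add x y hx hy => simp only [map_add, hx, hy]
    | tmul c n =>
      rw [prefixTmul_tmul, absorbMul_tmul, comoduleMul_tmul, TensorProduct.map_tmul]
      congr 1
      generalize Y.coact n = z
      induction z with
      | zero => simp
      | add x y hx hy => simp only [TensorProduct.tmul_add, map_add, hx, hy]
      | tmul c' m => rfl
  rw [h, coassoc_symm, TensorProduct.map_map, LinearMap.id_comp, LinearMap.comp_assoc]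

/-- The product rule for products `(1 ⊗ m) y`. -/
theorem twistedD_comoduleMul (X : HirschAlgebra R A) (Y : DGComoduleAlgebra H M)
    (hϑ : ∀ (i : ℤ) (c : C), c ∈ H.gr i → ϑ c ∈ X.gr (i + 1))
    (hΨ : IsTwistedPairing X H ϑ Ψ) {i : ℤ} {m : M} (hm : m ∈ Y.gr i) (y : A ⊗[R] M) :
    twistedD X Y ϑ (comoduleMul X Y Ψ m y) =
      twistedMul X Y Ψ (twistedD X Y ϑ (X.one ⊗ₜ m)) y +
        koszulSign R i • comoduleMul X Y Ψ m (twistedD X Y ϑ y) := by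
  induction y using X.tensor_induction Y.toDGModule with
  | add x y hx hy => simp only [map_add, hx, hy, smul_add]; abel
  | tmul k j a n ha hn =>
  have h := smashMul_leibniz X Y.toDGAlgebra hϑ hΨ (Y.coact_mem i m hm) ha (Y.coact n)
  rw [twistedD_one_tmul, map_sub, LinearMap.sub_apply, twistedMul_map_left, twistedMul_tmul,
    leftMul_one_left, twistedD, LinearMap.add_apply, LinearMap.add_apply, comoduleMul_tmul,
    comoduleMul_tmul, cap_smashMul X Y hΨ, DGModule.tensorD_tmul, cap_tmul, coassoc_symm,
    assoc_symm_map_coact_prefixTmul, Y.coact_d, ← sub_eq_add_neg, h, X.sgn_of_mem ha,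
    prefixTmul_smul_left, ← TensorProduct.smul_tmul']
  simp only [map_add, map_neg, map_smul]
  rw [comoduleMul_absorbMul, comoduleMul_tmul, comoduleMul_tmul, Y.coact_d, ← sub_eq_add_neg]
  rfl

theorem twistedMul_leibniz (X : HirschAlgebra R A) (Y : DGComoduleAlgebra H M)
    (hϑ : ∀ (i : ℤ) (c : C), c ∈ H.gr i → ϑ c ∈ X.gr (i + 1))
    (hΨ : IsTwistedPairing X H ϑ Ψ) {i : ℤ} {x : A ⊗[R] M}
    (hx : x ∈ X.tensorGr Y.toDGModule i) (y : A ⊗[R] M) :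
    twistedD X Y ϑ (twistedMul X Y Ψ x y) = twistedMul X Y Ψ (twistedD X Y ϑ x) y +
      koszulSign R i • twistedMul X Y Ψ x (twistedD X Y ϑ y) := by
  refine X.tensorGr_induction Y.toDGModule ?_ ?_ hx
  · intro k j a m ha hm hk
    subst hk
    rw [twistedMul_tmul, twistedMul_tmul, twistedD_leftMul X Y ϑ ha,
      twistedD_comoduleMul X Y hϑ hΨ hm, ← leftMul_tmul_one X a m, twistedD_leftMul X Y ϑ ha,
      leftMul_tmul, X.mul_one]
    simp only [map_add, LinearMap.add_apply, twistedMul_tmul, map_smul, LinearMap.smul_apply,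
      twistedMul_leftMul, smul_add, smul_smul, koszulSign_add, add_assoc]
  · intro x z hx hz
    simp only [map_add, LinearMap.add_apply, hx, hz, smul_add]
    abel

theorem smashMul_mem (X : HirschAlgebra R A) (Y : DGAlgebra R M)
    (hΨ : IsTwistedPairing X H ϑ Ψ) {i j k n : ℤ} {a : A} (ha : a ∈ X.gr k) {z w : C ⊗[R] M}
    (hz : z ∈ H.tensorGr Y.toDGModule i) (hw : w ∈ H.tensorGr Y.toDGModule j)
    (hn : i + (k + j) = n) :
    smashMul Y Ψ (pairSgn X H) z (prefixTmul a w) ∈ X.tensorGr Y.toDGModule n := by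
  refine H.tensorGr_induction Y.toDGModule ?_ ?_ hz
  · intro p q c m hc hm h
    refine H.tensorGr_induction Y.toDGModule ?_ ?_ hw
    · intro p' q' c' m' hc' hm' h'
      rw [prefixTmul_tmul, smashMul_tmul_smul _ _ _ hm _
        (map_sgn_tmul X.toDGModule H.toDGModule ha hc')]
      exact Submodule.smul_mem _ _ (X.tmul_mem_tensorGr _ (hΨ.mem _ _ _ _ _ _ hc ha hc')
        (Y.mul_mem _ _ _ _ hm hm') (by omega))
    · intro x y hx hy
      simp only [map_add]; exact add_mem hx hy
  · intro x y hx hy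
    simp only [map_add, LinearMap.add_apply]; exact add_mem hx hy

theorem twistedMul_mem (X : HirschAlgebra R A) (Y : DGComoduleAlgebra H M)
    (hΨ : IsTwistedPairing X H ϑ Ψ) {i j : ℤ} {x y : A ⊗[R] M}
    (hx : x ∈ X.tensorGr Y.toDGModule i) (hy : y ∈ X.tensorGr Y.toDGModule j) :
    twistedMul X Y Ψ x y ∈ X.tensorGr Y.toDGModule (i + j) := by
  refine X.tensorGr_induction Y.toDGModule ?_ ?_ hx
  · intro p q a m ha hm h
    refine X.tensorGr_induction Y.toDGModule ?_ ?_ hy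
    · intro p' q' a' m' ha' hm' h'
      rw [twistedMul_tmul, comoduleMul_tmul]
      have := leftMul_mem X Y.toDGModule ha (smashMul_mem X Y.toDGAlgebra hΨ ha'
        (Y.coact_mem _ _ hm) (Y.coact_mem _ _ hm') rfl)
      rwa [show p + (q + (p' + q')) = i + j by omega] at this
    · intro x y hx hy
      simp only [map_add]; exact add_mem hx hy
  · intro x y hx hy
    simp only [map_add, LinearMap.add_apply]; exact add_mem hx hy

/-- The counit law of the coaction, tensored with `a`. -/
theorem sum_counit_coact (Y : DGComoduleAlgebra H M) (a : A) (m : M) :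
    TensorProduct.map (LinearMap.toSpanSingleton R A a ∘ₗ H.counit) LinearMap.id (Y.coact m) =
      a ⊗ₜ[R] m := by
  conv_rhs => rw [← Y.coact_counit m]
  generalize Y.coact m = z
  induction z with
  | zero => simp
  | add x y hx hy => simp only [map_add, TensorProduct.tmul_add, hx, hy]
  | tmul c m => simp [TensorProduct.smul_tmul]

theorem one_twistedMul (X : HirschAlgebra R A) (Y : DGComoduleAlgebra H M)
    (hΨ : IsTwistedPairing X H ϑ Ψ) (y : A ⊗[R] M) :
    twistedMul X Y Ψ (X.one ⊗ₜ Y.one) y = y := by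
  rw [twistedMul_tmul, leftMul_one_left]
  induction y with
  | zero => simp
  | add x y hx hy => rw [map_add, hx, hy]
  | tmul a m =>
  rw [comoduleMul_tmul, Y.coact_one, ← sum_counit_coact Y a m]
  generalize Y.coact m = z
  induction z with
  | zero => simp
  | add x y hx hy => simp only [map_add, hx, hy]
  | tmul c m =>
  rw [prefixTmul_tmul, smashMul_tmul _ _ _ Y.one_mem, Y.one_mul]
  simp [signPow, hΨ.one_left]

theorem twistedMul_one (X : HirschAlgebra R A) (Y : DGComoduleAlgebra H M)
    (hΨ : IsTwistedPairing X H ϑ Ψ) (x : A ⊗[R] M) :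
    twistedMul X Y Ψ x (X.one ⊗ₜ Y.one) = x := by
  induction x with
  | zero => simp
  | add x y hx hy => rw [map_add, LinearMap.add_apply, hx, hy]
  | tmul a m =>
  have h : comoduleMul X Y Ψ m (X.one ⊗ₜ Y.one) = X.one ⊗ₜ m := by
    rw [comoduleMul_tmul, Y.coact_one, prefixTmul_tmul, ← sum_counit_coact Y X.one m]
    generalize Y.coact m = z
    induction z using H.tensor_induction Y.toDGModule with
    | add x y hx hy => simp only [map_add, LinearMap.add_apply, hx, hy]
    | tmul i j c m hc hm =>
    rw [smashMul_tmul_smul _ _ _ hm _ (map_sgn_tmul X.toDGModule H.toDGModule X.one_mem H.one_mem),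
      Y.mul_one, hΨ.one_middle, H.counit_one]
    simp [koszulSign_zero]
  rw [twistedMul_tmul, h, leftMul_tmul_one]

/-- The twisted tensor product `A ⊗_ϑ M` as a dg algebra, for a twisted pairing `Ψ`. -/
def twistedAlgebra (X : HirschAlgebra R A) (Y : DGComoduleAlgebra H M)
    (hϑ : IsTwistingCochain H X ϑ) (hΨ : IsTwistedPairing X H ϑ Ψ) : DGAlgebra R (A ⊗[R] M) where
  gr := X.tensorGr Y.toDGModule
  isInternal := X.tensorGr_isInternal Y.toDGModule
  d := twistedD X Y ϑ
  d_mem _ _ hz := twistedD_mem X Y hϑ.map_mem hz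
  d_d := twistedD_twistedD X Y hϑ
  mul := twistedMul X Y Ψ
  one := X.one ⊗ₜ Y.one
  mul_mem _ _ _ _ hx hy := twistedMul_mem X Y hΨ hx hy
  one_mem := X.tmul_mem_tensorGr Y.toDGModule X.one_mem Y.one_mem rfl
  one_mul := one_twistedMul X Y hΨ
  mul_one := twistedMul_one X Y hΨ
  leibniz i x y hx := by
    rw [zsmul_negOnePow (R := R)]
    exact twistedMul_leibniz X Y hϑ.map_mem hΨ hx y

end TwistedAlgebra

/-! ### Homogeneous words -/

noncomputable section HomogeneousWords

variable {R : Type u} [CommRing R] {W : Type v} [AddCommGroup W] [Module R W]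

/-- `IsWord g n t`: the element `t` of the tensor algebra is a word `[a₁|…|aₖ]` in homogeneous
letters, `aⱼ ∈ g iⱼ`, of suspended degree `n = ∑ⱼ (iⱼ - 1)`. -/
inductive IsWord (g : ℤ → Submodule R W) : ℤ → TensorAlgebra R W → Prop
  | one : IsWord g 0 1
  | cons {i n m : ℤ} {a : W} {t : TensorAlgebra R W} (ha : a ∈ g i) (ht : IsWord g n t)
      (hm : i - 1 + n = m) : IsWord g m (TensorAlgebra.ι R a * t)

variable {g : ℤ → Submodule R W}

theorem IsWord.mul {n m : ℤ} {s t : TensorAlgebra R W} (hs : IsWord g n s) (ht : IsWord g m t) :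
    IsWord g (n + m) (s * t) := by
  induction hs with
  | one => simpa using ht
  | cons ha _ hm ih => rw [_root_.mul_assoc]; exact .cons ha ih (by omega)

theorem IsWord.letter {i : ℤ} {a : W} (ha : a ∈ g i) :
    IsWord g (i - 1) (TensorAlgebra.ι R a) := by
  simpa using IsWord.cons ha .one rfl

/-- The words span the tensor algebra if the homogeneous letters span the module of letters. -/
@[elab_as_elim]
theorem word_induction (hg : ⨆ i, g i = ⊤) {p : TensorAlgebra R W → Prop}
    (word : ∀ n t, IsWord g n t → p t) (smul : ∀ (r : R) t, p t → p (r • t))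
    (add : ∀ s t, p s → p t → p (s + t)) (t : TensorAlgebra R W) : p t := by
  have zero : p 0 := by simpa using smul 0 1 (word 0 1 .one)
  have h : t ∈ Submodule.span R {t | ∃ n, IsWord g n t} := by
    induction t using TensorAlgebra.induction with
    | algebraMap r =>
      rw [Algebra.algebraMap_eq_smul_one]
      exact Submodule.smul_mem _ _ (Submodule.subset_span ⟨0, .one⟩)
    | ι a =>
      have ha : a ∈ ⨆ i, g i := hg ▸ Submodule.mem_top
      induction ha using Submodule.iSup_induction' with
      | mem i a ha => exact Submodule.subset_span ⟨_, .letter ha⟩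
      | zero => simp
      | add a b _ _ ha hb => rw [map_add]; exact add_mem ha hb
    | mul s t hs ht =>
      have := Submodule.mul_mem_mul hs ht
      rw [Submodule.span_mul_span] at this
      refine Submodule.span_mono ?_ this
      rintro _ ⟨s, ⟨n, hs⟩, t, ⟨m, ht⟩, rfl⟩
      exact ⟨_, hs.mul ht⟩
    | add s t hs ht => exact add_mem hs ht
  induction h using Submodule.span_induction with
  | mem t ht => exact word _ _ ht.choose_spec
  | zero => exact zero
  | add s t _ _ hs ht => exact add s t hs ht
  | smul r t _ ht => exact smul r t ht

theorem TensorAlgebra.tprod_zero (a : Fin 0 → W) : TensorAlgebra.tprod R W 0 a = 1 := by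
  simp [TensorAlgebra.tprod_apply]

theorem TensorAlgebra.tprod_succ {k : ℕ} (a : Fin (k + 1) → W) : TensorAlgebra.tprod R W (k + 1) a =
    TensorAlgebra.ι R (a 0) * TensorAlgebra.tprod R W k (Fin.tail a) := by
  simp [TensorAlgebra.tprod_apply, List.ofFn_succ, Fin.tail]

theorem IsWord.exists_tprod {n : ℤ} {t : TensorAlgebra R W} (ht : IsWord g n t) :
    ∃ (k : ℕ) (i : Fin k → ℤ) (a : Fin k → W), (∀ j, a j ∈ g (i j)) ∧ n = (∑ j, i j) - k ∧
      t = TensorAlgebra.tprod R W k a := by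
  induction ht with
  | one => exact ⟨0, Fin.elim0, Fin.elim0, fun j => j.elim0, by simp,
      (TensorAlgebra.tprod_zero _).symm⟩
  | @cons i n m a t ha _ hm ih =>
    obtain ⟨k, j, b, hb, hn, rfl⟩ := ih
    refine ⟨k + 1, Fin.cons i j, Fin.cons a b, ?_, ?_, ?_⟩
    · exact Fin.cases (by simpa using ha) (by simpa using hb)
    · rw [Fin.sum_univ_succ]; simp; omega
    · rw [TensorAlgebra.tprod_succ]; simp

theorem algebraMapInv_cons (a : W) (t : TensorAlgebra R W) :
    TensorAlgebra.algebraMapInv (TensorAlgebra.ι R a * t) = 0 := by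
  simp [TensorAlgebra.algebraMapInv]

theorem IsWord.algebraMapInv_eq_zero {n : ℤ} {t : TensorAlgebra R W} (ht : IsWord g n t)
    (hn : n ≠ 0) : TensorAlgebra.algebraMapInv t = 0 := by
  cases ht with
  | one => exact absurd rfl hn
  | cons => exact algebraMapInv_cons _ _

namespace Words

/-- The projection of words onto words with one letter, `[a] ↦ a`. -/
def letter : TensorAlgebra R W →ₗ[R] W :=
  foldCons ((LinearMap.lsmul R W ∘ₗ TensorAlgebra.algebraMapInv.toLinearMap).flip) 0 0

theorem letter_one : letter (1 : TensorAlgebra R W) = 0 := foldCons_one _ _ _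

theorem letter_cons (a : W) (t : TensorAlgebra R W) :
    letter (TensorAlgebra.ι R a * t) = TensorAlgebra.algebraMapInv t • a := by
  rw [letter, foldCons_cons]; simp

theorem peel_one : peel (1 : TensorAlgebra R W) = 0 := foldCons_one _ _ _

theorem peel_cons (a : W) (t : TensorAlgebra R W) :
    peel (TensorAlgebra.ι R a * t) = a ⊗ₜ t := by
  rw [peel, foldCons_cons]; simp

theorem deconcat_one : deconcat (1 : TensorAlgebra R W) = 1 ⊗ₜ 1 := foldCons_one _ _ _

theorem deconcat_cons (a : W) (t : TensorAlgebra R W) :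
    deconcat (TensorAlgebra.ι R a * t) = 1 ⊗ₜ (TensorAlgebra.ι R a * t) +
      LinearMap.rTensor _ (LinearMap.mul R (TensorAlgebra R W) (TensorAlgebra.ι R a))
        (deconcat t) := by
  rw [deconcat, foldCons_cons]; rfl

variable {W' : Type w} [AddCommGroup W'] [Module R W']

theorem map_one (f : W →ₗ[R] W') : map f 1 = 1 := by simp [map]

theorem map_cons (f : W →ₗ[R] W') (a : W) (t : TensorAlgebra R W) :
    map f (TensorAlgebra.ι R a * t) = TensorAlgebra.ι R (f a) * map f t := by simp [map]

theorem evalOps_tprod (E : ∀ p q : ℕ, (⨂[R]^p W) →ₗ[R] (⨂[R]^q W) →ₗ[R] W) {k l : ℕ}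
    (a : Fin k → W) (b : Fin l → W) :
    evalOps E (TensorAlgebra.tprod R W k a) (TensorAlgebra.tprod R W l b) =
      E k l (PiTensorProduct.tprod R a) (PiTensorProduct.tprod R b) := by
  simp only [evalOps, LinearMap.compl₁₂_apply, AlgHom.toLinearMap_apply,
    TensorAlgebra.toDirectSum_tensorPower_tprod, ← DirectSum.lof_eq_of R,
    DirectSum.toModule_lof, LinearMap.flip_apply]

end Words

/-- The span of the words of degree `n`. -/
def wordGr (g : ℤ → Submodule R W) (n : ℤ) : Submodule R (TensorAlgebra R W) :=
  Submodule.span R {t | IsWord g n t}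

theorem IsWord.mem_wordGr {n : ℤ} {t : TensorAlgebra R W} (ht : IsWord g n t) : t ∈ wordGr g n :=
  Submodule.subset_span ht

theorem cons_mem_wordGr {i n m : ℤ} {a : W} (ha : a ∈ g i) {t : TensorAlgebra R W}
    (ht : t ∈ wordGr g n) (hm : i - 1 + n = m) : TensorAlgebra.ι R a * t ∈ wordGr g m := by
  induction ht using Submodule.span_induction with
  | mem t ht => exact (IsWord.cons ha ht hm).mem_wordGr
  | zero => simp
  | add s t _ _ hs ht => rw [mul_add]; exact add_mem hs ht
  | smul r t _ ht => rw [mul_smul_comm]; exact Submodule.smul_mem _ _ ht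

theorem IsWord.deconcat_mem {n : ℤ} {t : TensorAlgebra R W} (ht : IsWord g n t) :
    Words.deconcat t ∈ gradedTensor (wordGr g) (wordGr g) n := by
  induction ht with
  | one =>
    rw [Words.deconcat_one]
    exact tmul_mem_gradedTensor IsWord.one.mem_wordGr IsWord.one.mem_wordGr rfl
  | cons ha ht hm ih =>
    rw [Words.deconcat_cons]
    refine add_mem (tmul_mem_gradedTensor IsWord.one.mem_wordGr
      (IsWord.cons ha ht hm).mem_wordGr (zero_add _)) ?_
    refine gradedTensor_induction ?_ ?_ ih
    · intro p q s s' hs hs' h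
      exact tmul_mem_gradedTensor (cons_mem_wordGr ha hs rfl) hs' (by omega)
    · intro a b ha hb
      rw [_root_.map_add]; exact add_mem ha hb

theorem deconcat_mem {n : ℤ} {t : TensorAlgebra R W} (ht : t ∈ wordGr g n) :
    Words.deconcat t ∈ gradedTensor (wordGr g) (wordGr g) n := by
  induction ht using Submodule.span_induction with
  | mem t ht => exact IsWord.deconcat_mem ht
  | zero => simp
  | add s t _ _ hs ht => rw [map_add]; exact add_mem hs ht
  | smul r t _ ht => rw [map_smul]; exact Submodule.smul_mem _ _ ht

theorem map_mem_wordGr {W' : Type w} [AddCommGroup W'] [Module R W'] {g' : ℤ → Submodule R W'}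
    {f : W →ₗ[R] W'} (hf : ∀ i a, a ∈ g i → f a ∈ g' i) {n : ℤ} {t : TensorAlgebra R W}
    (ht : t ∈ wordGr g n) : Words.map f t ∈ wordGr g' n := by
  induction ht using Submodule.span_induction with
  | mem t ht =>
    refine IsWord.mem_wordGr ?_
    induction ht with
    | one => rw [Words.map_one]; exact .one
    | cons ha _ hm ih => rw [Words.map_cons]; exact .cons (hf _ _ ha) ih hm
  | zero => simp
  | add s t _ _ hs ht => rw [map_add]; exact add_mem hs ht
  | smul r t _ ht => rw [map_smul]; exact Submodule.smul_mem _ _ ht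

end HomogeneousWords

/-! ### The operations of a Hirsch algebra on words -/

noncomputable section HirschWords

variable {R : Type u} [CommRing R] {A : Type v} [AddCommGroup A] [Module R A]

theorem evalOps_mem (X : HirschAlgebra R A) {n m : ℤ} {s t : TensorAlgebra R A}
    (hs : s ∈ wordGr X.gr n) (ht : t ∈ wordGr X.gr m) :
    Words.evalOps X.E s t ∈ X.gr (n + m + 1) := by
  induction hs using Submodule.span_induction with
  | zero => simp
  | add s t _ _ hs ht => rw [map_add]; exact add_mem hs ht
  | smul r t _ ht => rw [map_smul]; exact Submodule.smul_mem _ _ ht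
  | mem s hs =>
  induction ht using Submodule.span_induction with
  | zero => simp
  | add s t _ _ hs ht => rw [map_add]; exact add_mem hs ht
  | smul r t _ ht => rw [map_smul]; exact Submodule.smul_mem _ _ ht
  | mem t ht =>
  obtain ⟨k, i, a, ha, rfl, rfl⟩ := IsWord.exists_tprod hs
  obtain ⟨l, j, b, hb, rfl, rfl⟩ := IsWord.exists_tprod ht
  rw [Words.evalOps_tprod]
  have := X.E_mem k l i j a b ha hb
  rwa [show ∑ k, i k + ∑ k, j k + 1 - (k : ℤ) - l = ∑ j, i j - k + (∑ i, j i - l) + 1 by ring]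
    at this

theorem evalOps_one_right (X : HirschAlgebra R A) (s : TensorAlgebra R A) :
    Words.evalOps X.E s 1 = Words.letter s := by
  induction s using word_induction X.isInternal.submodule_iSup_eq_top with
  | smul r t ht => rw [map_smul, map_smul, LinearMap.smul_apply, ht]
  | add s t hs ht => rw [map_add, map_add, LinearMap.add_apply, hs, ht]
  | word n s hs =>
  obtain ⟨k, i, a, -, -, rfl⟩ := hs.exists_tprod
  rw [← TensorAlgebra.tprod_zero (Fin.elim0 : Fin 0 → A), Words.evalOps_tprod]
  match k with
  | 0 => rw [X.E_zero_zero, TensorAlgebra.tprod_zero, Words.letter_one]; rfl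
  | 1 =>
    rw [X.E_one_left, TensorAlgebra.tprod_succ, TensorAlgebra.tprod_zero, Words.letter_cons,
      _root_.map_one, one_smul]
  | k + 2 =>
    rw [X.E_left _ (by omega), TensorAlgebra.tprod_succ, TensorAlgebra.tprod_succ,
      Words.letter_cons, algebraMapInv_cons, zero_smul]
    rfl

theorem evalOps_one_left (X : HirschAlgebra R A) (s : TensorAlgebra R A) :
    Words.evalOps X.E 1 s = Words.letter s := by
  induction s using word_induction X.isInternal.submodule_iSup_eq_top with
  | smul r t ht => rw [map_smul, map_smul, ht]
  | add s t hs ht => rw [map_add, map_add, hs, ht]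
  | word n s hs =>
  obtain ⟨k, i, a, -, -, rfl⟩ := hs.exists_tprod
  rw [← TensorAlgebra.tprod_zero (Fin.elim0 : Fin 0 → A), Words.evalOps_tprod]
  match k with
  | 0 => rw [X.E_zero_zero, TensorAlgebra.tprod_zero, Words.letter_one]; rfl
  | 1 =>
    rw [X.E_one_right, TensorAlgebra.tprod_succ, TensorAlgebra.tprod_zero, Words.letter_cons,
      _root_.map_one, one_smul]
  | k + 2 =>
    rw [X.E_right _ (by omega), TensorAlgebra.tprod_succ, TensorAlgebra.tprod_succ,
      Words.letter_cons, algebraMapInv_cons, zero_smul]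
    rfl

/-- The unit conditions on the operations: `E(s; [1|t])` vanishes unless `s` and `t` are empty. -/
theorem evalOps_unit (X : HirschAlgebra R A) (s t : TensorAlgebra R A) :
    Words.evalOps X.E s (TensorAlgebra.ι R X.one * t) =
      (TensorAlgebra.algebraMapInv s * TensorAlgebra.algebraMapInv t) • X.one := by
  induction s using word_induction X.isInternal.submodule_iSup_eq_top with
  | smul r s hs =>
    rw [map_smul, map_smul, LinearMap.smul_apply, hs, smul_smul, smul_eq_mul, _root_.mul_assoc]
  | add s t hs ht => rw [map_add, map_add, LinearMap.add_apply, hs, ht, add_mul, add_smul]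
  | word n s hs =>
  induction t using word_induction X.isInternal.submodule_iSup_eq_top with
  | smul r t ht =>
    rw [mul_smul_comm, map_smul, map_smul, ht, smul_smul, smul_eq_mul, mul_left_comm]
  | add s t hs ht => rw [mul_add, map_add, map_add, hs, ht, mul_add, add_smul]
  | word m t ht =>
  obtain ⟨k, -, a, -, -, rfl⟩ := hs.exists_tprod
  obtain ⟨l, -, b, -, -, rfl⟩ := ht.exists_tprod
  match k with
  | 0 => rw [TensorAlgebra.tprod_zero, evalOps_one_left, Words.letter_cons, _root_.map_one, one_mul]
  | k + 1 =>
    have h : TensorAlgebra.ι R X.one * TensorAlgebra.tprod R A l b =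
        TensorAlgebra.tprod R A (l + 1) (Fin.cons X.one b) := by
      rw [TensorAlgebra.tprod_succ]; simp
    rw [h, Words.evalOps_tprod, X.E_unit _ _ _ _ (by omega) (by omega) (.inr ⟨0, by simp⟩),
      TensorAlgebra.tprod_succ, algebraMapInv_cons, zero_mul, zero_smul]

end HirschWords

/-! ### Signs and degrees in the bar construction -/

noncomputable section BarSigns

variable {R : Type u} [CommRing R] {A : Type v} [AddCommGroup A] [Module R A]

namespace DGAlgebra

/-- The grading of the letters of the bar construction, before desuspension. -/
def letterGr (X : DGAlgebra R A) (i : ℤ) : Submodule R X.pos := (X.gr i).comap X.pos.subtype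

theorem iSup_letterGr (X : DGAlgebra R A) : ⨆ i, X.letterGr i = ⊤ := by
  refine eq_top_iff.mpr fun a _ => ?_
  induction a using X.pos_induction with
  | mem i a hi ha => exact Submodule.mem_iSup_of_mem (p := X.letterGr) i ha
  | add a b ha hb => exact add_mem (ha trivial) (hb trivial)

theorem parity_of_isWord (X : DGAlgebra R A) {n : ℤ} {t : X.Bar} (ht : IsWord X.letterGr n t) :
    Words.parity (X.posProj ∘ₗ X.odd ∘ₗ X.pos.subtype) (X.posProj ∘ₗ X.even ∘ₗ X.pos.subtype) t =
      if Even n then (t, 0) else (0, t) := by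
  induction ht with
  | one => simp [Words.parity, Words.foldCons_one]
  | @cons i n m a t ha ht hm ih =>
    rw [Words.parity] at ih ⊢
    rw [Words.foldCons_cons, ih]
    have ha' : (a : A) ∈ X.gr i := ha
    subst hm
    simp only [LinearMap.zero_apply, zero_add, LinearMap.mk₂_apply, LinearMap.comp_apply,
      Submodule.subtype_apply, X.odd_of_mem ha', X.even_of_mem ha', Int.even_add, Int.even_sub]
    by_cases hi : Even i <;> by_cases hn : Even n <;> simp [hi, hn, X.posProj_coe]

theorem barEven_of_isWord (X : DGAlgebra R A) {n : ℤ} {t : X.Bar} (ht : IsWord X.letterGr n t) :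
    X.barEven t = if Even n then t else 0 := by
  rw [barEven, LinearMap.comp_apply, X.parity_of_isWord ht]; split_ifs <;> rfl

theorem barOdd_of_isWord (X : DGAlgebra R A) {n : ℤ} {t : X.Bar} (ht : IsWord X.letterGr n t) :
    X.barOdd t = if Even n then 0 else t := by
  rw [barOdd, LinearMap.comp_apply, X.parity_of_isWord ht]; split_ifs <;> rfl

theorem barEven_of_mem (X : DGAlgebra R A) {n : ℤ} {t : X.Bar} (ht : t ∈ wordGr X.letterGr n) :
    X.barEven t = if Even n then t else 0 := by
  induction ht using Submodule.span_induction with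
  | mem t ht => exact X.barEven_of_isWord ht
  | zero => simp
  | add s t _ _ hs ht => rw [map_add, hs, ht]; split_ifs <;> simp
  | smul r t _ ht => rw [map_smul, ht]; split_ifs <;> simp

theorem barOdd_of_mem (X : DGAlgebra R A) {n : ℤ} {t : X.Bar} (ht : t ∈ wordGr X.letterGr n) :
    X.barOdd t = if Even n then 0 else t := by
  induction ht using Submodule.span_induction with
  | mem t ht => exact X.barOdd_of_isWord ht
  | zero => simp
  | add s t _ _ hs ht => rw [map_add, hs, ht]; split_ifs <;> simp
  | smul r t _ ht => rw [map_smul, ht]; split_ifs <;> simp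

theorem barSgn_of_mem (X : DGAlgebra R A) {n : ℤ} {t : X.Bar} (ht : t ∈ wordGr X.letterGr n) :
    X.barSgn t = koszulSign R n • t := by
  rw [barSgn, LinearMap.sub_apply, X.barEven_of_mem ht, X.barOdd_of_mem ht, koszulSign_eq_ite]
  split_ifs <;> simp

theorem letterSgn_of_mem (X : DGAlgebra R A) {i : ℤ} {a : X.pos} (ha : (a : A) ∈ X.gr i) :
    X.letterSgn a = koszulSign R (i + 1) • a := by
  rw [letterSgn, LinearMap.neg_apply, LinearMap.comp_apply, LinearMap.comp_apply,
    Submodule.subtype_apply, X.sgn_of_mem ha, map_smul, X.posProj_coe, koszulSign_succ, neg_smul]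

theorem barOps_tmul (X : HirschAlgebra R A) (s t : X.Bar) :
    X.barOps X.E (s ⊗ₜ t) =
      Words.evalOps X.E (Words.map X.pos.subtype s) (Words.map X.pos.subtype t) := rfl

theorem barOps_mem (X : HirschAlgebra R A) {n m : ℤ} {s t : X.Bar}
    (hs : s ∈ wordGr X.letterGr n) (ht : t ∈ wordGr X.letterGr m) :
    X.barOps X.E (s ⊗ₜ t) ∈ X.gr (n + m + 1) :=
  evalOps_mem X (map_mem_wordGr (fun _ _ h => h) hs) (map_mem_wordGr (fun _ _ h => h) ht)

/-- The grading of `BA ⊗ BA`. -/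
abbrev barBarGr (X : DGAlgebra R A) : ℤ → Submodule R (X.Bar ⊗[R] X.Bar) :=
  gradedTensor (wordGr X.letterGr) (wordGr X.letterGr)

theorem barBarComul_mem (X : DGAlgebra R A) {n : ℤ} {z : X.Bar ⊗[R] X.Bar}
    (hz : z ∈ X.barBarGr n) : X.barBarComul z ∈ gradedTensor X.barBarGr X.barBarGr n := by
  refine gradedTensor_induction ?_ ?_ hz
  swap
  · intro a b ha hb
    rw [map_add]; exact add_mem ha hb
  intro p q s t hs ht hpq
  rw [barBarComul, LinearMap.comp_apply, TensorProduct.map_tmul]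
  refine gradedTensor_induction ?_ ?_ (deconcat_mem hs)
  swap
  · intro a b ha hb
    rw [TensorProduct.add_tmul, map_add]; exact add_mem ha hb
  intro p₁ p₂ s₁ s₂ hs₁ hs₂ hp
  refine gradedTensor_induction ?_ ?_ (deconcat_mem ht)
  swap
  · intro a b ha hb
    rw [TensorProduct.tmul_add, map_add]; exact add_mem ha hb
  intro q₁ q₂ t₁ t₂ ht₁ ht₂ hq
  rw [koszulSwap_tmul _ _ _ p₂ _ _ _ _ (X.barEven_of_mem hs₂) (X.barOdd_of_mem hs₂),
    signPow_apply _ p₂ (X.barSgn_of_mem ht₁), TensorProduct.tmul_smul, ← TensorProduct.smul_tmul']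
  exact Submodule.smul_mem _ _ (tmul_mem_gradedTensor (tmul_mem_gradedTensor hs₁ ht₁ rfl)
    (tmul_mem_gradedTensor hs₂ ht₂ rfl) (by omega))

theorem _root_.algebraMapInv_eq_zero_of_mem_wordGr {W : Type*} [AddCommGroup W] [Module R W]
    {g : ℤ → Submodule R W} {n : ℤ} (hn : n ≠ 0) {t : TensorAlgebra R W} (ht : t ∈ wordGr g n) :
    TensorAlgebra.algebraMapInv t = 0 := by
  induction ht using Submodule.span_induction with
  | mem t ht => exact ht.algebraMapInv_eq_zero hn
  | zero => simp
  | add s t _ _ hs ht => rw [map_add, hs, ht, add_zero]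
  | smul r t _ ht => rw [map_smul, ht, smul_zero]

theorem barBarCounit_of_mem (X : DGAlgebra R A) {n : ℤ} (hn : n ≠ 0) {z : X.Bar ⊗[R] X.Bar}
    (hz : z ∈ X.barBarGr n) : X.barBarCounit z = 0 := by
  refine gradedTensor_induction ?_ ?_ hz
  · intro p q s t hs ht hpq
    simp only [barBarCounit, LinearMap.comp_apply, TensorProduct.map_tmul,
      AlgHom.toLinearMap_apply, LinearMap.mul'_apply]
    by_cases hp : p = 0
    · rw [algebraMapInv_eq_zero_of_mem_wordGr (n := q) (by omega) ht, mul_zero]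
    · rw [algebraMapInv_eq_zero_of_mem_wordGr hp hs, zero_mul]
  · intro a b ha hb
    rw [map_add, ha, hb, add_zero]

/-- The right counit law of deconcatenation. -/
theorem _root_.Words.deconcat_counit {W : Type*} [AddCommGroup W] [Module R W]
    (t : TensorAlgebra R W) :
    TensorProduct.rid R _ (TensorProduct.map LinearMap.id
      TensorAlgebra.algebraMapInv.toLinearMap (Words.deconcat t)) = t := by
  induction t using word_induction (g := fun _ => ⊤) (by simp) with
  | smul r t ht => simp only [map_smul, ht]
  | add s t hs ht => simp only [map_add, hs, ht]
  | word n t ht =>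
  induction ht with
  | one => simp [Words.deconcat_one]
  | @cons i n m a t ha _ hm ih =>
    rw [Words.deconcat_cons, map_add, map_add, TensorProduct.map_tmul, AlgHom.toLinearMap_apply,
      algebraMapInv_cons, TensorProduct.tmul_zero, map_zero, zero_add]
    conv_rhs => rw [← ih]
    generalize Words.deconcat t = z
    induction z with
    | zero => simp
    | add x y hx hy => simp only [map_add, mul_add, hx, hy]
    | tmul x y => simp

/-- The right counit law of the coalgebra `BA ⊗ BA`. -/
theorem barBarComul_counit (X : DGAlgebra R A) (z : X.Bar ⊗[R] X.Bar) :
    TensorProduct.rid R _ (TensorProduct.map LinearMap.id X.barBarCounit (X.barBarComul z)) =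
      z := by
  have h : ∀ x y : X.Bar ⊗[R] X.Bar,
      TensorProduct.rid R _ (TensorProduct.map LinearMap.id X.barBarCounit
        (koszulSwap X.barEven X.barOdd X.barSgn (x ⊗ₜ y))) =
      TensorProduct.rid R _ (TensorProduct.map LinearMap.id
        TensorAlgebra.algebraMapInv.toLinearMap x) ⊗ₜ TensorProduct.rid R _
        (TensorProduct.map LinearMap.id TensorAlgebra.algebraMapInv.toLinearMap y) := by
    intro x y
    induction x with
    | zero => simp
    | add x x' hx hx' => simp only [TensorProduct.add_tmul, map_add, hx, hx']
    | tmul s₁ s₂ =>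
    induction y with
    | zero => simp
    | add x x' hx hx' => simp only [TensorProduct.tmul_add, map_add, hx, hx']
    | tmul t₁ t₂ =>
    induction s₂ using word_induction X.iSup_letterGr with
    | smul r s hs =>
      simp only [TensorProduct.tmul_smul, ← TensorProduct.smul_tmul', map_smul, hs]
    | add s s' hs hs' =>
      simp only [TensorProduct.tmul_add, TensorProduct.add_tmul, map_add, hs, hs']
    | word p s₂ hs₂ =>
    rw [koszulSwap_tmul _ _ _ p _ _ _ _ (X.barEven_of_isWord hs₂) (X.barOdd_of_isWord hs₂)]
    simp only [TensorProduct.map_tmul, LinearMap.id_apply, TensorProduct.rid_tmul, barBarCounit,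
      LinearMap.comp_apply, AlgHom.toLinearMap_apply, LinearMap.mul'_apply,
      TensorProduct.smul_tmul_smul]
    by_cases hp : p = 0
    · subst hp
      simp [signPow]
    · simp [hs₂.algebraMapInv_eq_zero hp]
  induction z with
  | zero => simp
  | add x y hx hy => simp only [map_add, hx, hy]
  | tmul s t =>
  rw [barBarComul, LinearMap.comp_apply, TensorProduct.map_tmul, h,
    Words.deconcat_counit, Words.deconcat_counit]

end DGAlgebra

end BarSigns

/-! ### Comultiplicative extensions -/

noncomputable section Coextension

variable {R : Type u} [CommRing R] {W : Type v} [AddCommGroup W] [Module R W]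
  {D : Type w} [AddCommGroup D] [Module R D] {Δ : D →ₗ[R] D ⊗[R] D} {ε : D →ₗ[R] R}
  {φ : D →ₗ[R] W} {g : ℤ → Submodule R D}

namespace Words

/-- If `φ` vanishes in degrees `≤ 0` and the counit in negative degrees, then each further tensor
factor uses up a positive degree, so the comultiplicative extension is locally finite. -/
theorem coextComponent_eq_zero (hΔ : ∀ n z, z ∈ g n → Δ z ∈ gradedTensor g g n)
    (hε : ∀ n z, n < 0 → z ∈ g n → ε z = 0) (hφ : ∀ n z, n < 1 → z ∈ g n → φ z = 0)
    (k : ℕ) {n : ℤ} {z : D} (hz : z ∈ g n) (hn : n < k) : coextComponent Δ ε φ k z = 0 := by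
  induction k generalizing n z with
  | zero =>
    have : ε z = 0 := hε n z (by simpa using hn) hz
    simp [coextComponent, this]
  | succ k ih =>
    rw [coextComponent, LinearMap.comp_apply, LinearMap.comp_apply]
    refine gradedTensor_induction ?_ ?_ (hΔ n z hz)
    · intro i j x y hx hy hij
      rw [TensorProduct.map_tmul, LinearMap.comp_apply]
      by_cases hi : i < 1
      · rw [hφ i x hi hx]; simp
      · rw [ih hy (by push_cast at hn; omega)]; simp
    · intro a b ha hb
      rw [map_add, map_add, ha, hb, add_zero]

theorem coextComponent_one (hcounit : ∀ z, TensorProduct.rid R D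
      (TensorProduct.map LinearMap.id ε (Δ z)) = z) (z : D) :
    coextComponent Δ ε φ 1 z = TensorAlgebra.ι R (φ z) := by
  conv_rhs => rw [← hcounit z]
  rw [coextComponent, LinearMap.comp_apply, LinearMap.comp_apply]
  generalize Δ z = y
  induction y with
  | zero => simp
  | add x y hx hy => simp only [map_add, hx, hy]
  | tmul x y =>
    simp [coextComponent, Algebra.algebraMap_eq_smul_one]

theorem letter_coextComponent (hcounit : ∀ z, TensorProduct.rid R D
      (TensorProduct.map LinearMap.id ε (Δ z)) = z) (k : ℕ) (z : D) :
    letter (coextComponent Δ ε φ k z) = if k = 1 then φ z else 0 := by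
  match k with
  | 0 =>
    simp [coextComponent, Algebra.algebraMap_eq_smul_one, letter_one]
  | 1 =>
    rw [coextComponent_one hcounit, ← mul_one (TensorAlgebra.ι R (φ z)), letter_cons]; simp
  | k + 2 =>
    rw [if_neg (by omega), coextComponent, LinearMap.comp_apply, LinearMap.comp_apply]
    generalize Δ z = y
    induction y with
    | zero => simp
    | add x y hx hy => simp only [map_add, hx, hy, add_zero]
    | tmul x y =>
      rw [TensorProduct.map_tmul, LinearMap.mul'_apply, LinearMap.comp_apply, letter_cons]
      have : TensorAlgebra.algebraMapInv (coextComponent Δ ε φ (k + 1) y) = 0 := by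
        rw [coextComponent, LinearMap.comp_apply, LinearMap.comp_apply]
        generalize Δ y = w
        induction w with
        | zero => simp
        | add x y hx hy => simp only [map_add, hx, hy, add_zero]
        | tmul x y =>
          rw [TensorProduct.map_tmul, LinearMap.mul'_apply, LinearMap.comp_apply,
            algebraMapInv_cons]
      rw [this, zero_smul]

theorem letter_coextension (hcounit : ∀ z, TensorProduct.rid R D
      (TensorProduct.map LinearMap.id ε (Δ z)) = z) {z : D} {N : ℕ}
    (hN : ∀ k, N ≤ k → coextComponent Δ ε φ k z = 0) :
    letter (coextension Δ ε φ z) = φ z := by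
  have hs : (Function.support fun k => coextComponent Δ ε φ k z) ⊆ Finset.range (N + 2) := by
    intro k hk
    by_contra h
    exact hk (hN k (by simp at h; omega))
  rw [coextension, finsum_eq_sum_of_support_subset _ hs, map_sum]
  simp only [letter_coextComponent hcounit]
  simp

end Words

end Coextension

/-! ### The comultiplicative extension of a twisting cochain -/

noncomputable section BarExtension

variable {R : Type u} [CommRing R] {A : Type v} [AddCommGroup A] [Module R A]
  {C : Type w} [AddCommGroup C] [Module R C]

theorem tensorMap_sub_right {V V' W W' : Type*} [AddCommGroup V] [Module R V] [AddCommGroup V']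
    [Module R V'] [AddCommGroup W] [Module R W] [AddCommGroup W'] [Module R W']
    (f : V →ₗ[R] V') (g g' : W →ₗ[R] W') :
    TensorProduct.map f (g - g') = TensorProduct.map f g - TensorProduct.map f g' := by
  ext x y
  simp [TensorProduct.tmul_sub]

namespace DGCoalgebra

theorem comul_assoc (H : DGCoalgebra R C) (c : C) :
    TensorProduct.assoc R C C C (TensorProduct.map H.comul LinearMap.id (H.comul c)) =
      TensorProduct.map LinearMap.id H.comul (H.comul c) :=
  LinearMap.congr_fun H.coassoc c

theorem counit_left (H : DGCoalgebra R C) (c : C) :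
    TensorProduct.lid R C (TensorProduct.map H.counit LinearMap.id (H.comul c)) = c := by
  have := LinearMap.congr_fun H.rTensor_counit_comp_comul c
  change TensorProduct.map H.counit LinearMap.id (H.comul c) = 1 ⊗ₜ c at this
  rw [this, TensorProduct.lid_tmul, one_smul]

theorem counit_right (H : DGCoalgebra R C) (c : C) :
    TensorProduct.rid R C (TensorProduct.map LinearMap.id H.counit (H.comul c)) = c := by
  have := LinearMap.congr_fun H.lTensor_counit_comp_comul c
  change TensorProduct.map LinearMap.id H.counit (H.comul c) = c ⊗ₜ 1 at this
  rw [this, TensorProduct.rid_tmul, one_smul]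

end DGCoalgebra

namespace IsTwistingCochain

variable {H : DGHopfAlgebra R C} {X : HirschAlgebra R A} {ϑ : C →ₗ[R] A}

theorem eq_zero (hϑ : IsTwistingCochain H X ϑ) {i : ℤ} (hi : i < 1) {c : C} (hc : c ∈ H.gr i) :
    ϑ c = 0 := by
  have h := hϑ.map_mem i c hc
  obtain rfl | rfl | hi : i = 0 ∨ i = -1 ∨ i + 1 < 0 := by omega
  · simpa [X.gr_one] using h
  · exact hϑ.map_neg_one c hc
  · simpa [X.gr_neg _ hi] using h

theorem mem_pos (hϑ : IsTwistingCochain H X ϑ) (c : C) : ϑ c ∈ X.pos := by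
  induction c using H.homogeneous_induction with
  | mem i c hc =>
    by_cases hi : i < 1
    · rw [hϑ.eq_zero hi hc]; exact zero_mem _
    · exact X.pos_of_mem (by omega) (hϑ.map_mem i c hc)
  | zero => simp
  | add a b ha hb => rw [map_add]; exact add_mem ha hb

theorem coe_posProj (hϑ : IsTwistingCochain H X ϑ) (c : C) : (X.posProj (ϑ c) : A) = ϑ c :=
  X.toDGModule.coe_posProj (hϑ.mem_pos c)

theorem coextComponent_eq_zero {W : Type*} [AddCommGroup W] [Module R W] {φ : C →ₗ[R] W}
    (hφ : ∀ n z, n < 1 → z ∈ H.gr n → φ z = 0) (k : ℕ) {i : ℤ} {c : C} (hc : c ∈ H.gr i)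
    (hi : i < k) : Words.coextComponent H.comul H.counit φ k c = 0 :=
  Words.coextComponent_eq_zero (fun n z hz => H.comul_mem n z hz)
    (fun n z hn hz => H.counit_eq_zero n z hn.ne hz) hφ k hc hi

theorem exists_coextComponent_eq_zero {W : Type*} [AddCommGroup W] [Module R W] {φ : C →ₗ[R] W}
    (hφ : ∀ n z, n < 1 → z ∈ H.gr n → φ z = 0) (c : C) :
    ∃ N : ℕ, ∀ k, N ≤ k → Words.coextComponent H.comul H.counit φ k c = 0 := by
  induction c using H.homogeneous_induction with
  | mem i c hc =>
    exact ⟨(i + 1).toNat, fun k hk => coextComponent_eq_zero hφ k hc (by omega)⟩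
  | zero => exact ⟨0, fun k _ => map_zero _⟩
  | add a b ha hb =>
    obtain ⟨N, hN⟩ := ha
    obtain ⟨N', hN'⟩ := hb
    exact ⟨max N N', fun k hk => by rw [map_add, hN k (by omega), hN' k (by omega), add_zero]⟩

theorem posProj_comp_eq_zero (hϑ : IsTwistingCochain H X ϑ) (n : ℤ) (z : C) (hn : n < 1)
    (hz : z ∈ H.gr n) : (X.posProj ∘ₗ ϑ) z = 0 := by
  rw [LinearMap.comp_apply, hϑ.eq_zero hn hz, map_zero]

theorem finite_support (hϑ : IsTwistingCochain H X ϑ) (c : C) :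
    (Function.support fun k =>
      Words.coextComponent H.comul H.counit (X.posProj ∘ₗ ϑ) k c).Finite := by
  obtain ⟨N, hN⟩ := exists_coextComponent_eq_zero hϑ.posProj_comp_eq_zero c
  refine (Finset.range N).finite_toSet.subset fun k hk => ?_
  by_contra h
  exact hk (hN k (by simpa using h))

/-- The comultiplicative extension `C → BA` of a twisting cochain as a linear map. -/
def barExt (hϑ : IsTwistingCochain H X ϑ) : C →ₗ[R] X.Bar where
  toFun := barExtension H X ϑ
  map_add' a b := by
    simp only [barExtension, Words.coextension, map_add]
    exact finsum_add_distrib (hϑ.finite_support a) (hϑ.finite_support b)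
  map_smul' r a := by
    simp only [barExtension, Words.coextension, map_smul, RingHom.id_apply]
    exact (smul_finsum' r (hϑ.finite_support a)).symm

theorem barExt_eq_sum (hϑ : IsTwistingCochain H X ϑ) {c : C} {N : ℕ}
    (hN : ∀ k, N ≤ k → Words.coextComponent H.comul H.counit (X.posProj ∘ₗ ϑ) k c = 0) :
    hϑ.barExt c =
      ∑ k ∈ Finset.range N, Words.coextComponent H.comul H.counit (X.posProj ∘ₗ ϑ) k c := by
  refine finsum_eq_sum_of_support_subset _ fun k hk => ?_
  by_contra h
  exact hk (hN k (by simpa using h))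

theorem barExt_eq_zero (hϑ : IsTwistingCochain H X ϑ) {i : ℤ} (hi : i < 0) {c : C}
    (hc : c ∈ H.gr i) : hϑ.barExt c = 0 := by
  rw [hϑ.barExt_eq_sum (N := 0)
    (fun k _ => coextComponent_eq_zero hϑ.posProj_comp_eq_zero k hc (by omega))]
  simp

/-- The comultiplicative extension satisfies `F c = ε(c) [] + ∑ [ϑ c'|F c'']`. -/
theorem barExt_rec (hϑ : IsTwistingCochain H X ϑ) (c : C) :
    hϑ.barExt c = H.counit c • 1 + LinearMap.mul' R X.Bar
      (TensorProduct.map (TensorAlgebra.ι R ∘ₗ X.posProj ∘ₗ ϑ) hϑ.barExt (H.comul c)) := by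
  have h : ∀ z : C ⊗[R] C, ∃ N : ℕ, ∀ n, N ≤ n →
      TensorProduct.map (TensorAlgebra.ι R ∘ₗ X.posProj ∘ₗ ϑ) hϑ.barExt z =
      ∑ k ∈ Finset.range n, TensorProduct.map (TensorAlgebra.ι R ∘ₗ X.posProj ∘ₗ ϑ)
        (Words.coextComponent H.comul H.counit (X.posProj ∘ₗ ϑ) k) z := by
    intro z
    induction z with
    | zero => exact ⟨0, by simp⟩
    | add x y hx hy =>
      obtain ⟨N, hN⟩ := hx
      obtain ⟨N', hN'⟩ := hy
      refine ⟨max N N', fun n hn => ?_⟩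
      simp only [map_add, Finset.sum_add_distrib]
      rw [hN n (by omega), hN' n (by omega)]
    | tmul x y =>
      obtain ⟨N, hN⟩ := exists_coextComponent_eq_zero hϑ.posProj_comp_eq_zero y
      refine ⟨N, fun n hn => ?_⟩
      simp only [TensorProduct.map_tmul]
      rw [← TensorProduct.tmul_sum, hϑ.barExt_eq_sum (fun k hk => hN k (hn.trans hk))]
  obtain ⟨N, hN⟩ := h (H.comul c)
  obtain ⟨N', hN'⟩ := exists_coextComponent_eq_zero hϑ.posProj_comp_eq_zero c
  rw [hN (max N N') (by omega), hϑ.barExt_eq_sum (N := max N N' + 1)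
    (fun k hk => hN' k (by omega)), Finset.sum_range_succ', map_sum, add_comm]
  congr 1
  simp [Words.coextComponent, Algebra.algebraMap_eq_smul_one]

theorem algebraMapInv_barExt (hϑ : IsTwistingCochain H X ϑ) (c : C) :
    TensorAlgebra.algebraMapInv (hϑ.barExt c) = H.counit c := by
  rw [hϑ.barExt_rec, map_add, map_smul, map_one, smul_eq_mul, mul_one, add_eq_left]
  generalize H.comul c = z
  induction z with
  | zero => simp
  | add x y hx hy => rw [map_add, map_add, map_add, hx, hy, add_zero]
  | tmul x y =>
    rw [TensorProduct.map_tmul, LinearMap.mul'_apply, LinearMap.comp_apply, algebraMapInv_cons]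

theorem peel_barExt (hϑ : IsTwistingCochain H X ϑ) (c : C) :
    Words.peel (hϑ.barExt c) =
      TensorProduct.map (X.posProj ∘ₗ ϑ) hϑ.barExt (H.comul c) := by
  rw [hϑ.barExt_rec, map_add, map_smul, Words.peel_one, smul_zero, zero_add]
  generalize H.comul c = z
  induction z with
  | zero => simp
  | add x y hx hy => simp only [map_add, hx, hy]
  | tmul x y =>
    rw [TensorProduct.map_tmul, LinearMap.mul'_apply, LinearMap.comp_apply, Words.peel_cons]
    rfl

theorem barExt_mem (hϑ : IsTwistingCochain H X ϑ) {i : ℤ} {c : C} (hc : c ∈ H.gr i) :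
    hϑ.barExt c ∈ wordGr X.letterGr i := by
  have h : ∀ (k : ℕ) (i : ℤ) (c : C), c ∈ H.gr i →
      Words.coextComponent H.comul H.counit (X.posProj ∘ₗ ϑ) k c ∈ wordGr X.letterGr i := by
    intro k
    induction k with
    | zero =>
      intro i c hc
      rw [Words.coextComponent, LinearMap.comp_apply, Algebra.linearMap_apply,
        Algebra.algebraMap_eq_smul_one]
      by_cases hi : i = 0
      · subst hi
        exact Submodule.smul_mem _ _ IsWord.one.mem_wordGr
      · rw [H.counit_eq_zero i c hi hc, zero_smul]; exact zero_mem _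
    | succ k ih =>
      intro i c hc
      rw [Words.coextComponent, LinearMap.comp_apply, LinearMap.comp_apply]
      refine H.tensorGr_induction H.toDGModule ?_ ?_ (H.comul_mem i c hc)
      · intro p q x y hx hy hpq
        rw [TensorProduct.map_tmul, LinearMap.mul'_apply]
        refine cons_mem_wordGr (g := X.letterGr) (i := p + 1) ?_ (ih q y hy) (by omega)
        change (X.posProj (ϑ x) : A) ∈ X.gr (p + 1)
        rw [hϑ.coe_posProj]
        exact hϑ.map_mem p x hx
      · intro a b ha hb
        rw [map_add, map_add]; exact add_mem ha hb
  rw [hϑ.barExt_eq_sum (N := (i + 1).toNat)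
    (fun k hk => coextComponent_eq_zero hϑ.posProj_comp_eq_zero k hc (by omega))]
  exact sum_mem fun k _ => h k i c hc

/-- A map out of `C` that vanishes in negative degrees is determined by a recursion of the form
`G c = ∑ S(ϑ c', G c'')`: as `ϑ c'` vanishes unless `c'` has positive degree, the degree of `c''` is
smaller than that of `c`. -/
theorem eq_zero_of_rec (hϑ : IsTwistingCochain H X ϑ) {P : Type*} [AddCommGroup P] [Module R P]
    {G : C →ₗ[R] P} (S : X.pos ⊗[R] P →ₗ[R] P) (hneg : ∀ i c, i < 0 → c ∈ H.gr i → G c = 0)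
    (hrec : ∀ c, G c = S (TensorProduct.map (X.posProj ∘ₗ ϑ) G (H.comul c))) : G = 0 := by
  have h : ∀ (n : ℕ) (i : ℤ) (c : C), i < n → c ∈ H.gr i → G c = 0 := by
    intro n
    induction n with
    | zero => intro i c hi hc; exact hneg i c (by simpa using hi) hc
    | succ n ih =>
      intro i c hi hc
      rw [hrec]
      refine H.tensorGr_induction H.toDGModule ?_ ?_ (H.comul_mem i c hc)
      · intro p q x y hx hy hpq
        rw [TensorProduct.map_tmul]
        by_cases hp : p < 1
        · rw [hϑ.posProj_comp_eq_zero p x hp hx]; simp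
        · rw [ih q y (by push_cast at hi; omega) hy]; simp
      · intro a b ha hb
        rw [map_add, map_add, ha, hb, add_zero]
  exact H.hom_ext_homogeneous fun i c hc => h (i + 1).toNat i c (by omega) hc

/-- The comultiplicative extension is a map of coalgebras. -/
theorem deconcat_barExt (hϑ : IsTwistingCochain H X ϑ) (c : C) :
    Words.deconcat (hϑ.barExt c) = TensorProduct.map hϑ.barExt hϑ.barExt (H.comul c) := by
  let S : X.pos ⊗[R] (X.Bar ⊗[R] X.Bar) →ₗ[R] X.Bar ⊗[R] X.Bar :=
    TensorProduct.lift (LinearMap.rTensorHom X.Bar ∘ₗ LinearMap.mul R X.Bar ∘ₗ TensorAlgebra.ι R)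
  have hS : ∀ a s t, S (a ⊗ₜ (s ⊗ₜ t)) = (TensorAlgebra.ι R a * s) ⊗ₜ t := fun _ _ _ => rfl
  -- the recursion for the left-hand side
  have h1 : ∀ c, Words.deconcat (hϑ.barExt c) = 1 ⊗ₜ hϑ.barExt c +
      S (TensorProduct.map (X.posProj ∘ₗ ϑ) (Words.deconcat ∘ₗ hϑ.barExt) (H.comul c)) := by
    intro c
    rw [hϑ.barExt_rec c, map_add, map_smul, Words.deconcat_one, TensorProduct.tmul_add,
      TensorProduct.tmul_smul, add_assoc]
    congr 1
    generalize H.comul c = z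
    induction z with
    | zero => simp
    | add x y hx hy => simp only [map_add, hx, hy, TensorProduct.tmul_add]; abel
    | tmul x y =>
      rw [TensorProduct.map_tmul, LinearMap.mul'_apply, LinearMap.comp_apply,
        Words.deconcat_cons]
      rfl
  -- the recursion for the right-hand side, by coassociativity
  have h2 : ∀ c, TensorProduct.map hϑ.barExt hϑ.barExt (H.comul c) = 1 ⊗ₜ hϑ.barExt c +
      S (TensorProduct.map (X.posProj ∘ₗ ϑ) (TensorProduct.map hϑ.barExt hϑ.barExt ∘ₗ H.comul)
        (H.comul c)) := by
    intro c
    have e1 : ∀ z : C ⊗[R] C, TensorProduct.map hϑ.barExt hϑ.barExt z =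
        1 ⊗ₜ hϑ.barExt (TensorProduct.lid R C (TensorProduct.map H.counit LinearMap.id z)) +
        S (TensorProduct.map (X.posProj ∘ₗ ϑ) (TensorProduct.map hϑ.barExt hϑ.barExt)
          (TensorProduct.assoc R C C C (TensorProduct.map H.comul LinearMap.id z))) := by
      intro z
      induction z with
      | zero => simp
      | add x y hx hy => simp only [map_add, hx, hy, TensorProduct.tmul_add]; abel
      | tmul x y =>
        rw [TensorProduct.map_tmul, hϑ.barExt_rec x, TensorProduct.add_tmul]
        congr 1
        · simp [TensorProduct.smul_tmul]
        · rw [TensorProduct.map_tmul, LinearMap.id_apply]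
          generalize H.comul x = z
          induction z with
          | zero => simp
          | add x y hx hy => simp only [map_add, TensorProduct.add_tmul, hx, hy]
          | tmul x y => rfl
    rw [e1, H.counit_left, H.comul_assoc, TensorProduct.map_map, LinearMap.comp_id]
  have key : Words.deconcat ∘ₗ hϑ.barExt - TensorProduct.map hϑ.barExt hϑ.barExt ∘ₗ H.comul =
      0 := by
    refine hϑ.eq_zero_of_rec S ?_ ?_
    · intro i c hi hc
      rw [LinearMap.sub_apply, LinearMap.comp_apply, LinearMap.comp_apply,
        hϑ.barExt_eq_zero hi hc, map_zero, zero_sub, neg_eq_zero]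
      refine H.tensorGr_induction H.toDGModule ?_ ?_ (H.comul_mem i c hc)
      · intro p q x y hx hy hpq
        rw [TensorProduct.map_tmul]
        by_cases hp : p < 0
        · rw [hϑ.barExt_eq_zero hp hx, TensorProduct.zero_tmul]
        · rw [hϑ.barExt_eq_zero (i := q) (by omega) hy, TensorProduct.tmul_zero]
      · intro a b ha hb
        rw [map_add, ha, hb, add_zero]
    · intro c
      rw [LinearMap.sub_apply, LinearMap.comp_apply, LinearMap.comp_apply, h1, h2,
        tensorMap_sub_right, LinearMap.sub_apply, map_sub]
      abel
  exact sub_eq_zero.mp (LinearMap.congr_fun key c)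

theorem letterSgn_posProj (hϑ : IsTwistingCochain H X ϑ) (c : C) :
    X.letterSgn (X.posProj (ϑ c)) = X.posProj (ϑ (H.sgn c)) := by
  induction c using H.homogeneous_induction with
  | zero => simp
  | add a b ha hb => simp only [map_add, ha, hb]
  | mem i c hc =>
    have h : (X.posProj (ϑ c) : A) ∈ X.gr (i + 1) := by
      rw [hϑ.coe_posProj]; exact hϑ.map_mem i c hc
    rw [X.letterSgn_of_mem h, H.sgn_of_mem hc, map_smul, map_smul, koszulSign_succ,
      koszulSign_succ, neg_neg]

theorem mulHead_barExt (hϑ : IsTwistingCochain H X ϑ) (a : X.pos) (c : C) :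
    X.mulHead a (hϑ.barExt c) = LinearMap.mul' R X.Bar
      (TensorProduct.map (TensorAlgebra.ι R ∘ₗ X.posProj ∘ₗ X.mul a ∘ₗ ϑ) hϑ.barExt
        (H.comul c)) := by
  have h : ∀ t : X.Bar, X.mulHead a t = LinearMap.mul' R X.Bar (TensorProduct.map
      (TensorAlgebra.ι R ∘ₗ X.posProj ∘ₗ X.mul a ∘ₗ X.pos.subtype) LinearMap.id
        (Words.peel t)) := by
    intro t
    simp only [DGAlgebra.mulHead, LinearMap.compl₂_apply]
    generalize Words.peel t = z
    induction z with
    | zero => simp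
    | add x y hx hy => simp only [map_add, hx, hy]
    | tmul x y => simp
  have h' : (TensorAlgebra.ι R ∘ₗ X.posProj ∘ₗ X.mul a ∘ₗ X.pos.subtype) ∘ₗ X.posProj ∘ₗ ϑ =
      TensorAlgebra.ι R ∘ₗ X.posProj ∘ₗ X.mul a ∘ₗ ϑ :=
    LinearMap.ext fun c => by simp [hϑ.coe_posProj]
  rw [h, hϑ.peel_barExt, TensorProduct.map_map, LinearMap.id_comp, h']

/-- The comultiplicative extension is a chain map. -/
theorem barD_barExt (hϑ : IsTwistingCochain H X ϑ) (c : C) :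
    X.barD (hϑ.barExt c) = hϑ.barExt (H.d c) := by
  let S : X.pos ⊗[R] X.Bar →ₗ[R] X.Bar :=
    LinearMap.mul' R X.Bar ∘ₗ TensorProduct.map (TensorAlgebra.ι R ∘ₗ X.letterSgn) LinearMap.id
  -- `K f (c ⊗ c') = [f c|F c']`
  let K (f : C →ₗ[R] A) : C ⊗[R] C →ₗ[R] X.Bar := LinearMap.mul' R X.Bar ∘ₗ
    TensorProduct.map (TensorAlgebra.ι R ∘ₗ X.posProj ∘ₗ f) hϑ.barExt
  -- the recursion for the left-hand side; the second term comes from multiplying adjacent letters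
  have h1 : ∀ c, X.barD (hϑ.barExt c) =
      - K (X.d ∘ₗ ϑ) (H.comul c)
      - K (TensorProduct.lift X.mul ∘ₗ TensorProduct.map (ϑ ∘ₗ H.sgn) ϑ ∘ₗ H.comul) (H.comul c)
      + S (TensorProduct.map (X.posProj ∘ₗ ϑ) (X.barD ∘ₗ hϑ.barExt) (H.comul c)) := by
    intro c
    have e1 : ∀ z : C ⊗[R] C, X.barD (K ϑ z) = - K (X.d ∘ₗ ϑ) z
        - LinearMap.mul' R X.Bar (TensorProduct.map (TensorAlgebra.ι R ∘ₗ X.posProj ∘ₗ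
            TensorProduct.lift X.mul ∘ₗ TensorProduct.map (ϑ ∘ₗ H.sgn) ϑ) hϑ.barExt
          ((TensorProduct.assoc R C C C).symm (TensorProduct.map LinearMap.id H.comul z)))
        + S (TensorProduct.map (X.posProj ∘ₗ ϑ) (X.barD ∘ₗ hϑ.barExt) z) := by
      intro z
      induction z with
      | zero => simp
      | add x y hx hy => simp only [map_add, hx, hy]; abel
      | tmul x y =>
        have e2 : X.mulHead (X.letterSgn (X.posProj (ϑ x))) (hϑ.barExt y) =
            LinearMap.mul' R X.Bar (TensorProduct.map (TensorAlgebra.ι R ∘ₗ X.posProj ∘ₗ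
              TensorProduct.lift X.mul ∘ₗ TensorProduct.map (ϑ ∘ₗ H.sgn) ϑ) hϑ.barExt
              ((TensorProduct.assoc R C C C).symm
                (TensorProduct.map LinearMap.id H.comul (x ⊗ₜ y)))) := by
          rw [hϑ.letterSgn_posProj, hϑ.mulHead_barExt, hϑ.coe_posProj, TensorProduct.map_tmul]
          generalize H.comul y = z
          induction z with
          | zero => simp
          | add x y hx hy => simp only [map_add, TensorProduct.tmul_add, hx, hy]
          | tmul x y => rfl
        have e3 : K ϑ (x ⊗ₜ y) =
            TensorAlgebra.ι R (X.posProj (ϑ x)) * hϑ.barExt y := rfl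
        rw [← e2, e3, DGAlgebra.barD, Words.foldCons_cons]
        simp only [LinearMap.sub_apply, LinearMap.neg_apply, LinearMap.comp_apply,
          LinearMap.mul_apply', Submodule.subtype_apply, hϑ.coe_posProj]
        rfl
    rw [hϑ.barExt_rec, map_add, map_smul, DGAlgebra.barD, Words.foldCons_one, smul_zero,
      zero_add, ← DGAlgebra.barD]
    have e4 := e1 (H.comul c)
    rw [← H.comul_assoc, LinearEquiv.symm_apply_apply, TensorProduct.map_map] at e4
    exact e4
  have h2 : ∀ c, hϑ.barExt (H.d c) = K (ϑ ∘ₗ H.d) (H.comul c) +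
      S (TensorProduct.map (X.posProj ∘ₗ ϑ) (hϑ.barExt ∘ₗ H.d) (H.comul c)) := by
    intro c
    rw [hϑ.barExt_rec, H.counit_d, zero_smul, zero_add, H.comul_d]
    generalize H.comul c = z
    induction z with
    | zero => simp
    | add x y hx hy => simp only [map_add, hx, hy]; abel
    | tmul x y =>
      rw [DGModule.tensorD_tmul, map_add, map_add]
      congr 1
      simp only [S, TensorProduct.map_tmul, LinearMap.comp_apply, hϑ.letterSgn_posProj,
        LinearMap.id_apply]
  -- the twisting cochain equation
  have h3 : ∀ z, K (TensorProduct.lift X.mul ∘ₗ TensorProduct.map (ϑ ∘ₗ H.sgn) ϑ ∘ₗ H.comul) z =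
      - K (X.d ∘ₗ ϑ) z - K (ϑ ∘ₗ H.d) z := by
    intro z
    induction z with
    | zero => simp
    | add x y hx hy => simp only [map_add, hx, hy]; abel
    | tmul x y =>
      have := hϑ.twisting x
      rw [← neg_eq_iff_eq_neg] at this
      simp only [K, TensorProduct.map_tmul, LinearMap.comp_apply, ← this, map_neg, map_add,
        LinearMap.mul'_apply]
      noncomm_ring
  have key : X.barD ∘ₗ hϑ.barExt - hϑ.barExt ∘ₗ H.d = 0 := by
    refine hϑ.eq_zero_of_rec S ?_ ?_
    · intro i c hi hc
      rw [LinearMap.sub_apply, LinearMap.comp_apply, LinearMap.comp_apply,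
        hϑ.barExt_eq_zero hi hc, map_zero, zero_sub, neg_eq_zero]
      -- in degree `0` a boundary has no component of positive length, and counit `0`
      rw [hϑ.barExt_eq_sum (N := 1) (fun k hk => coextComponent_eq_zero
        hϑ.posProj_comp_eq_zero k (H.d_mem i c hc) (by omega))]
      simp [Words.coextComponent, H.counit_d]
    · intro c
      rw [LinearMap.sub_apply, LinearMap.comp_apply, LinearMap.comp_apply, h1, h2, h3,
        tensorMap_sub_right, LinearMap.sub_apply, map_sub]
      abel
  exact sub_eq_zero.mp (LinearMap.congr_fun key c)

end IsTwistingCochain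

namespace IsMultiplicativeTwistingCochain

variable {H : DGHopfAlgebra R C} {X : HirschAlgebra R A} {ϑ : C →ₗ[R] A}

/-- Multiplicativity of `ϑ`, read off from the words of length one:
`E(F c; F c') = ϑ(c c')`. -/
theorem barOps_barExt (hϑ : IsMultiplicativeTwistingCochain H X ϑ) (c c' : C) :
    X.barOps X.E (hϑ.barExt c ⊗ₜ hϑ.barExt c') = ϑ (H.mul c c') := by
  induction c using H.homogeneous_induction with
  | zero => simp
  | add a b ha hb => simp only [map_add, LinearMap.add_apply, TensorProduct.add_tmul, ha, hb]
  | mem i c hc =>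
  induction c' using H.homogeneous_induction with
  | zero => simp
  | add a b ha hb => simp only [map_add, TensorProduct.tmul_add, ha, hb]
  | mem j c' hc' =>
  have hm := H.mul_mem i j c c' hc hc'
  -- in total degree `< 0` both sides vanish, and otherwise the projection to `A^{>0}` is harmless
  by_cases hij : i + j + 1 ≤ 0
  · rw [hϑ.eq_zero (by omega) hm]
    by_cases hi : i < 0
    · rw [hϑ.barExt_eq_zero hi hc]; simp
    · rw [hϑ.barExt_eq_zero (i := j) (by omega) hc']; simp
  have h := congrArg Words.letter (hϑ.map_mul c c')
  obtain ⟨N, hN⟩ := IsTwistingCochain.exists_coextComponent_eq_zero hϑ.posProj_comp_eq_zero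
    (H.mul c c')
  -- `A¹ = 0`, so `E` also kills degree `0` of `BA ⊗ BA`
  have hφ : ∀ n z, n < 1 → z ∈ X.barBarGr n → (X.posProj ∘ₗ X.barOps X.E) z = 0 := by
    intro n z hn hz
    refine gradedTensor_induction ?_ ?_ hz
    · intro p q s t hs ht hpq
      have := DGAlgebra.barOps_mem X hs ht
      rw [hpq] at this
      rw [LinearMap.comp_apply]
      by_cases hn' : n = 0
      · subst hn'
        rw [zero_add, X.gr_one, Submodule.mem_bot] at this
        rw [this, map_zero]
      · exact X.posProj_of_mem_nonpos (by omega) this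
    · intro a b ha hb
      rw [map_add, ha, hb, add_zero]
  have hmem : hϑ.barExt c ⊗ₜ hϑ.barExt c' ∈ X.barBarGr (i + j) :=
    tmul_mem_gradedTensor (hϑ.barExt_mem hc) (hϑ.barExt_mem hc') rfl
  rw [barExtension, Words.letter_coextension H.counit_right hN, HirschAlgebra.barMul] at h
  erw [Words.letter_coextension X.barBarComul_counit (N := (i + j + 1).toNat)
    (fun k hk => Words.coextComponent_eq_zero (fun n z hz => X.barBarComul_mem hz)
      (fun n z hn hz => X.barBarCounit_of_mem hn.ne hz) hφ k hmem (by omega))] at h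
  have h' := congrArg Subtype.val h
  rw [LinearMap.comp_apply, hϑ.coe_posProj, LinearMap.comp_apply] at h'
  rw [h']
  exact (X.toDGModule.coe_posProj (X.pos_of_mem (by omega)
    (DGAlgebra.barOps_mem X (hϑ.barExt_mem hc) (hϑ.barExt_mem hc')))).symm

end IsMultiplicativeTwistingCochain

end BarExtension

/-! ### The pairing defined by a multiplicative twisting cochain -/

noncomputable section Pairing

variable {R : Type u} [CommRing R] {A : Type v} [AddCommGroup A] [Module R A]
  {C : Type w} [AddCommGroup C] [Module R C]

theorem algebraMapInv_map {W : Type v} {W' : Type w} [AddCommGroup W] [Module R W]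
    [AddCommGroup W'] [Module R W'] (f : W →ₗ[R] W') (t : TensorAlgebra R W) :
    TensorAlgebra.algebraMapInv (Words.map f t) = TensorAlgebra.algebraMapInv t := by
  induction t using word_induction (g := fun _ => ⊤) (by simp) with
  | smul r t ht => rw [map_smul, map_smul, map_smul, ht]
  | add s t hs ht => rw [map_add, map_add, map_add, hs, ht]
  | word n t ht =>
    cases ht with
    | one => rw [Words.map_one, map_one, map_one]
    | cons => rw [Words.map_cons, algebraMapInv_cons, algebraMapInv_cons]

theorem HirschAlgebra.mul_mem_pos (X : HirschAlgebra R A) (a b : X.pos) :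
    X.mul a b ∈ X.pos := by
  induction a using X.pos_induction with
  | add a a' ha ha' =>
    rw [Submodule.coe_add, map_add, LinearMap.add_apply]
    exact add_mem ha ha'
  | mem i a hi ha' =>
  induction b using X.pos_induction with
  | add b b' hb hb' =>
    rw [Submodule.coe_add, map_add]
    exact add_mem hb hb'
  | mem j b hj hb' => exact X.pos_of_mem (add_pos hi hj) (X.mul_mem i j a b ha' hb')

/-- The value of `E ⌣ E` on `s ⊗ t`, as a functional of the deconcatenations of the bar words `s`
and `t`. -/
abbrev HirschAlgebra.cupOps (X : HirschAlgebra R A) :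
    (X.Bar ⊗[R] X.Bar) ⊗[R] (X.Bar ⊗[R] X.Bar) →ₗ[R] A :=
  TensorProduct.lift X.mul ∘ₗ
    TensorProduct.map (X.barOps X.E ∘ₗ X.barBarSgn) (X.barOps X.E) ∘ₗ
    koszulSwap X.barEven X.barOdd X.barSgn

theorem HirschAlgebra.cupOps_tmul (X : HirschAlgebra R A) {p q r : ℤ} {s₁ s₂ t₁ : X.Bar}
    (hs₁ : s₁ ∈ wordGr X.letterGr p) (hs₂ : s₂ ∈ wordGr X.letterGr q)
    (ht₁ : t₁ ∈ wordGr X.letterGr r) (t₂ : X.Bar) :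
    X.cupOps ((s₁ ⊗ₜ s₂) ⊗ₜ (t₁ ⊗ₜ t₂)) =
      koszulSign R (q * r + p + r) •
        X.mul (X.barOps X.E (s₁ ⊗ₜ t₁)) (X.barOps X.E (s₂ ⊗ₜ t₂)) := by
  simp only [HirschAlgebra.cupOps, LinearMap.comp_apply]
  rw [koszulSwap_tmul _ _ _ q _ _ _ _ (X.barEven_of_mem hs₂) (X.barOdd_of_mem hs₂),
    signPow_apply _ q (X.barSgn_of_mem ht₁), TensorProduct.map_tmul, LinearMap.comp_apply,
    DGAlgebra.barBarSgn, TensorProduct.map_tmul, map_smul, X.barSgn_of_mem hs₁,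
    X.barSgn_of_mem ht₁]
  simp only [TensorProduct.tmul_smul, ← TensorProduct.smul_tmul', map_smul, smul_smul,
    TensorProduct.lift.tmul, koszulSign_add]
  congr 1
  ring

theorem DGCoalgebra.counit_sgn (H : DGCoalgebra R C) (c : C) : H.counit (H.sgn c) = H.counit c := by
  induction c using H.homogeneous_induction with
  | zero => simp
  | add a b ha hb => rw [map_add, map_add, map_add, ha, hb]
  | mem i c hc =>
    rw [H.sgn_of_mem hc, map_smul]
    by_cases hi : i = 0
    · rw [hi, koszulSign_zero, one_smul]
    · rw [H.counit_eq_zero i c hi hc, smul_zero]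

namespace IsTwistingCochain

variable {H : DGHopfAlgebra R C} {X : HirschAlgebra R A} {ϑ : C →ₗ[R] A}

/-- The comultiplicative extension of `ϑ`, with values in words in letters of `A`. -/
def wordExt (hϑ : IsTwistingCochain H X ϑ) : C →ₗ[R] TensorAlgebra R A :=
  Words.map X.pos.subtype ∘ₗ hϑ.barExt

theorem wordExt_mem (hϑ : IsTwistingCochain H X ϑ) {i : ℤ} {c : C} (hc : c ∈ H.gr i) :
    hϑ.wordExt c ∈ wordGr X.gr i :=
  map_mem_wordGr (fun _ _ h => h) (hϑ.barExt_mem hc)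

theorem algebraMapInv_wordExt (hϑ : IsTwistingCochain H X ϑ) (c : C) :
    TensorAlgebra.algebraMapInv (hϑ.wordExt c) = H.counit c := by
  rw [wordExt, LinearMap.comp_apply, algebraMapInv_map, hϑ.algebraMapInv_barExt]

theorem wordExt_rec (hϑ : IsTwistingCochain H X ϑ) (c : C) :
    hϑ.wordExt c = H.counit c • 1 + LinearMap.mul' R (TensorAlgebra R A)
      (TensorProduct.map (TensorAlgebra.ι R ∘ₗ ϑ) hϑ.wordExt (H.comul c)) := by
  rw [wordExt, LinearMap.comp_apply, hϑ.barExt_rec, map_add, map_smul, Words.map_one]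
  congr 1
  generalize H.comul c = z
  induction z with
  | zero => simp
  | add x y hx hy => simp only [map_add, hx, hy]
  | tmul x y =>
    rw [TensorProduct.map_tmul, LinearMap.mul'_apply, LinearMap.comp_apply, Words.map_cons,
      LinearMap.comp_apply, Submodule.subtype_apply, hϑ.coe_posProj]
    rfl

theorem letter_wordExt (hϑ : IsTwistingCochain H X ϑ) (c : C) :
    Words.letter (hϑ.wordExt c) = ϑ c := by
  conv_rhs => rw [← H.counit_right c]
  rw [hϑ.wordExt_rec, map_add, map_smul, Words.letter_one, smul_zero, zero_add]
  generalize H.comul c = z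
  induction z with
  | zero => simp
  | add x y hx hy => simp only [map_add, hx, hy]
  | tmul x y =>
    rw [TensorProduct.map_tmul, LinearMap.mul'_apply, LinearMap.comp_apply, Words.letter_cons,
      hϑ.algebraMapInv_wordExt]
    simp

/-- The pairing `(c₁, a ⊗ c₂) ↦ (-1)^|c₁| E(F c₁; [a|F c₂])`, where `F` is the comultiplicative
extension of `ϑ`. -/
def pairing (hϑ : IsTwistingCochain H X ϑ) : C →ₗ[R] A ⊗[R] C →ₗ[R] A :=
  (Words.evalOps X.E).compl₁₂ (hϑ.wordExt ∘ₗ H.sgn)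
    (LinearMap.mul' R (TensorAlgebra R A) ∘ₗ TensorProduct.map (TensorAlgebra.ι R) hϑ.wordExt)

theorem pairing_tmul (hϑ : IsTwistingCochain H X ϑ) (c₁ : C) (a : A) (c₂ : C) :
    hϑ.pairing c₁ (a ⊗ₜ c₂) =
      Words.evalOps X.E (hϑ.wordExt (H.sgn c₁)) (TensorAlgebra.ι R a * hϑ.wordExt c₂) := rfl

/-- On a letter `a` of positive degree the pairing is `E` on words of the bar construction. -/
theorem pairing_pos (hϑ : IsTwistingCochain H X ϑ) {i : ℤ} {c₁ : C} (hc₁ : c₁ ∈ H.gr i)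
    (a : X.pos) (c₂ : C) :
    X.barOps X.E (hϑ.barExt c₁ ⊗ₜ (TensorAlgebra.ι R a * hϑ.barExt c₂)) =
      koszulSign R i • hϑ.pairing c₁ ((a : A) ⊗ₜ c₂) := by
  rw [DGAlgebra.barOps_tmul, Words.map_cons, pairing_tmul, H.sgn_of_mem hc₁, map_smul, map_smul,
    LinearMap.smul_apply, smul_smul, koszulSign_mul_self, one_smul]
  rfl

theorem barOps_barExt_one (hϑ : IsTwistingCochain H X ϑ) (c : C) :
    X.barOps X.E (hϑ.barExt c ⊗ₜ 1) = ϑ c := by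
  rw [DGAlgebra.barOps_tmul, Words.map_one, evalOps_one_right]
  exact hϑ.letter_wordExt c

theorem pairing_mem (hϑ : IsTwistingCochain H X ϑ) {i k l : ℤ} {c₁ : C} {a : A} {c₂ : C}
    (hc₁ : c₁ ∈ H.gr i) (ha : a ∈ X.gr k) (hc₂ : c₂ ∈ H.gr l) :
    hϑ.pairing c₁ (a ⊗ₜ c₂) ∈ X.gr (i + k + l) := by
  have := evalOps_mem X (hϑ.wordExt_mem (H.sgn_mem hc₁))
    (cons_mem_wordGr ha (hϑ.wordExt_mem hc₂) rfl)
  rwa [show i + (k - 1 + l) + 1 = i + k + l by ring] at this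

theorem pairing_one_middle (hϑ : IsTwistingCochain H X ϑ) (c₁ c₂ : C) :
    hϑ.pairing c₁ (X.one ⊗ₜ c₂) = (H.counit c₁ * H.counit c₂) • X.one := by
  rw [pairing_tmul, evalOps_unit, hϑ.algebraMapInv_wordExt, hϑ.algebraMapInv_wordExt,
    H.counit_sgn]

/-- `E(F c₁; [a ϑ(c₂')|F c₂''])` comes from the term of the bar differential of `[a|F c₂]` that
multiplies the first two letters. -/
theorem barOps_mulHead (hϑ : IsTwistingCochain H X ϑ) {i : ℤ} {c₁ : C} (hc₁ : c₁ ∈ H.gr i)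
    (a : X.pos) (c₂ : C) :
    X.barOps X.E (hϑ.barExt c₁ ⊗ₜ X.mulHead a (hϑ.barExt c₂)) =
      koszulSign R i • hϑ.pairing c₁ (absorbMul X ϑ (prefixTmul (a : A) (H.comul c₂))) := by
  rw [hϑ.mulHead_barExt]
  generalize H.comul c₂ = z
  induction z with
  | zero => simp
  | add x y hx hy => simp only [map_add, TensorProduct.tmul_add, smul_add, hx, hy]
  | tmul x y =>
    rw [TensorProduct.map_tmul, LinearMap.mul'_apply, prefixTmul_tmul, absorbMul_tmul,
      LinearMap.comp_apply, hϑ.pairing_pos hc₁]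
    simp only [LinearMap.comp_apply]
    rw [X.toDGModule.coe_posProj (X.mul_mem_pos a ⟨ϑ x, hϑ.mem_pos x⟩)]

/-- The part of `E ⌣ E` on `F c₁ ⊗ [a|F c₂]` in which the letter `a` stays in the second factor. -/
theorem cupOps_head (hϑ : IsTwistingCochain H X ϑ) {i : ℤ} {z : C ⊗[R] C}
    (hz : z ∈ H.tensorGr H.toDGModule i) (a : X.pos) (c₂ : C) :
    X.cupOps (TensorProduct.map hϑ.barExt hϑ.barExt z ⊗ₜ
        (1 ⊗ₜ (TensorAlgebra.ι R a * hϑ.barExt c₂))) =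
      koszulSign R i • headMul X ϑ hϑ.pairing z ((a : A) ⊗ₜ c₂) := by
  refine H.tensorGr_induction H.toDGModule ?_ ?_ hz
  · intro p q x y hx hy hpq
    subst hpq
    rw [TensorProduct.map_tmul,
      X.cupOps_tmul (hϑ.barExt_mem hx) (hϑ.barExt_mem hy) IsWord.one.mem_wordGr,
      hϑ.barOps_barExt_one, hϑ.pairing_pos hy, headMul_tmul, map_smul, smul_smul,
      ← koszulSign_add]
    congr 2
    ring
  · intro x y hx hy
    rw [map_add, TensorProduct.add_tmul, map_add, map_add, hx, hy, LinearMap.add_apply, smul_add]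

end IsTwistingCochain

namespace IsMultiplicativeTwistingCochain

variable {H : DGHopfAlgebra R C} {X : HirschAlgebra R A} {ϑ : C →ₗ[R] A}

/-- The part of `E ⌣ E` on `F c₁ ⊗ [a|F c₂]` in which the letter `a` goes to the first factor; here
multiplicativity of `ϑ` evaluates the second factor `E(F c₁''; F c₂'')`. -/
theorem cupOps_tail (hϑ : IsMultiplicativeTwistingCochain H X ϑ) {i k : ℤ} {z : C ⊗[R] C}
    (hz : z ∈ H.tensorGr H.toDGModule i) {a : X.pos} (ha : (a : A) ∈ X.gr k) (w : C ⊗[R] C) :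
    X.cupOps (TensorProduct.map hϑ.barExt hϑ.barExt z ⊗ₜ
        LinearMap.rTensor X.Bar (LinearMap.mul R X.Bar (TensorAlgebra.ι R a))
          (TensorProduct.map hϑ.barExt hϑ.barExt w)) =
      - (koszulSign R i • tailMul X H ϑ hϑ.pairing z (prefixTmul (a : A) w)) := by
  refine H.tensorGr_induction H.toDGModule ?_ ?_ hz
  swap
  · intro x y hx hy
    rw [map_add, TensorProduct.add_tmul, map_add, map_add, hx, hy, LinearMap.add_apply, smul_add,
      neg_add]
  intro p q x y hx hy hpq
  subst hpq
  induction w using H.tensor_induction H.toDGModule with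
  | add w w' hw hw' =>
    rw [map_add, map_add, map_add, TensorProduct.tmul_add, map_add, hw, hw', map_add, smul_add,
      neg_add]
  | tmul l l' x₂ y₂ hx₂ hy₂ =>
  rw [TensorProduct.map_tmul, TensorProduct.map_tmul, LinearMap.rTensor_tmul,
    LinearMap.mul_apply', X.cupOps_tmul (hϑ.barExt_mem hx) (hϑ.barExt_mem hy)
      (cons_mem_wordGr (g := X.letterGr) ha (hϑ.barExt_mem hx₂) rfl),
    hϑ.barOps_barExt, hϑ.pairing_pos hx, prefixTmul_tmul, tailMul_tmul X H ϑ _ x hy,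
    signPow_apply _ q (map_sgn_tmul X.toDGModule H.toDGModule ha hx₂)]
  simp only [map_smul, LinearMap.smul_apply, X.sgn_of_mem (hϑ.pairing_mem hx ha hx₂), smul_smul]
  rw [← neg_smul]
  congr 1
  rw [show q * (k - 1 + l) + p + (k - 1 + l) = (q * (k + l) + p + (k + l)) - q - 1 by ring,
    show p + k + l = p + (k + l) by ring, ← koszulSign_add, ← koszulSign_add, ← koszulSign_add,
    ← koszulSign_succ]
  refine koszulSign_congr ?_
  simp only [Int.even_add, Int.even_sub]
  generalize Even (q * (k + l)) = P
  tauto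

theorem barExt_one (hϑ : IsMultiplicativeTwistingCochain H X ϑ) : hϑ.barExt H.one = 1 :=
  hϑ.map_one

theorem pairing_one_left (hϑ : IsMultiplicativeTwistingCochain H X ϑ) (a : A) (c₂ : C) :
    hϑ.pairing H.one (a ⊗ₜ c₂) = H.counit c₂ • a := by
  rw [IsTwistingCochain.pairing_tmul, H.sgn_one, IsTwistingCochain.wordExt,
    LinearMap.comp_apply, hϑ.barExt_one, Words.map_one, evalOps_one_left, Words.letter_cons,
    ← IsTwistingCochain.wordExt, hϑ.algebraMapInv_wordExt]

/-- The Hirsch identity for a letter `a` of positive degree: the equation `∇ E = - E ⌣ E` on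
`F c₁ ⊗ [a|F c₂]`, where `F` is a map of dg coalgebras. -/
theorem hirsch_pos (hϑ : IsMultiplicativeTwistingCochain H X ϑ) {i k : ℤ} {c₁ : C} {a : A}
    {c₂ : C} (hc₁ : c₁ ∈ H.gr i) (hk : 0 < k) (ha : a ∈ X.gr k) :
    X.d (hϑ.pairing c₁ (a ⊗ₜ c₂)) = hϑ.pairing (H.d c₁) (a ⊗ₜ c₂)
      + koszulSign R i • hϑ.pairing c₁ (X.d a ⊗ₜ c₂)
      - koszulSign R (i + k) • hϑ.pairing c₁ (absorbMul X ϑ (prefixTmul a (H.comul c₂)))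
      + koszulSign R (i + k) • hϑ.pairing c₁ (a ⊗ₜ H.d c₂)
      - headMul X ϑ hϑ.pairing (H.comul c₁) (a ⊗ₜ c₂)
      + tailMul X H ϑ hϑ.pairing (H.comul c₁) (prefixTmul a (H.comul c₂)) := by
  set b : X.pos := ⟨a, X.pos_of_mem hk ha⟩ with hb
  have hab : (b : A) = a := rfl
  have hd : X.posProj (X.d a) = ⟨X.d a, X.pos_of_mem (by omega) (X.d_mem k a ha)⟩ :=
    X.posProj_of_mem (by omega) (X.d_mem k a ha)
  have h := X.E_twisting (hϑ.barExt c₁ ⊗ₜ (TensorAlgebra.ι R b * hϑ.barExt c₂))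
  have hD : X.barD (TensorAlgebra.ι R b * hϑ.barExt c₂) =
      - (TensorAlgebra.ι R (X.posProj (X.d a)) * hϑ.barExt c₂) +
        koszulSign R k • X.mulHead b (hϑ.barExt c₂) -
        koszulSign R k • (TensorAlgebra.ι R b * hϑ.barExt (H.d c₂)) := by
    rw [← hϑ.barD_barExt, DGAlgebra.barD, Words.foldCons_cons, ← DGAlgebra.barD]
    simp only [LinearMap.sub_apply, LinearMap.neg_apply, LinearMap.comp_apply,
      LinearMap.mul_apply', Submodule.subtype_apply, X.letterSgn_of_mem (a := b) ha, map_smul,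
      LinearMap.smul_apply, koszulSign_succ, neg_smul, map_neg, hab]
    abel
  have hcup : TensorProduct.lift X.mul (TensorProduct.map (X.barOps X.E ∘ₗ X.barBarSgn)
      (X.barOps X.E) (X.barBarComul (hϑ.barExt c₁ ⊗ₜ (TensorAlgebra.ι R b * hϑ.barExt c₂)))) =
      koszulSign R i • headMul X ϑ hϑ.pairing (H.comul c₁) (a ⊗ₜ c₂) -
      koszulSign R i • tailMul X H ϑ hϑ.pairing (H.comul c₁) (prefixTmul a (H.comul c₂)) := by
    have e1 := hϑ.cupOps_head (H.comul_mem i c₁ hc₁) b c₂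
    have e2 := hϑ.cupOps_tail (H.comul_mem i c₁ hc₁) (a := b) ha (H.comul c₂)
    rw [sub_eq_add_neg, ← hab, ← e1, ← e2, ← map_add, ← TensorProduct.tmul_add,
      ← hϑ.deconcat_barExt, ← hϑ.deconcat_barExt, ← Words.deconcat_cons]
    rfl
  rw [hcup, DGAlgebra.barBarD, LinearMap.add_apply, TensorProduct.map_tmul,
    TensorProduct.map_tmul, hϑ.barD_barExt, X.barSgn_of_mem (hϑ.barExt_mem hc₁), hD, hd] at h
  simp only [map_add, LinearMap.id_apply, ← TensorProduct.smul_tmul', map_smul,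
    TensorProduct.tmul_add, TensorProduct.tmul_sub, TensorProduct.tmul_neg, map_neg, map_sub,
    TensorProduct.tmul_smul, hϑ.pairing_pos hc₁, hϑ.pairing_pos (H.d_mem i c₁ hc₁),
    hϑ.barOps_mulHead hc₁, koszulSign_succ, hab] at h
  rw [koszulSign_add]
  obtain hi | hi : koszulSign R i = 1 ∨ koszulSign R i = -1 := by
    rw [koszulSign_eq_ite]; split_ifs <;> simp
  · rw [hi] at h ⊢
    rw [← sub_eq_zero] at h ⊢
    rw [← h]
    module
  · rw [hi] at h ⊢
    rw [← sub_eq_zero] at h ⊢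
    rw [← neg_eq_zero, ← h]
    module

/-- The Hirsch identity for the letter `1`: here it says that `E(F c₁; F c₂) = ϑ(c₁ c₂)`, by
multiplicativity. -/
theorem hirsch_one (hϑ : IsMultiplicativeTwistingCochain H X ϑ) {i : ℤ} {c₁ c₂ : C}
    (hc₁ : c₁ ∈ H.gr i) :
    koszulSign R i • hϑ.pairing c₁ (absorbMul X ϑ (prefixTmul X.one (H.comul c₂))) =
      - headMul X ϑ hϑ.pairing (H.comul c₁) (X.one ⊗ₜ c₂)
      + tailMul X H ϑ hϑ.pairing (H.comul c₁) (prefixTmul X.one (H.comul c₂)) := by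
  have h1 : hϑ.pairing c₁ (absorbMul X ϑ (prefixTmul X.one (H.comul c₂))) =
      ϑ (H.mul (H.sgn c₁) c₂) - H.counit c₂ • ϑ (H.sgn c₁) := by
    have e : hϑ.pairing c₁ (absorbMul X ϑ (prefixTmul X.one (H.comul c₂))) =
        Words.evalOps X.E (hϑ.wordExt (H.sgn c₁)) (hϑ.wordExt c₂ - H.counit c₂ • 1) := by
      rw [hϑ.wordExt_rec c₂, add_sub_cancel_left]
      generalize H.comul c₂ = z
      induction z with
      | zero => simp
      | add x y hx hy => simp only [map_add, hx, hy]
      | tmul x y =>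
        rw [prefixTmul_tmul, absorbMul_tmul, X.one_mul, IsTwistingCochain.pairing_tmul]
        rfl
    rw [e, map_sub, map_smul, evalOps_one_right, hϑ.letter_wordExt, ← hϑ.barOps_barExt]
    rfl
  have h2 : headMul X ϑ hϑ.pairing (H.comul c₁) (X.one ⊗ₜ c₂) = H.counit c₂ • ϑ c₁ := by
    conv_rhs => rw [← H.counit_right c₁]
    generalize H.comul c₁ = z
    induction z with
    | zero => simp
    | add x y hx hy => simp only [map_add, LinearMap.add_apply, hx, hy, smul_add]
    | tmul x y =>
      rw [headMul_tmul, hϑ.pairing_one_middle, map_smul, X.mul_one, TensorProduct.map_tmul,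
        TensorProduct.rid_tmul, LinearMap.id_apply, map_smul, smul_smul, mul_comm]
  have h3 : tailMul X H ϑ hϑ.pairing (H.comul c₁) (prefixTmul X.one (H.comul c₂)) =
      ϑ (H.mul c₁ c₂) := by
    conv_rhs => rw [← H.counit_left c₁, ← H.counit_left c₂]
    generalize H.comul c₁ = z
    generalize H.comul c₂ = w
    induction z using H.tensor_induction H.toDGModule with
    | add x y hx hy => simp only [map_add, LinearMap.add_apply, hx, hy]
    | tmul p q x y hx hy =>
    induction w with
    | zero => simp
    | add x y hx hy => simp only [map_add, hx, hy]
    | tmul x₂ y₂ =>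
      have e : hϑ.pairing x (signPow (TensorProduct.map X.sgn H.sgn) q (X.one ⊗ₜ x₂)) =
          (H.counit x * H.counit x₂) • X.one := by
        unfold signPow
        split_ifs
        · exact hϑ.pairing_one_middle x x₂
        · rw [TensorProduct.map_tmul, X.sgn_one, hϑ.pairing_one_middle, H.counit_sgn]
      rw [prefixTmul_tmul, tailMul_tmul X H ϑ _ x hy, e, map_smul, X.sgn_one, map_smul,
        LinearMap.smul_apply, X.one_mul]
      simp [smul_smul, mul_comm]
  rw [h1, h2, h3, H.sgn_of_mem hc₁]
  simp only [map_smul, LinearMap.smul_apply, smul_sub, smul_smul]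
  rw [koszulSign_mul_self, mul_comm (H.counit c₂), ← mul_assoc, koszulSign_mul_self, one_mul,
    one_smul]
  abel

theorem isTwistedPairing (hϑ : IsMultiplicativeTwistingCochain H X ϑ) :
    IsTwistedPairing X H ϑ hϑ.pairing where
  mem _ _ _ _ _ _ hc₁ ha hc₂ := hϑ.pairing_mem hc₁ ha hc₂
  one_middle := hϑ.pairing_one_middle
  one_left := hϑ.pairing_one_left
  hirsch i k l c₁ a c₂ hc₁ ha hc₂ := by
    obtain hk | rfl | hk := lt_trichotomy k 0
    · rw [X.gr_neg k hk, Submodule.mem_bot] at ha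
      subst ha
      simp [prefixTmul]
    · rw [X.gr_zero, Submodule.mem_span_singleton] at ha
      obtain ⟨r, rfl⟩ := ha
      have h := hϑ.hirsch_one (c₂ := c₂) hc₁
      simp only [← TensorProduct.smul_tmul', map_smul, hϑ.pairing_one_middle, X.d_one,
        H.counit_d, prefixTmul_smul_left, smul_zero, TensorProduct.zero_tmul, map_zero,
        zero_mul, mul_zero, zero_smul, add_zero]
      rw [smul_comm, h]
      module
    · exact hϑ.hirsch_pos hc₁ hk ha

end IsMultiplicativeTwistingCochain

end Pairing

/-! ### Comparison with the explicit sum -/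

noncomputable section ExplicitSum

variable {R : Type u} [CommRing R] {A : Type v} [AddCommGroup A] [Module R A]
  {C : Type w} [AddCommGroup C] [Module R C] {M : Type x} [AddCommGroup M] [Module R M]
  {H : DGHopfAlgebra R C}

/-- By coassociativity, the iterated coaction is the coaction followed by the iterated
comultiplication. -/
theorem iterCoact_eq (Y : DGComoduleAlgebra H M) (ϑ : C →ₗ[R] A) (n : ℕ) (m : M) :
    iterCoact Y ϑ n m =
      TensorProduct.map (Words.coextComponent H.comul H.counit ϑ n) LinearMap.id (Y.coact m) := by
  induction n generalizing m with
  | zero =>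
    conv_lhs => rw [← Y.coact_counit m]
    rw [iterCoact]
    generalize Y.coact m = z
    induction z with
    | zero => simp
    | add x y hx hy => simp only [map_add, hx, hy]
    | tmul c m =>
      simp [Words.coextComponent, Algebra.algebraMap_eq_smul_one, TensorProduct.smul_tmul]
  | succ n ih =>
    have h : ∀ z : C ⊗[R] M, TensorProduct.map (LinearMap.mul' R (TensorAlgebra R A)) LinearMap.id
        ((TensorProduct.assoc R (TensorAlgebra R A) (TensorAlgebra R A) M).symm
          (TensorProduct.map (TensorAlgebra.ι R ∘ₗ ϑ) (iterCoact Y ϑ n) z)) =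
        TensorProduct.map (LinearMap.mul' R (TensorAlgebra R A) ∘ₗ TensorProduct.map
          (TensorAlgebra.ι R ∘ₗ ϑ) (Words.coextComponent H.comul H.counit ϑ n)) LinearMap.id
          ((TensorProduct.assoc R C C M).symm (TensorProduct.map LinearMap.id Y.coact z)) := by
      intro z
      induction z with
      | zero => simp
      | add x y hx hy => simp only [map_add, hx, hy]
      | tmul c m =>
        rw [TensorProduct.map_tmul, ih, TensorProduct.map_tmul, LinearMap.id_apply]
        generalize Y.coact m = z
        induction z with
        | zero => simp
        | add x y hx hy => simp only [map_add, TensorProduct.tmul_add, hx, hy]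
        | tmul c' m => rfl
    rw [iterCoact, LinearMap.comp_apply, LinearMap.comp_apply, LinearMap.comp_apply,
      LinearEquiv.coe_coe, h, coassoc_symm, TensorProduct.map_map, LinearMap.id_comp]
    rfl

theorem wordSgn_of_mem (X : HirschAlgebra R A) {n : ℤ} {t : TensorAlgebra R A}
    (ht : t ∈ wordGr X.gr n) : wordSgn X t = koszulSign R n • t := by
  induction ht using Submodule.span_induction with
  | zero => simp
  | add s t _ _ hs ht => rw [map_add, hs, ht, smul_add]
  | smul r t _ ht => rw [map_smul, ht, smul_comm]
  | mem t ht =>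
    induction ht with
    | one => rw [wordSgn, Words.map_one, koszulSign_zero, one_smul]
    | @cons i n m a t ha _ hm ih =>
      rw [wordSgn] at ih ⊢
      rw [Words.map_cons, ih, LinearMap.neg_apply, X.sgn_of_mem ha, ← neg_smul, ← koszulSign_succ,
        map_smul, smul_mul_smul_comm, ← koszulSign_add]
      congr 1
      refine koszulSign_congr ?_
      subst hm
      simp only [Int.even_add, Int.even_sub]

namespace IsTwistingCochain

variable {X : HirschAlgebra R A} {ϑ : C →ₗ[R] A}

theorem wordSgn_wordExt (hϑ : IsTwistingCochain H X ϑ) (c : C) :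
    wordSgn X (hϑ.wordExt c) = hϑ.wordExt (H.sgn c) := by
  induction c using H.homogeneous_induction with
  | zero => simp
  | add a b ha hb => simp only [map_add, ha, hb]
  | mem i c hc => rw [wordSgn_of_mem X (hϑ.wordExt_mem hc), H.sgn_of_mem hc, map_smul]

theorem map_coextComponent (hϑ : IsTwistingCochain H X ϑ) (n : ℕ) (c : C) :
    Words.map X.pos.subtype (Words.coextComponent H.comul H.counit (X.posProj ∘ₗ ϑ) n c) =
      Words.coextComponent H.comul H.counit ϑ n c := by
  induction n generalizing c with
  | zero =>
    simp [Words.coextComponent, Algebra.algebraMap_eq_smul_one, Words.map_one]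
  | succ n ih =>
    simp only [Words.coextComponent, LinearMap.comp_apply]
    generalize H.comul c = z
    induction z with
    | zero => simp
    | add x y hx hy => simp only [map_add, hx, hy]
    | tmul x y =>
      rw [TensorProduct.map_tmul, LinearMap.mul'_apply, LinearMap.comp_apply, Words.map_cons, ih,
        LinearMap.comp_apply, Submodule.subtype_apply, hϑ.coe_posProj]
      rfl

/-- The iterated coactions vanish eventually, and they add up to `∑ F c ⊗ m'`. -/
theorem exists_iterCoact (hϑ : IsTwistingCochain H X ϑ) (Y : DGComoduleAlgebra H M) (m : M) :
    ∃ N : ℕ, (∀ n, N ≤ n → iterCoact Y ϑ n m = 0) ∧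
      ∑ n ∈ Finset.range N, iterCoact Y ϑ n m =
        TensorProduct.map hϑ.wordExt LinearMap.id (Y.coact m) := by
  have h : ∀ z : C ⊗[R] M, ∃ N : ℕ, (∀ n, N ≤ n → TensorProduct.map
      (Words.coextComponent H.comul H.counit ϑ n) LinearMap.id z = 0) ∧
      ∀ n, N ≤ n → ∑ k ∈ Finset.range n, TensorProduct.map
        (Words.coextComponent H.comul H.counit ϑ k) LinearMap.id z =
          TensorProduct.map hϑ.wordExt LinearMap.id z := by
    intro z
    induction z with
    | zero => exact ⟨0, by simp, by simp⟩
    | add x y hx hy =>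
      obtain ⟨N, hN, hN'⟩ := hx
      obtain ⟨K, hK, hK'⟩ := hy
      refine ⟨max N K, fun n hn => ?_, fun n hn => ?_⟩
      · rw [map_add, hN n (by omega), hK n (by omega), add_zero]
      · simp only [map_add, Finset.sum_add_distrib]
        rw [hN' n (by omega), hK' n (by omega)]
    | tmul c m =>
      obtain ⟨N, hN⟩ := exists_coextComponent_eq_zero hϑ.posProj_comp_eq_zero c
      refine ⟨N, fun n hn => ?_, fun n hn => ?_⟩
      · rw [TensorProduct.map_tmul, ← hϑ.map_coextComponent, hN n hn, map_zero,
          TensorProduct.zero_tmul]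
      · simp only [TensorProduct.map_tmul, ← hϑ.map_coextComponent]
        rw [← TensorProduct.sum_tmul, ← map_sum,
          ← hϑ.barExt_eq_sum (fun k hk => hN k (hn.trans hk))]
        rfl
  obtain ⟨N, hN, hN'⟩ := h (Y.coact m)
  refine ⟨N, fun n hn => ?_, ?_⟩
  · rw [iterCoact_eq, hN n hn]
  · simp only [iterCoact_eq, hN' N le_rfl]

/-- The twisted product in terms of words. -/
theorem twistedMul_eq (hϑ : IsTwistingCochain H X ϑ) (Y : DGComoduleAlgebra H M) (a₁ : A) (m₁ : M)
    (a₂ : A) (m₂ : M) : twistedMul X Y hϑ.pairing (a₁ ⊗ₜ m₁) (a₂ ⊗ₜ m₂) =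
      leftMul X a₁
        (opsMul X Y (TensorProduct.map (wordSgn X) Y.even
            (TensorProduct.map hϑ.wordExt LinearMap.id (Y.coact m₁)))
          (consLeft a₂ (TensorProduct.map hϑ.wordExt LinearMap.id (Y.coact m₂))) +
        opsMul X Y (TensorProduct.map (wordSgn X) Y.odd
            (TensorProduct.map hϑ.wordExt LinearMap.id (Y.coact m₁)))
          (consLeft (X.sgn a₂) (TensorProduct.map (wordSgn X) LinearMap.id
            (TensorProduct.map hϑ.wordExt LinearMap.id (Y.coact m₂))))) := by
  rw [twistedMul_tmul, comoduleMul_tmul]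
  congr 1
  generalize Y.coact m₁ = z
  generalize Y.coact m₂ = w
  induction z with
  | zero => simp
  | add x y hx hy => simp only [map_add, LinearMap.add_apply, hx, hy]; abel
  | tmul c₁ m =>
  induction w with
  | zero => simp
  | add x y hx hy => simp only [map_add, hx, hy]; abel
  | tmul c₂ n =>
  simp only [smashMul, pairSgn, prefixTmul_tmul, LinearMap.add_apply, LinearMap.comp_apply,
    LinearMap.compl₁₂_apply, TensorProduct.map_tmul, LinearMap.id_apply, hϑ.wordSgn_wordExt]
  rfl

theorem twistedMul_eq_finsum (hϑ : IsTwistingCochain H X ϑ) (Y : DGComoduleAlgebra H M) (a₁ : A)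
    (m₁ : M) (a₂ : A) (m₂ : M) :
    (Function.support
      (fun k : ℕ × ℕ => twistedMulTerm X Y ϑ k.1 k.2 a₁ m₁ a₂ m₂)).Finite ∧
    twistedMul X Y hϑ.pairing (a₁ ⊗ₜ m₁) (a₂ ⊗ₜ m₂) =
      ∑ᶠ k : ℕ × ℕ, twistedMulTerm X Y ϑ k.1 k.2 a₁ m₁ a₂ m₂ := by
  obtain ⟨N, hN, hN'⟩ := hϑ.exists_iterCoact Y m₁
  obtain ⟨K, hK, hK'⟩ := hϑ.exists_iterCoact Y m₂
  have hs : (Function.support fun k : ℕ × ℕ => twistedMulTerm X Y ϑ k.1 k.2 a₁ m₁ a₂ m₂) ⊆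
      (Finset.range N ×ˢ Finset.range K : Finset (ℕ × ℕ)) := by
    rintro ⟨p, r⟩ hk
    by_contra h
    refine hk ?_
    have h' : N ≤ p ∨ K ≤ r := by
      by_contra! h'
      exact h (by simpa using h')
    obtain hp | hr := h'
    · simp [twistedMulTerm, hN p hp]
    · simp [twistedMulTerm, hK r hr]
  refine ⟨(Finset.finite_toSet _).subset hs, ?_⟩
  rw [finsum_eq_sum_of_support_subset _ hs, hϑ.twistedMul_eq, ← hN', ← hK', Finset.sum_product]
  simp only [twistedMulTerm, map_sum, LinearMap.sum_apply, map_add, Finset.sum_add_distrib]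
  congr 1 <;> exact Finset.sum_comm

end IsTwistingCochain

end ExplicitSum

theorem mainTheorem3 {R : Type*} [CommRing R]
    {A : Type*} [AddCommGroup A] [Module R A]
    {C : Type*} [AddCommGroup C] [Module R C]
    {M : Type*} [AddCommGroup M] [Module R M]
    (X : HirschAlgebra R A) (H : DGHopfAlgebra R C) (Y : DGComoduleAlgebra H M)
    (ϑ : C →ₗ[R] A) (hϑ : IsMultiplicativeTwistingCochain H X ϑ) :
    ∃ T : DGAlgebra R (A ⊗[R] M),
      (∀ n : ℤ, T.gr n = X.toDGModule.tensorGr Y.toDGModule n) ∧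
      T.d = twistedD X Y ϑ ∧
      T.one = X.one ⊗ₜ[R] Y.one ∧
      ∀ (a₁ : A) (m₁ : M) (a₂ : A) (m₂ : M),
        (Function.support
          (fun k : ℕ × ℕ => twistedMulTerm X Y ϑ k.1 k.2 a₁ m₁ a₂ m₂)).Finite ∧
        T.mul (a₁ ⊗ₜ[R] m₁) (a₂ ⊗ₜ[R] m₂) =
          ∑ᶠ k : ℕ × ℕ, twistedMulTerm X Y ϑ k.1 k.2 a₁ m₁ a₂ m₂ :=
  ⟨twistedAlgebra X Y hϑ.toIsTwistingCochain hϑ.isTwistedPairing, fun _ => rfl, rfl, rfl,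
    hϑ.toIsTwistingCochain.twistedMul_eq_finsum Y⟩
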